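/- Let $k$ be an algebraically closed field, let $Q$ be a finite quiver, and let $I\subseteq J^2$ be an ideal of the path algebra $kQ$ that is homogeneous for the grading by path length, where $J$ denotes the ideal generated by the arrows. Let $A=kQ/I=A_{(0)}\oplus A_{(1)}\oplus\cdots$ with the induced grading. Assume that $A$ is finite dimensional, has finite global dimension and is Koszul, i.e. the graded left $A$-module $A_{(0)}=A/(A_{(1)}\oplus A_{(2)}\oplus\cdots)$ has a minimal graded projective resolution $\cdots\to P^1\to P^0\to A_{(0)}\to 0$ with $P^i$ generated in degree $i$ for every $i\ge 0$. Let $E(A)=\bigoplus_{n\ge 0}\operatorname{Ext}^n_A(A_{(0)},A_{(0)})$ be its Yoneda algebra, with the Yoneda product. Then $A$ is simply connected if and only if $E(A)$ is simply connected. Here a presentation of a $k$-algebra $B$ is a pair $(Q_B,I_\mu)$ of a finite quiver and an ideal with $J^m\subseteq I_\mu\subseteq J^2$ for some $m$ such that $B\cong kQ_B/I_\mu$ as $k$-algebras. The algebra $B$ is called simply connected if it has a presentation and if, for every presentation $(Q_B,I_\mu)$ of $B$, the quiver $Q_B$ is non-empty, connected and without oriented cycles, and the fundamental group $\pi_1(Q_B,I_\mu)$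 is trivial. The group $\pi_1(Q_B,I_\mu)$ consists of the classes of closed walks at a vertex under the smallest equivalence relation on walks that is compatible with concatenation, cancels $\alpha\alpha^{-1}$ and $\alpha^{-1}\alpha$ for every arrow $\alpha$, and identifies any two parallel paths $w_i,w_j$ that occur in a common minimal relation, i.e. in a linear combination $\sum_{l} c_l w_l\in I_\mu$ of distinct parallel paths with all $c_l\neq 0$ no non-empty proper subsum of which lies in $I_\mu$. -/

import Mathlib

universe u v w

noncomputable section

open CategoryTheory

/-! ### The path algebra of a finite quiver -/

section PathAlgebra

/-- All paths of a quiver, with arbitrary end points (trivial paths included). -/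
abbrev AnyPath (V : Type) [Quiver.{0} V] : Type :=
  Σ a b : V, Quiver.Path a b

/-- The length of a path. -/
def AnyPath.length {V : Type} [Quiver.{0} V] (p : AnyPath V) : ℕ := p.2.2.length

/-- The path algebra `kQ`: the vector space with basis the paths of `Q`. -/
def PathAlgebra (k : Type u) [Field k] (V : Type) [Quiver.{0} V] : Type u :=
  AnyPath V →₀ k

namespace PathAlgebra

variable (k : Type u) [Field k] {V : Type} [Quiver.{0} V]

instance : AddCommGroup (PathAlgebra k V) := inferInstanceAs (AddCommGroup (AnyPath V →₀ k))

instance : Module k (PathAlgebra k V) := inferInstanceAs (Module k (AnyPath V →₀ k))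

/-- The basis element given by a path. -/
def ofPath (p : AnyPath V) : PathAlgebra k V := Finsupp.single p 1

/-- The linear combination of parallel paths `a → b` with the given coefficients. -/
def ofParallel {a b : V} (r : Quiver.Path a b →₀ k) : PathAlgebra k V :=
  Finsupp.mapDomain (fun p => (⟨a, b, p⟩ : AnyPath V)) r

open Classical in
/-- The product of two paths: their concatenation (first `p`, then `q`) if `p` ends where `q`
starts, and zero otherwise. -/
def mulPath (p q : AnyPath V) : PathAlgebra k V :=
  if h : p.2.1 = q.1 then ofPath k ⟨p.1, q.2.1, (p.2.2.cast rfl h).comp q.2.2⟩ else 0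

/-- Multiplication of the path algebra: the bilinear extension of `mulPath`. -/
def mulLin : PathAlgebra k V →ₗ[k] PathAlgebra k V →ₗ[k] PathAlgebra k V :=
  Finsupp.linearCombination k (fun p : AnyPath V =>
    (Finsupp.linearCombination k (fun q : AnyPath V => mulPath k p q) :
      (AnyPath V →₀ k) →ₗ[k] PathAlgebra k V))

instance : Mul (PathAlgebra k V) := ⟨fun x y => mulLin k x y⟩

instance [Fintype V] : One (PathAlgebra k V) :=
  ⟨∑ a : V, ofPath k ⟨a, a, Quiver.Path.nil⟩⟩

variable {k}

theorem mul_def (x y : PathAlgebra k V) : x * y = mulLin k x y := rfl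

theorem one_def [Fintype V] :
    (1 : PathAlgebra k V) = ∑ a : V, ofPath k ⟨a, a, Quiver.Path.nil⟩ := rfl

theorem ofPath_mul_ofPath (p q : AnyPath V) :
    ofPath k p * ofPath k q = mulPath k p q := by
  rw [mul_def, mulLin, ofPath, ofPath]
  erw [Finsupp.linearCombination_single, one_smul, Finsupp.linearCombination_single, one_smul]

theorem mulPath_of_ne {p q : AnyPath V} (h : p.2.1 ≠ q.1) : mulPath k p q = 0 := by
  simp [mulPath, h]

theorem mulPath_comp {a b c : V} (p : Quiver.Path a b) (q : Quiver.Path b c) :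
    mulPath k (⟨a, b, p⟩ : AnyPath V) ⟨b, c, q⟩ = ofPath k ⟨a, c, p.comp q⟩ := by
  simp [mulPath]

theorem linearMap_ext {M : Type*} [AddCommGroup M] [Module k M]
    {f g : PathAlgebra k V →ₗ[k] M} (h : ∀ p, f (ofPath k p) = g (ofPath k p)) : f = g :=
  Finsupp.lhom_ext' fun p => LinearMap.ext_ring (h p)

theorem mul_assoc_path (p q r : AnyPath V) :
    ofPath k p * ofPath k q * ofPath k r = ofPath k p * (ofPath k q * ofPath k r) := by
  obtain ⟨a, b, p⟩ := p
  obtain ⟨c, d, q⟩ := q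
  obtain ⟨e, f, r⟩ := r
  rw [ofPath_mul_ofPath, ofPath_mul_ofPath]
  by_cases h : b = c
  · subst h
    rw [mulPath_comp, ofPath_mul_ofPath]
    by_cases h' : d = e
    · subst h'
      rw [mulPath_comp, mulPath_comp, ofPath_mul_ofPath, mulPath_comp, Quiver.Path.comp_assoc]
    · rw [mulPath_of_ne h', mulPath_of_ne h', mul_def, map_zero]
  · rw [mulPath_of_ne h, mul_def, map_zero, LinearMap.zero_apply]
    by_cases h' : d = e
    · subst h'
      rw [mulPath_comp, ofPath_mul_ofPath, mulPath_of_ne h]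
    · rw [mulPath_of_ne h', mul_def, map_zero]

theorem induction {P : PathAlgebra k V → Prop} (zero : P 0)
    (add : ∀ x y, P x → P y → P (x + y)) (smul : ∀ (c : k) p, P (c • ofPath k p))
    (x : PathAlgebra k V) : P x := by
  refine Finsupp.induction_linear (motive := P) x zero add fun p c => ?_
  have h := smul c p
  have e : c • ofPath k p = (Finsupp.single p c : AnyPath V →₀ k) := by
    rw [ofPath]
    exact (Finsupp.smul_single_one p c)
  rwa [e] at h

instance [Fintype V] : Ring (PathAlgebra k V) where
  __ := (inferInstance : AddCommGroup (PathAlgebra k V))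
  left_distrib x y z := map_add (mulLin k x) y z
  right_distrib x y z := by simp [mul_def]
  zero_mul x := by simp [mul_def]
  mul_zero x := by simp [mul_def]
  mul_assoc x y z := by
    induction x using PathAlgebra.induction with
    | zero => simp [mul_def]
    | add x x' h h' => simp_all [mul_def]
    | smul a p =>
      induction y using PathAlgebra.induction with
      | zero => simp [mul_def]
      | add y y' h h' => simp_all [mul_def]
      | smul b q =>
        induction z using PathAlgebra.induction with
        | zero => simp [mul_def]
        | add z z' h h' => simp only [mul_def, map_add] at h h' ⊢; rw [h, h']
        | smul c r =>
          have h := mul_assoc_path (k := k) p q r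
          simp only [mul_def, map_smul, LinearMap.smul_apply] at h ⊢
          rw [h]
  one_mul x := by
    induction x using PathAlgebra.induction with
    | zero => simp [mul_def]
    | add x x' h h' => simp_all [mul_def]
    | smul c p =>
      obtain ⟨a, b, p⟩ := p
      rw [mul_def, map_smul, one_def, map_sum, LinearMap.sum_apply]
      congr 1
      rw [Finset.sum_eq_single a]
      · rw [← mul_def, ofPath_mul_ofPath, mulPath_comp, Quiver.Path.nil_comp]
      · intro d _ hd
        rw [← mul_def, ofPath_mul_ofPath, mulPath_of_ne hd]
      · simp
  mul_one x := by
    induction x using PathAlgebra.induction with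
    | zero => simp [mul_def]
    | add x x' h h' => simp_all [mul_def]
    | smul c p =>
      obtain ⟨a, b, p⟩ := p
      rw [mul_def, map_smul, LinearMap.smul_apply, one_def, map_sum]
      congr 1
      rw [Finset.sum_eq_single b]
      · rw [← mul_def, ofPath_mul_ofPath, mulPath_comp, Quiver.Path.comp_nil]
      · intro d _ hd
        rw [← mul_def, ofPath_mul_ofPath, mulPath_of_ne (Ne.symm hd)]
      · simp

instance [Fintype V] : Algebra k (PathAlgebra k V) :=
  Algebra.ofModule (fun c x y => by simp [mul_def]) (fun c x y => by simp [mul_def])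

end PathAlgebra

end PathAlgebra

/-! ### Bound quivers, presentations and the fundamental group -/

section BoundQuiver

variable {k : Type u} [Field k] {V : Type} [Fintype V] [Quiver.{0} V]

/-- `I ⊆ J²`, where `J` is the ideal generated by the arrows: since `J ^ n` is the span of the
paths of length at least `n`, this says that only paths of length at least two occur in the
elements of `I`. -/
def ContainedInArrowSquare (I : TwoSidedIdeal (PathAlgebra k V)) : Prop :=
  ∀ x ∈ I, ∀ p ∈ Finsupp.support (M := k) x, 2 ≤ AnyPath.length p

/-- Admissible ideals: `J ^ m ⊆ I ⊆ J ^ 2` for some `m`. -/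
def IsAdmissible (I : TwoSidedIdeal (PathAlgebra k V)) : Prop :=
  ContainedInArrowSquare I ∧
    ∃ m : ℕ, ∀ p : AnyPath V, m ≤ p.length → PathAlgebra.ofPath k p ∈ I

open Classical in
/-- `I` is homogeneous for the grading of `kQ` by the length of paths. -/
def IsLengthHomogeneous (I : TwoSidedIdeal (PathAlgebra k V)) : Prop :=
  ∀ x ∈ I, ∀ n : ℕ,
    (Finsupp.filter (M := k) (fun p : AnyPath V => p.length = n) x : PathAlgebra k V) ∈ I

/-- `(Q, I)` is a presentation of the algebra `B`: `I` is admissible and `B ≅ kQ / I`. -/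
def IsPresentation (I : TwoSidedIdeal (PathAlgebra k V)) (B : Type w) [Ring B] [Algebra k B] :
    Prop :=
  IsAdmissible I ∧ Nonempty (I.ringCon.Quotient ≃ₐ[k] B)

open Classical in
/-- A relation `r = ∑ cᵢ wᵢ ∈ I` between parallel paths `wᵢ : a → b` (with `cᵢ ≠ 0`) is minimal
if no non-empty proper subsum of it belongs to `I`. -/
def IsMinimalRelation (I : TwoSidedIdeal (PathAlgebra k V)) {a b : V}
    (r : Quiver.Path a b →₀ k) : Prop :=
  PathAlgebra.ofParallel k r ∈ I ∧
    ∀ s : Finset (Quiver.Path a b), s.Nonempty → s ⊂ r.support →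
      PathAlgebra.ofParallel k (r.filter (· ∈ s)) ∉ I

/-- The relation on the free groupoid of `Q` (walks up to cancellation of `α α⁻¹` and `α⁻¹ α`)
that identifies any two paths which occur in the same minimal relation of `I`. -/
inductive HomotopyStep (I : TwoSidedIdeal (PathAlgebra k V)) : HomRel (Quiver.FreeGroupoid V)
  | step {a b : V} (r : Quiver.Path a b →₀ k) (hr : IsMinimalRelation I r)
      (p q : Quiver.Path a b) (hp : p ∈ r.support) (hq : q ∈ r.support) :
      HomotopyStep I (composePath ((Quiver.FreeGroupoid.of V).mapPath p))
        (composePath ((Quiver.FreeGroupoid.of V).mapPath q))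

/-- The groupoid of homotopy classes of walks of the bound quiver `(Q, I)`. -/
abbrev HomotopyGroupoid (I : TwoSidedIdeal (PathAlgebra k V)) : Type :=
  CategoryTheory.Quotient (HomotopyStep I)

/-- The fundamental group `π₁(Q, I, x)`: the homotopy classes of closed walks at `x`, a group
under composition (the vertex group of the groupoid of homotopy classes of walks). -/
abbrev BoundQuiverFundamentalGroup (I : TwoSidedIdeal (PathAlgebra k V)) (x : V) : Type :=
  (⟨(Quiver.FreeGroupoid.of V).obj x⟩ : HomotopyGroupoid I) ⟶
    (⟨(Quiver.FreeGroupoid.of V).obj x⟩ : HomotopyGroupoid I)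

end BoundQuiver

/-- No oriented cycles. -/
def IsAcyclicQuiver (V : Type) [Quiver.{0} V] : Prop :=
  ∀ (a : V) (p : Quiver.Path a a), p.length = 0

/-- The underlying graph is connected (and non-empty). -/
def IsConnectedQuiver (V : Type) [Quiver.{0} V] : Prop :=
  Nonempty V ∧ ∀ a b : V,
    Nonempty (Quiver.Path (V := Quiver.Symmetrify V) (Quiver.Symmetrify.of.obj a)
      (Quiver.Symmetrify.of.obj b))

/-- Simply connected algebras: basic finite-dimensional algebras (that is, algebras that have a
presentation by a finite quiver and an admissible ideal) which are connected and triangular, and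
for which the fundamental group of every presentation is trivial. The quiver of a presentation of
`B` is always the ordinary quiver of `B`. -/
def IsSimplyConnectedAlgebra (k : Type u) [Field k] (B : Type w) [Ring B] [Algebra k B] : Prop :=
  (∃ (V : Type) (_ : Fintype V) (_ : Quiver.{0} V) (_ : ∀ a b : V, Finite (a ⟶ b))
    (I : TwoSidedIdeal (PathAlgebra k V)), IsPresentation I B) ∧
  ∀ (V : Type) [Fintype V] [Quiver.{0} V] [∀ a b : V, Finite (a ⟶ b)]
    (I : TwoSidedIdeal (PathAlgebra k V)), IsPresentation I B →
      IsConnectedQuiver V ∧ IsAcyclicQuiver V ∧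
        ∀ x : V, Subsingleton (BoundQuiverFundamentalGroup I x)

/-! ### Koszul algebras -/

section Koszul

variable {k : Type u} [Field k] {A : Type v} [Ring A] [Algebra k A]

/-- The graded algebra `A` is of the form `kQ / I`, where `Q` is a finite quiver, `I` is a
homogeneous ideal with generators in degrees at least two, and the grading is induced by the
length of paths. -/
def IsGradedQuiverAlgebra (𝒜 : ℕ → Submodule k A) : Prop :=
  ∃ (V : Type) (_ : Fintype V) (_ : Quiver.{0} V) (_ : ∀ a b : V, Finite (a ⟶ b))
    (I : TwoSidedIdeal (PathAlgebra k V)),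
    IsLengthHomogeneous I ∧ ContainedInArrowSquare I ∧
      ∃ e : I.ringCon.Quotient ≃ₐ[k] A, ∀ n : ℕ,
        𝒜 n = Submodule.span k
          {x | ∃ p : AnyPath V, p.length = n ∧
            x = e ((PathAlgebra.ofPath k p : PathAlgebra k V) : I.ringCon.Quotient)}

variable (𝒜 : ℕ → Submodule k A) [GradedAlgebra 𝒜]

/-- The left `A`-module `A₍₀₎ = A / (A₍₁₎ ⊕ A₍₂₎ ⊕ ⋯)`. -/
abbrev DegreeZeroModule : Type v := A ⧸ (HomogeneousIdeal.irrelevant 𝒜).toIdeal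

/-- A minimal graded projective resolution `⋯ → P 2 → P 1 → P 0 → A₍₀₎ → 0` in which `P i` is
generated in degree `i`. As `A` is positively graded, such a `P i` vanishes in degrees less
than `i`, so gradings indexed by natural numbers suffice. -/
structure LinearResolution where
  P : ℕ → Type v
  [addCommGroup : ∀ i, AddCommGroup (P i)]
  [module : ∀ i, Module A (P i)]
  grading : ∀ i, ℕ → AddSubgroup (P i)
  isInternal : ∀ i, DirectSum.IsInternal (grading i)
  smul_mem : ∀ (i m n : ℕ) (a : A) (x : P i), a ∈ 𝒜 m → x ∈ grading i n →
    a • x ∈ grading i (m + n)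
  projective : ∀ i, Module.Projective A (P i)
  d : ∀ i, P (i + 1) →ₗ[A] P i
  ε : P 0 →ₗ[A] DegreeZeroModule 𝒜
  d_mem : ∀ (i n : ℕ) (x : P (i + 1)), x ∈ grading (i + 1) n → d i x ∈ grading i n
  /-- `ε` has degree zero, `A₍₀₎` being concentrated in degree zero. -/
  ε_eq_zero : ∀ (n : ℕ) (x : P 0), n ≠ 0 → x ∈ grading 0 n → ε x = 0
  ε_surjective : Function.Surjective ε
  exact_zero : Function.Exact (d 0) ε
  exact_succ : ∀ i, Function.Exact (d (i + 1)) (d i)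
  minimal : ∀ (i : ℕ) (x : P (i + 1)),
    d i x ∈ (HomogeneousIdeal.irrelevant 𝒜).toIdeal • (⊤ : Submodule A (P i))
  generated : ∀ i, Submodule.span A (grading i i : Set (P i)) = ⊤

/-- Koszul algebras. -/
def IsKoszulAlgebra : Prop := Nonempty (LinearResolution 𝒜)

variable (A) in
/-- Finite global dimension: the projective dimensions of the finitely generated left modules
are bounded. -/
def HasFiniteGlobalDimension : Prop :=
  ∃ d : ℕ, ∀ M : ModuleCat.{v} A, Module.Finite A M → HasProjectiveDimensionLE M d

end Koszul

/-! ### The Yoneda algebra -/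

section Yoneda

open CategoryTheory.Abelian

/-- `⨁ n, Extⁿ(X, X)` for an object of an abelian category. -/
def ExtAlgebra {C : Type u} [Category.{v} C] [Abelian C] [HasExt.{w} C] (X : C) : Type w :=
  DirectSum ℕ fun n => Ext.{w} X X n

namespace ExtAlgebra

variable {C : Type u} [Category.{v} C] [Abelian C] [HasExt.{w} C] (X : C)

/-- The Yoneda product `α * β = α ∘ β` (first `β`, then `α`). -/
instance : GradedMonoid.GMul fun n => Ext.{w} X X n where
  mul {a b} α β := β.comp α (add_comm b a)

instance : GradedMonoid.GOne fun n => Ext.{w} X X n where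
  one := Ext.mk₀ (𝟙 X)

theorem mk_comp_id {n m : ℕ} (α : Ext.{w} X X n) (h : n + 0 = m) :
    (⟨m, α.comp (Ext.mk₀ (𝟙 X)) h⟩ : GradedMonoid fun n => Ext.{w} X X n) = ⟨n, α⟩ := by
  obtain rfl : n = m := h
  simp

theorem mk_id_comp {n m : ℕ} (α : Ext.{w} X X n) (h : 0 + n = m) :
    (⟨m, (Ext.mk₀ (𝟙 X)).comp α h⟩ : GradedMonoid fun n => Ext.{w} X X n) = ⟨n, α⟩ := by
  obtain rfl : n = m := by omega
  simp

theorem mk_assoc {a b c ab bc m m' : ℕ} (α : Ext.{w} X X a) (β : Ext.{w} X X b)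
    (γ : Ext.{w} X X c) (h₁ : a + b = ab) (h₂ : b + c = bc) (h : ab + c = m)
    (h' : a + bc = m') :
    (⟨m', α.comp (β.comp γ h₂) h'⟩ : GradedMonoid fun n => Ext.{w} X X n) =
      ⟨m, (α.comp β h₁).comp γ h⟩ := by
  obtain rfl : m = m' := by omega
  rw [Ext.comp_assoc α β γ h₁ h₂ (by omega)]

instance : DirectSum.GRing fun n => Ext.{w} X X n where
  mul_zero _ := Ext.zero_comp _ _ _ _ _
  zero_mul _ := Ext.comp_zero _ _ _ _ _
  mul_add _ _ _ := Ext.add_comp _ _ _ _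
  add_mul _ _ _ := Ext.comp_add _ _ _ _
  one_mul α := mk_comp_id X α.2 _
  mul_one α := mk_id_comp X α.2 _
  mul_assoc α β γ := mk_assoc X γ.2 β.2 α.2 (add_comm _ _) (add_comm _ _) _ _
  natCast n := n • Ext.mk₀ (𝟙 X)
  natCast_zero := zero_smul _ _
  natCast_succ n := succ_nsmul _ n
  intCast n := n • Ext.mk₀ (𝟙 X)
  intCast_ofNat n := natCast_zsmul _ n
  intCast_negSucc_ofNat n := negSucc_zsmul _ n

instance : Ring (ExtAlgebra X) :=
  inferInstanceAs (Ring (DirectSum ℕ fun n => Ext.{w} X X n))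

variable {k : Type*} [CommRing k] [Linear k C]

theorem mk_comp_smul_id {n m : ℕ} (c : k) (α : Ext.{w} X X n) (h : n + 0 = m) :
    (⟨m, α.comp (c • Ext.mk₀ (𝟙 X)) h⟩ : GradedMonoid fun n => Ext.{w} X X n) =
      ⟨n, c • α⟩ := by
  rw [Ext.comp_smul, ← Ext.smul_comp, mk_comp_id]

theorem mk_smul_id_comp {n m : ℕ} (c : k) (α : Ext.{w} X X n) (h : 0 + n = m) :
    (⟨m, (c • Ext.mk₀ (𝟙 X)).comp α h⟩ : GradedMonoid fun n => Ext.{w} X X n) =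
      ⟨n, c • α⟩ := by
  rw [Ext.smul_comp, ← Ext.comp_smul, mk_id_comp]

instance : DirectSum.GAlgebra k fun n => Ext.{w} X X n where
  toFun :=
    { toFun c := c • Ext.mk₀ (𝟙 X)
      map_zero' := zero_smul _ _
      map_add' c d := add_smul _ _ _ }
  map_one := one_smul k (Ext.mk₀ (𝟙 X))
  map_mul c d := by
    refine Eq.trans ?_ (mk_comp_smul_id X c (d • Ext.mk₀ (𝟙 X)) (add_comm 0 0)).symm
    rw [smul_smul]
    rfl
  commutes c α :=
    (mk_comp_smul_id X c α.2 (add_comm α.1 0)).trans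
      (mk_smul_id_comp X c α.2 (add_comm 0 α.1)).symm
  smul_def c α := (mk_comp_smul_id X c α.2 (add_comm α.1 0)).symm

instance : Algebra k (ExtAlgebra X) :=
  inferInstanceAs (Algebra k (DirectSum ℕ fun n => Ext.{w} X X n))

end ExtAlgebra

/-- The Yoneda algebra `E(A) = ⨁ n, Extⁿ_A(A₍₀₎, A₍₀₎)` of a graded algebra. -/
abbrev YonedaAlgebra {k : Type u} [Field k] {A : Type v} [Ring A] [Algebra k A]
    (𝒜 : ℕ → Submodule k A) [GradedAlgebra 𝒜] : Type v :=
  ExtAlgebra (ModuleCat.of A (DegreeZeroModule 𝒜))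

end Yoneda

end

/-! Homotopy classes of paths grade the path algebra. Every element of an ideal `I` is a sum of
minimal relations, and each minimal relation lies in a single class, so `I` is homogeneous for its
own classes (`isHomogeneous_homotopyDegree`). Conversely, if an ideal `I'` on the same quiver is
homogeneous for the classes of `I`, then its minimal relations identify only paths that `I` already
identifies, so π₁(Q, I) is a quotient of π₁(Q, I')
(`subsingleton_fundamentalGroup_of_isHomogeneous`). It therefore suffices to attach to every
presentation of one of the algebras A, E(A) a presentation of the other one, on the same quiver,
whose ideal is homogeneous for the homotopy classes of the first. Connectedness and acyclicity then
transfer because the quiver is the same.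

The companion is built in two stages. An arbitrary presentation need not respect the grading.
However, the powers of the arrow ideal map onto the filtration by degree, so replacing arrows by
their leading terms, and relations by their initial forms, gives a graded presentation on the same
quiver. Passing to initial forms preserves homogeneity for any classification of paths
(`exists_isGradedPresentation`).

The second stage is Koszul duality. Write S for A₍₀₎. The linear resolution identifies Extⁿ(S, S)
with the dual of the degree-n part of Pⁿ, and left multiplication by classes in Ext¹ is dual to the
differential. Exactness then shows that E(A) is generated in degrees zero and one, and that its
relations are generated by the elements ∑ φ(x_α x_β) αβ, with φ a linear form on A. These form the
orthogonal complement of the quadratic relations of A (`ker_le_span_quadraticDual`,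
`sum_mul_eq_zero`). The relations of A are themselves generated by the quadratic ones
(`ker_le_span_quadratic`). Since orthogonal complements with respect to the basis of paths respect
homogeneity, it passes in both directions (`isHomogeneous`, `isHomogeneous_of_dual`). Every graded
presentation of E(A) is dual to one of A, by taking a dual basis of A₍₁₎
(`exists_isYonedaDual_of_yoneda`).

Finite dimension of A and finite global dimension bound the gradings of A and of E(A), which makes
the kernels of the graded presentations admissible. -/

noncomputable section

open CategoryTheory CategoryTheory.Abelian

/-! ### Coefficients, projections and the universal property of the path algebra. -/

namespace PathAlgebra

variable {k : Type u} [Field k] {V : Type} [Quiver.{0} V]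

/-- The coefficient of a path, as a linear form. -/
def coeff (p : AnyPath V) : PathAlgebra k V →ₗ[k] k := Finsupp.lapply p

open Classical in
/-- The projection onto the span of the paths that satisfy `s`. -/
def restrict (s : AnyPath V → Prop) : PathAlgebra k V →ₗ[k] PathAlgebra k V where
  toFun x := Finsupp.filter (M := k) s x
  map_add' _ _ := Finsupp.filter_add
  map_smul' _ _ := Finsupp.filter_smul

open Classical in
theorem coeff_ofPath (p q : AnyPath V) : coeff p (ofPath k q) = if q = p then 1 else 0 := by
  change (Finsupp.single q (1 : k)) p = _
  rw [Finsupp.single_apply]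

theorem ext_coeff {x y : PathAlgebra k V} (h : ∀ p, coeff p x = coeff p y) : x = y :=
  Finsupp.ext h

open Classical in
theorem coeff_restrict (s : AnyPath V → Prop) (p : AnyPath V) (x : PathAlgebra k V) :
    coeff p (restrict s x) = if s p then coeff p x else 0 :=
  Finsupp.filter_apply s x p

open Classical in
theorem restrict_ofPath (s : AnyPath V → Prop) (p : AnyPath V) :
    restrict s (ofPath k p) = if s p then ofPath k p else 0 := by
  apply ext_coeff
  intro q
  rw [coeff_restrict]
  by_cases h : p = q
  · subst h; split_ifs <;> simp
  · split_ifs <;> simp [coeff_ofPath, h]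

theorem restrict_restrict (s t : AnyPath V → Prop) (x : PathAlgebra k V) :
    restrict s (restrict t x) = restrict (fun p => s p ∧ t p) x := by
  classical
  apply ext_coeff
  intro q
  simp only [coeff_restrict]
  split_ifs <;> simp_all

theorem restrict_zero_add_restrict_one (x : PathAlgebra k V) :
    restrict (fun p => p.length = 0) x + restrict (fun p => 1 ≤ p.length) x = x := by
  apply ext_coeff
  intro p
  rw [map_add, coeff_restrict, coeff_restrict]
  by_cases h : p.length = 0
  · rw [if_pos h, if_neg (by omega), add_zero]
  · rw [if_neg h, if_pos (by omega), zero_add]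

theorem mem_support_iff (x : PathAlgebra k V) (p : AnyPath V) :
    p ∈ Finsupp.support (M := k) x ↔ coeff p x ≠ 0 := Finsupp.mem_support_iff

/-- The sum over all paths of a family of linear maps is a linear map. -/
def ofFamily {M : Type*} [AddCommGroup M] [Module k M] (f : AnyPath V → M) :
    PathAlgebra k V →ₗ[k] M := Finsupp.linearCombination k f

theorem ofFamily_ofPath {M : Type*} [AddCommGroup M] [Module k M] (f : AnyPath V → M)
    (p : AnyPath V) : ofFamily f (ofPath k p) = f p := by
  refine (Finsupp.linearCombination_single k (1 : k) p).trans (one_smul _ _)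

/-- The trivial path at a vertex. -/
abbrev vertex (a : V) : AnyPath V := ⟨a, a, Quiver.Path.nil⟩

/-- An arrow as a path. -/
abbrev arrow {a b : V} (α : a ⟶ b) : AnyPath V := ⟨a, b, α.toPath⟩

theorem comp_mul {a b c : V} (p : Quiver.Path a b) (q : Quiver.Path b c) :
    ofPath k (⟨a, b, p⟩ : AnyPath V) * ofPath k ⟨b, c, q⟩ = ofPath k ⟨a, c, p.comp q⟩ := by
  rw [ofPath_mul_ofPath, mulPath_comp]

theorem mul_of_ne {p q : AnyPath V} (h : p.2.1 ≠ q.1) : ofPath k p * ofPath k q = 0 := by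
  rw [ofPath_mul_ofPath, mulPath_of_ne h]

theorem length_comp {a b c : V} (p : Quiver.Path a b) (q : Quiver.Path b c) :
    AnyPath.length (⟨a, c, p.comp q⟩ : AnyPath V) =
      AnyPath.length (⟨a, b, p⟩ : AnyPath V) + AnyPath.length (⟨b, c, q⟩ : AnyPath V) :=
  Quiver.Path.length_comp p q

theorem eq_vertex_of_length {p : AnyPath V} (h : p.length = 0) : p = vertex p.1 := by
  obtain ⟨a, b, p⟩ := p
  cases p with
  | nil => rfl
  | cons p α => simp [AnyPath.length] at h

theorem exists_cons_of_length {p : AnyPath V} {n : ℕ} (h : p.length = n + 1) :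
    ∃ (a b c : V) (q : Quiver.Path a b) (α : b ⟶ c), p = ⟨a, c, q.comp α.toPath⟩ ∧
      AnyPath.length (⟨a, b, q⟩ : AnyPath V) = n := by
  obtain ⟨a, b, p⟩ := p
  cases p with
  | nil => simp [AnyPath.length] at h
  | cons p α =>
    refine ⟨a, _, b, p, α, by rw [Quiver.Path.comp_toPath_eq_cons], ?_⟩
    simpa [AnyPath.length] using h

theorem exists_comp_of_length {p : AnyPath V} {n : ℕ} (h : p.length = n + 1) :
    ∃ (a b c : V) (α : a ⟶ b) (q : Quiver.Path b c), p = ⟨a, c, α.toPath.comp q⟩ ∧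
      AnyPath.length (⟨b, c, q⟩ : AnyPath V) = n := by
  induction n generalizing p with
  | zero =>
    obtain ⟨a, b, c, q, α, rfl, hq⟩ := exists_cons_of_length h
    have hb : b = a := by
      cases q with
      | nil => rfl
      | cons q β => simp [AnyPath.length] at hq
    subst hb
    have : q = Quiver.Path.nil := Quiver.Path.eq_nil_of_length_zero q hq
    subst this
    exact ⟨b, c, c, α, .nil, by rw [Quiver.Path.nil_comp, Quiver.Path.comp_nil], rfl⟩
  | succ n ih =>
    obtain ⟨a, b, c, q, β, rfl, hq⟩ := exists_cons_of_length h
    obtain ⟨a', b', c', α, q', h', hq'⟩ := ih hq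
    simp only [Sigma.mk.injEq] at h'
    obtain ⟨rfl, h'⟩ := h'
    simp only [heq_eq_eq, Sigma.mk.injEq] at h'
    obtain ⟨rfl, h'⟩ := h'
    simp only [heq_eq_eq] at h'
    subst h'
    refine ⟨_, _, _, α, q'.comp β.toPath, by rw [Quiver.Path.comp_assoc], ?_⟩
    rw [length_comp, hq']
    rfl

variable [Fintype V]

/-- An algebra homomorphism from the path algebra, given by its values on paths. -/
def algHomOfPath {B : Type*} [Ring B] [Algebra k B] (f : AnyPath V → B)
    (one : ∑ a, f (vertex a) = 1)
    (comp : ∀ {a b c : V} (p : Quiver.Path a b) (q : Quiver.Path b c),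
      f ⟨a, c, p.comp q⟩ = f ⟨a, b, p⟩ * f ⟨b, c, q⟩)
    (ne : ∀ p q : AnyPath V, p.2.1 ≠ q.1 → f p * f q = 0) : PathAlgebra k V →ₐ[k] B :=
  AlgHom.ofLinearMap (ofFamily f)
    (by rw [one_def, map_sum]; simp only [ofFamily_ofPath]; exact one)
    (by
      intro x y
      induction x using PathAlgebra.induction with
      | zero => simp
      | add x x' h h' => rw [add_mul, map_add, h, h', map_add, add_mul]
      | smul c p =>
        induction y using PathAlgebra.induction with
        | zero => simp
        | add y y' h h' => rw [mul_add, map_add, h, h', map_add, mul_add]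
        | smul d q =>
          rw [smul_mul_smul_comm, map_smul, map_smul, map_smul, smul_mul_smul_comm]
          congr 1
          obtain ⟨a, b, p⟩ := p
          obtain ⟨b', c, q⟩ := q
          rw [ofFamily_ofPath, ofFamily_ofPath]
          by_cases h : b = b'
          · subst h
            rw [comp_mul, ofFamily_ofPath, comp]
          · rw [mul_of_ne h, map_zero, ne _ _ h])

theorem algHomOfPath_ofPath {B : Type*} [Ring B] [Algebra k B] (f : AnyPath V → B) (one comp ne)
    (p : AnyPath V) : algHomOfPath (k := k) f one comp ne (ofPath k p) = f p :=
  ofFamily_ofPath f p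

/-- The image of a path under the assignment of `e a` to the vertices and `x α` to the arrows. -/
def evalPath {B : Type*} [Ring B] (e : V → B) (x : ∀ a b : V, (a ⟶ b) → B) {a : V} :
    ∀ {b : V}, Quiver.Path a b → B
  | _, .nil => e a
  | _, .cons p α => evalPath e x p * x _ _ α

section lift

variable {B : Type*} [Ring B] [Algebra k B] {e : V → B} {x : ∀ a b : V, (a ⟶ b) → B}
  (he : ∀ a, e a * e a = e a) (hne : ∀ a b, a ≠ b → e a * e b = 0)
  (hone : ∑ a, e a = 1) (hl : ∀ a b α, e a * x a b α = x a b α)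
  (hr : ∀ a b α, x a b α * e b = x a b α)

include he in
omit [Fintype V] [Algebra k B] in
theorem vertex_mul_evalPath {a b : V} (p : Quiver.Path a b) :
    e a * evalPath e x p = evalPath e x p := by
  induction p with
  | nil => exact he a
  | cons p α ih => rw [evalPath, ← mul_assoc, ih]

include he hr in
omit [Fintype V] [Algebra k B] in
theorem evalPath_mul_vertex {a b : V} (p : Quiver.Path a b) :
    evalPath e x p * e b = evalPath e x p := by
  cases p with
  | nil => exact he a
  | cons p α => rw [evalPath, mul_assoc, hr]

include he hr in
omit [Fintype V] [Algebra k B] in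
theorem evalPath_comp {a b c : V} (p : Quiver.Path a b) (q : Quiver.Path b c) :
    evalPath e x (p.comp q) = evalPath e x p * evalPath e x q := by
  induction q with
  | nil => exact (evalPath_mul_vertex he hr p).symm
  | cons q α ih => rw [Quiver.Path.comp_cons, evalPath, ih, evalPath, mul_assoc]

/-- The universal property of the path algebra. -/
def lift : PathAlgebra k V →ₐ[k] B :=
  algHomOfPath (fun p => evalPath e x p.2.2) hone (fun p q => evalPath_comp he hr p q)
    (fun p q h => by
      rw [← evalPath_mul_vertex he hr p.2.2, ← vertex_mul_evalPath he q.2.2, mul_assoc,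
        ← mul_assoc (e _), hne _ _ h, zero_mul, mul_zero])

theorem lift_ofPath (p : AnyPath V) :
    lift (k := k) he hne hone hr (ofPath k p) = evalPath e x p.2.2 :=
  algHomOfPath_ofPath _ _ _ _ p

theorem lift_vertex (a : V) : lift (k := k) he hne hone hr (ofPath k (vertex a)) = e a :=
  lift_ofPath he hne hone hr _

include hl in
theorem lift_arrow {a b : V} (α : a ⟶ b) :
    lift (k := k) he hne hone hr (ofPath k (arrow α)) = x a b α := by
  rw [lift_ofPath]
  exact hl a b α

end lift

/-- This is `J ^ m * J ^ n ⊆ J ^ (m + n)`, with membership in a power of the arrow ideal expressed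
as being fixed by a projection. -/
theorem restrict_mul_restrict (m n : ℕ) (x y : PathAlgebra k V) :
    restrict (fun p => m + n ≤ p.length)
      (restrict (fun p => m ≤ p.length) x * restrict (fun p => n ≤ p.length) y) =
      restrict (fun p => m ≤ p.length) x * restrict (fun p => n ≤ p.length) y := by
  induction x using PathAlgebra.induction with
  | zero => simp
  | add x x' h h' => rw [map_add, add_mul, map_add, h, h']
  | smul c p =>
    induction y using PathAlgebra.induction with
    | zero => simp
    | add y y' h h' => rw [map_add, mul_add, map_add, h, h']
    | smul d q =>
      rw [map_smul, map_smul, smul_mul_smul_comm, map_smul]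
      congr 1
      rw [restrict_ofPath, restrict_ofPath]
      split_ifs with h h'
      · obtain ⟨a, b, p⟩ := p
        obtain ⟨b', c, q⟩ := q
        by_cases hb : b = b'
        · subst hb
          rw [comp_mul, restrict_ofPath, if_pos]
          rw [length_comp]
          omega
        · rw [mul_of_ne (by exact hb), map_zero]
      · simp
      · simp
      · simp

end PathAlgebra

/-! ### Classifications of paths and homogeneous ideals. -/

/-- A classification of the paths of a quiver that is compatible with composition and satisfies
the cancellation laws. -/
structure PathDegree (V : Type) [Quiver.{0} V] where
  /-- The classes. -/
  T : Type
  /-- The class of a path. -/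
  cls : AnyPath V → T
  comp_left : ∀ {a b c c' : V} (p : Quiver.Path a b) (q : Quiver.Path b c) (q' : Quiver.Path b c'),
    cls ⟨a, c, p.comp q⟩ = cls ⟨a, c', p.comp q'⟩ ↔ cls ⟨b, c, q⟩ = cls ⟨b, c', q'⟩
  comp_right : ∀ {a a' b c : V} (q : Quiver.Path a b) (q' : Quiver.Path a' b)
    (p : Quiver.Path b c),
    cls ⟨a, c, q.comp p⟩ = cls ⟨a', c, q'.comp p⟩ ↔ cls ⟨a, b, q⟩ = cls ⟨a', b, q'⟩

namespace PathDegree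

open PathAlgebra

variable {k : Type u} [Field k] {V : Type} [Quiver.{0} V] (Γ : PathDegree V)

/-- The component of an element of the path algebra in a class. -/
def component (t : Γ.T) : PathAlgebra k V →ₗ[k] PathAlgebra k V :=
  restrict fun p => Γ.cls p = t

/-- By the cancellation law `comp_left`, multiplication by `p` sends distinct classes to distinct
classes, so no other component of `x` contributes. -/
theorem component_mul_left {a b c : V} (p : Quiver.Path a b) (q : Quiver.Path b c)
    (x : PathAlgebra k V) :
    Γ.component (Γ.cls ⟨a, c, p.comp q⟩) (ofPath k ⟨a, b, p⟩ * x) =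
      ofPath k ⟨a, b, p⟩ * Γ.component (Γ.cls ⟨b, c, q⟩) x := by
  have h : Γ.component (Γ.cls ⟨a, c, p.comp q⟩) ∘ₗ mulLin k (ofPath k ⟨a, b, p⟩) =
      mulLin k (ofPath k ⟨a, b, p⟩) ∘ₗ Γ.component (Γ.cls ⟨b, c, q⟩) := by
    apply linearMap_ext
    rintro ⟨b', c', q'⟩
    simp only [LinearMap.comp_apply, ← mul_def]
    by_cases hb : b = b'
    · subst hb
      rw [comp_mul, component, component, restrict_ofPath, restrict_ofPath, Γ.comp_left]
      split_ifs
      · rw [comp_mul]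
      · rw [mul_def, map_zero]
    · rw [mul_of_ne (by exact hb), map_zero, component, restrict_ofPath]
      split_ifs
      · rw [mul_of_ne (by exact hb)]
      · rw [mul_def, map_zero]
  exact LinearMap.congr_fun h x

theorem component_mul_right {a b c : V} (q : Quiver.Path a b) (p : Quiver.Path b c)
    (x : PathAlgebra k V) :
    Γ.component (Γ.cls ⟨a, c, q.comp p⟩) (x * ofPath k ⟨b, c, p⟩) =
      Γ.component (Γ.cls ⟨a, b, q⟩) x * ofPath k ⟨b, c, p⟩ := by
  have h : Γ.component (Γ.cls ⟨a, c, q.comp p⟩) ∘ₗ (mulLin k).flip (ofPath k ⟨b, c, p⟩) =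
      (mulLin k).flip (ofPath k ⟨b, c, p⟩) ∘ₗ Γ.component (Γ.cls ⟨a, b, q⟩) := by
    apply linearMap_ext
    rintro ⟨a', b', q'⟩
    simp only [LinearMap.comp_apply, LinearMap.flip_apply, ← mul_def]
    by_cases hb : b' = b
    · subst hb
      rw [comp_mul, component, component, restrict_ofPath, restrict_ofPath, Γ.comp_right]
      split_ifs
      · rw [comp_mul]
      · rw [mul_def, map_zero, LinearMap.zero_apply]
    · rw [mul_of_ne (by exact hb), map_zero, component, restrict_ofPath]
      split_ifs
      · rw [mul_of_ne (by exact hb)]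
      · rw [mul_def, map_zero, LinearMap.zero_apply]
  exact LinearMap.congr_fun h x

theorem component_mul_left_eq_zero (t : Γ.T) {a b : V} (p : Quiver.Path a b)
    (h : ∀ (c : V) (q : Quiver.Path b c), Γ.cls ⟨a, c, p.comp q⟩ ≠ t) (x : PathAlgebra k V) :
    Γ.component t (ofPath k ⟨a, b, p⟩ * x) = 0 := by
  have h : Γ.component t ∘ₗ mulLin k (ofPath k ⟨a, b, p⟩) = 0 := by
    apply linearMap_ext
    rintro ⟨b', c', q'⟩
    simp only [LinearMap.comp_apply, ← mul_def]
    by_cases hb : b = b'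
    · subst hb
      rw [comp_mul, component, restrict_ofPath, if_neg (h _ _), LinearMap.zero_apply]
    · rw [mul_of_ne (by exact hb), map_zero, LinearMap.zero_apply]
  exact LinearMap.congr_fun h x

theorem component_mul_right_eq_zero (t : Γ.T) {b c : V} (p : Quiver.Path b c)
    (h : ∀ (a : V) (q : Quiver.Path a b), Γ.cls ⟨a, c, q.comp p⟩ ≠ t) (x : PathAlgebra k V) :
    Γ.component t (x * ofPath k ⟨b, c, p⟩) = 0 := by
  have h : Γ.component t ∘ₗ (mulLin k).flip (ofPath k ⟨b, c, p⟩) = 0 := by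
    apply linearMap_ext
    rintro ⟨a', b', q'⟩
    simp only [LinearMap.comp_apply, LinearMap.flip_apply, ← mul_def]
    by_cases hb : b' = b
    · subst hb
      rw [comp_mul, component, restrict_ofPath, if_neg (h _ _), LinearMap.zero_apply]
    · rw [mul_of_ne (by exact hb), map_zero, LinearMap.zero_apply]
  exact LinearMap.congr_fun h x

variable [Fintype V]

/-- An ideal is homogeneous if it contains the components of its elements. -/
def IsHomogeneous (I : TwoSidedIdeal (PathAlgebra k V)) : Prop :=
  ∀ x ∈ I, ∀ t, Γ.component t x ∈ I

theorem component_mem_of_smul (I : TwoSidedIdeal (PathAlgebra k V)) (c : k)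
    {x : PathAlgebra k V} (h : x ∈ I) : c • x ∈ I := by
  rw [← one_mul x, ← smul_mul_assoc]
  exact I.mul_mem_left _ _ h

/-- For a single path `y`, either `t` is the class of some `y * q` and the component is `y` times a
component of `x`, or no path starting with `y` has class `t` and the component vanishes. -/
theorem component_mul_mem_left (I : TwoSidedIdeal (PathAlgebra k V)) (y : PathAlgebra k V)
    {x : PathAlgebra k V} (hx : ∀ t, Γ.component t x ∈ I) (t : Γ.T) :
    Γ.component t (y * x) ∈ I := by
  induction y using PathAlgebra.induction with
  | zero => rw [zero_mul, map_zero]; exact I.zero_mem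
  | add y y' h h' => rw [add_mul, map_add]; exact I.add_mem h h'
  | smul c p =>
    rw [smul_mul_assoc, map_smul]
    apply component_mem_of_smul
    obtain ⟨a, b, p⟩ := p
    by_cases h : ∃ (c : V) (q : Quiver.Path b c), Γ.cls ⟨a, c, p.comp q⟩ = t
    · obtain ⟨c, q, rfl⟩ := h
      rw [component_mul_left]
      exact I.mul_mem_left _ _ (hx _)
    · push Not at h
      rw [component_mul_left_eq_zero Γ t p h]
      exact I.zero_mem

theorem component_mul_mem_right (I : TwoSidedIdeal (PathAlgebra k V)) (y : PathAlgebra k V)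
    {x : PathAlgebra k V} (hx : ∀ t, Γ.component t x ∈ I) (t : Γ.T) :
    Γ.component t (x * y) ∈ I := by
  induction y using PathAlgebra.induction with
  | zero => rw [mul_zero, map_zero]; exact I.zero_mem
  | add y y' h h' => rw [mul_add, map_add]; exact I.add_mem h h'
  | smul c p =>
    rw [mul_smul_comm, map_smul]
    apply component_mem_of_smul
    obtain ⟨b, c, p⟩ := p
    by_cases h : ∃ (a : V) (q : Quiver.Path a b), Γ.cls ⟨a, c, q.comp p⟩ = t
    · obtain ⟨a, q, rfl⟩ := h
      rw [component_mul_right]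
      exact I.mul_mem_right _ _ (hx _)
    · push Not at h
      rw [component_mul_right_eq_zero Γ t p h]
      exact I.zero_mem

/-- The elements all of whose components lie in an ideal form an ideal. -/
def core (I : TwoSidedIdeal (PathAlgebra k V)) : TwoSidedIdeal (PathAlgebra k V) :=
  TwoSidedIdeal.mk' {x | ∀ t, Γ.component t x ∈ I}
    (fun t => by rw [map_zero]; exact I.zero_mem)
    (fun hx hy t => by rw [map_add]; exact I.add_mem (hx t) (hy t))
    (fun hx t => by rw [map_neg]; exact I.neg_mem (hx t))
    (fun hy t => Γ.component_mul_mem_left I _ hy t)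
    (fun hx t => Γ.component_mul_mem_right I _ hx t)

theorem mem_core (I : TwoSidedIdeal (PathAlgebra k V)) (x : PathAlgebra k V) :
    x ∈ Γ.core I ↔ ∀ t, Γ.component t x ∈ I := by
  rw [core, TwoSidedIdeal.mem_mk']
  rfl

/-- The elements with all components in `I` form an ideal, the `core`. If it contains the
generators, it contains `I`, so homogeneity need only be checked on generators. -/
theorem isHomogeneous_of_le_span {I : TwoSidedIdeal (PathAlgebra k V)}
    {s : Set (PathAlgebra k V)} (hI : I ≤ TwoSidedIdeal.span s)
    (hs : ∀ x ∈ s, ∀ t, Γ.component t x ∈ I) : Γ.IsHomogeneous I := by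
  intro x hx
  rw [← mem_core]
  have : TwoSidedIdeal.span s ≤ Γ.core I := by
    rw [TwoSidedIdeal.span_le]
    intro y hy
    exact (Γ.mem_core I y).2 (hs y hy)
  exact this (hI hx)

end PathDegree

/-! ### Homotopy classes of paths -/

section Homotopy

open PathAlgebra

variable {k : Type u} [Field k] {V : Type} [Fintype V] [Quiver.{0} V]
  (I : TwoSidedIdeal (PathAlgebra k V))

/-- The homotopy class of a path. -/
def homotopyClass {a b : V} (p : Quiver.Path a b) :
    (⟨(Quiver.FreeGroupoid.of V).obj a⟩ : HomotopyGroupoid I) ⟶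
      ⟨(Quiver.FreeGroupoid.of V).obj b⟩ :=
  (CategoryTheory.Quotient.functor (HomotopyStep I)).map
    (composePath ((Quiver.FreeGroupoid.of V).mapPath p))

theorem homotopyClass_comp {a b c : V} (p : Quiver.Path a b) (q : Quiver.Path b c) :
    homotopyClass I (p.comp q) = homotopyClass I p ≫ homotopyClass I q := by
  rw [homotopyClass, Prefunctor.mapPath_comp, composePath_comp, Functor.map_comp]
  rfl

/-- The classification of paths up to homotopy. -/
def homotopyDegree : PathDegree V where
  T := Σ a b : V, (⟨(Quiver.FreeGroupoid.of V).obj a⟩ : HomotopyGroupoid I) ⟶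
      ⟨(Quiver.FreeGroupoid.of V).obj b⟩
  cls p := ⟨p.1, p.2.1, homotopyClass I p.2.2⟩
  comp_left {a b c c'} p q q' := by
    simp only [homotopyClass_comp, Sigma.mk.injEq, heq_eq_eq, true_and]
    constructor
    · rintro ⟨rfl, h⟩
      refine ⟨rfl, ?_⟩
      simp only [heq_eq_eq] at h ⊢
      exact (cancel_epi _).1 h
    · rintro ⟨rfl, h⟩
      refine ⟨rfl, ?_⟩
      simp only [heq_eq_eq] at h ⊢
      rw [h]
  comp_right {a a' b c} q q' p := by
    simp only [homotopyClass_comp, Sigma.mk.injEq]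
    constructor
    · rintro ⟨rfl, h⟩
      refine ⟨rfl, ?_⟩
      simp only [heq_eq_eq, Sigma.mk.injEq, true_and] at h ⊢
      exact (cancel_mono _).1 h
    · rintro ⟨rfl, h⟩
      refine ⟨rfl, ?_⟩
      simp only [heq_eq_eq, Sigma.mk.injEq, true_and] at h ⊢
      rw [h]

theorem homotopyDegree_cls_eq_iff {a b : V} (p q : Quiver.Path a b) :
    (homotopyDegree I).cls ⟨a, b, p⟩ = (homotopyDegree I).cls ⟨a, b, q⟩ ↔
      homotopyClass I p = homotopyClass I q := by
  simp [homotopyDegree]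

theorem ofParallel_single {a b : V} (p : Quiver.Path a b) (c : k) :
    ofParallel k (Finsupp.single p c) = c • ofPath k ⟨a, b, p⟩ := by
  rw [ofParallel, Finsupp.mapDomain_single, ofPath]
  exact (Finsupp.smul_single_one _ c).symm

theorem ofParallel_add {a b : V} (r s : Quiver.Path a b →₀ k) :
    ofParallel k (r + s) = ofParallel k r + ofParallel k s :=
  Finsupp.mapDomain_add

open Classical in
theorem restrict_ofParallel {a b : V} (s : AnyPath V → Prop) (r : Quiver.Path a b →₀ k) :
    restrict s (ofParallel k r) = ofParallel k (r.filter fun p => s ⟨a, b, p⟩) := by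
  induction r using Finsupp.induction_linear with
  | zero => rw [Finsupp.filter_zero, ofParallel, Finsupp.mapDomain_zero]; exact map_zero _
  | add r r' h h' => rw [ofParallel_add, map_add, h, h', Finsupp.filter_add, ofParallel_add]
  | single p c =>
    rw [ofParallel_single, map_smul, restrict_ofPath]
    split_ifs with h
    · rw [Finsupp.filter_single_of_pos (fun p => s ⟨a, b, p⟩) h, ofParallel_single]
    · rw [Finsupp.filter_single_of_neg (fun p => s ⟨a, b, p⟩) h, smul_zero, ofParallel,
        Finsupp.mapDomain_zero]
      rfl

/-- Induction on the number of terms. The paths in a minimal relation are homotopic by definition,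
so each component is the whole relation or zero. A relation that is not minimal splits into two
shorter elements of `I`. -/
theorem component_ofParallel_mem (n : ℕ) : ∀ {a b : V} (r : Quiver.Path a b →₀ k),
    r.support.card ≤ n → ofParallel k r ∈ I → ∀ t, (homotopyDegree I).component t
      (ofParallel k r) ∈ I := by
  classical
  induction n with
  | zero =>
    intro a b r hr _ t
    have : r = 0 := by simpa using hr
    subst this
    have : ofParallel k (0 : Quiver.Path a b →₀ k) = 0 := Finsupp.mapDomain_zero
    rw [this, map_zero]
    exact I.zero_mem
  | succ n ih =>
    intro a b r hr hI t
    by_cases hmin : IsMinimalRelation I r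
    · by_cases ht : ∃ p ∈ r.support, (homotopyDegree I).cls ⟨a, b, p⟩ = t
      · obtain ⟨p, hp, rfl⟩ := ht
        rw [PathDegree.component, restrict_ofParallel]
        rw [Finsupp.filter_eq_self_iff _ _ |>.2]
        · exact hI
        · intro q hq
          rw [homotopyDegree_cls_eq_iff]
          exact CategoryTheory.Quotient.sound _
            (HomotopyStep.step r hmin q p (Finsupp.mem_support_iff.2 hq) hp)
      · push Not at ht
        rw [PathDegree.component, restrict_ofParallel, (Finsupp.filter_eq_zero_iff _ _).2]
        · rw [ofParallel, Finsupp.mapDomain_zero]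
          exact I.zero_mem
        · intro q hq
          by_contra h
          exact ht q (Finsupp.mem_support_iff.2 h) hq
    · rw [IsMinimalRelation] at hmin
      push Not at hmin
      obtain ⟨s, hs, hsr, hsI⟩ := hmin hI
      have hsplit : ofParallel k r = ofParallel k (r.filter (· ∈ s)) +
          ofParallel k (r.filter (· ∉ s)) := by
        rw [← ofParallel_add, Finsupp.filter_add_filter_not]
      have hsI' : ofParallel k (r.filter (· ∉ s)) ∈ I := by
        have := I.sub_mem hI hsI
        rwa [hsplit, add_sub_cancel_left] at this
      rw [hsplit, map_add]
      have hcard := Finset.card_lt_card hsr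
      refine I.add_mem (ih _ ?_ hsI t) (ih _ ?_ hsI' t)
      · rw [Finsupp.support_filter]
        have : Finset.filter (· ∈ s) r.support ⊆ s := fun x hx => (Finset.mem_filter.1 hx).2
        have := Finset.card_le_card this
        omega
      · rw [Finsupp.support_filter]
        have : Finset.filter (· ∉ s) r.support ⊂ r.support := by
          obtain ⟨q, hq⟩ := hs
          refine Finset.filter_ssubset.2 ⟨q, hsr.1 hq, by simpa using hq⟩
        have := Finset.card_lt_card this
        omega

theorem exists_ofParallel (a b : V) (x : PathAlgebra k V) : ∃ r : Quiver.Path a b →₀ k,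
    ofPath k (vertex a) * x * ofPath k (vertex b) = ofParallel k r := by
  have hz : ofParallel k (0 : Quiver.Path a b →₀ k) = 0 := Finsupp.mapDomain_zero
  induction x using PathAlgebra.induction with
  | zero => exact ⟨0, by rw [mul_zero, zero_mul, hz]⟩
  | add x y hx hy =>
    obtain ⟨r, hr⟩ := hx
    obtain ⟨s, hs⟩ := hy
    exact ⟨r + s, by rw [mul_add, add_mul, hr, hs, ofParallel_add]⟩
  | smul c p =>
    obtain ⟨a', b', p⟩ := p
    by_cases h : a = a'
    · subst h
      by_cases h' : b' = b
      · subst h'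
        refine ⟨Finsupp.single p c, ?_⟩
        rw [ofParallel_single, mul_smul_comm, smul_mul_assoc, comp_mul, comp_mul,
          Quiver.Path.nil_comp, Quiver.Path.comp_nil]
      · refine ⟨0, ?_⟩
        rw [hz, mul_smul_comm, smul_mul_assoc, comp_mul, mul_of_ne (by exact h'), smul_zero]
    · refine ⟨0, ?_⟩
      rw [hz, mul_smul_comm, smul_mul_assoc, mul_of_ne (by exact h), zero_mul, smul_zero]

theorem sum_vertex_mul_mul_vertex (x : PathAlgebra k V) :
    ∑ a : V, ∑ b : V, ofPath k (vertex a) * x * ofPath k (vertex b) = x := by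
  simp_rw [← Finset.mul_sum, ← Finset.sum_mul, ← one_def, one_mul, mul_one]

/-- Every ideal is homogeneous with respect to its homotopy classes: each of its elements is a
sum of minimal relations. -/
theorem isHomogeneous_homotopyDegree : (homotopyDegree I).IsHomogeneous I := by
  intro x hx t
  rw [← sum_vertex_mul_mul_vertex x, map_sum]
  refine sum_mem fun a _ => ?_
  rw [map_sum]
  refine sum_mem fun b _ => ?_
  obtain ⟨r, hr⟩ := exists_ofParallel a b x
  have hmem : ofParallel k r ∈ I := hr ▸ I.mul_mem_right _ _ (I.mul_mem_left _ _ hx)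
  rw [hr]
  exact component_ofParallel_mem I _ r le_rfl hmem t

variable {I}

/-- The terms of `r` homotopic to `p` form a component of `r`, hence a subsum in `I'`. By minimality
this non-empty subsum cannot be proper. -/
theorem homotopyClass_eq_of_isMinimalRelation {I' : TwoSidedIdeal (PathAlgebra k V)}
    (h : (homotopyDegree I).IsHomogeneous I') {a b : V} {r : Quiver.Path a b →₀ k}
    (hr : IsMinimalRelation I' r) {p q : Quiver.Path a b} (hp : p ∈ r.support)
    (hq : q ∈ r.support) : homotopyClass I p = homotopyClass I q := by
  classical
  by_contra hne
  set s : Finset (Quiver.Path a b) :=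
    r.support.filter fun p' => homotopyClass I p' = homotopyClass I p
  refine hr.2 s ⟨p, by simpa [s] using hp⟩ ?_ ?_
  · exact Finset.filter_ssubset.2 ⟨q, hq, fun h => hne h.symm⟩
  · have := h _ hr.1 ((homotopyDegree I).cls ⟨a, b, p⟩)
    rw [PathDegree.component, restrict_ofParallel] at this
    convert this using 2
    ext p'
    simp only [Finsupp.filter_apply, homotopyDegree_cls_eq_iff]
    by_cases h0 : r p' = 0
    · simp [h0]
    · simp [s, h0]

/-- If an ideal is homogeneous for the homotopy classes of another one, then it has the larger
fundamental group. -/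
theorem subsingleton_fundamentalGroup_of_isHomogeneous {I' : TwoSidedIdeal (PathAlgebra k V)}
    (h : (homotopyDegree I).IsHomogeneous I') (x : V)
    (hs : Subsingleton (BoundQuiverFundamentalGroup I' x)) :
    Subsingleton (BoundQuiverFundamentalGroup I x) := by
  -- Both groupoids are quotients of the same free groupoid. `F` sends the class of a walk to the
  -- class of the same walk, so an equality of closed walks in the source passes to the target.
  let F : HomotopyGroupoid I' ⥤ HomotopyGroupoid I :=
    CategoryTheory.Quotient.lift (HomotopyStep I')
      (CategoryTheory.Quotient.functor (HomotopyStep I)) (by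
        rintro _ _ _ _ ⟨r, hr, p, q, hp, hq⟩
        exact homotopyClass_eq_of_isMinimalRelation h hr hp hq)
  constructor
  intro f g
  obtain ⟨f, rfl⟩ := (CategoryTheory.Quotient.functor (HomotopyStep I)).map_surjective f
  obtain ⟨g, rfl⟩ := (CategoryTheory.Quotient.functor (HomotopyStep I)).map_surjective g
  have := hs.elim ((CategoryTheory.Quotient.functor (HomotopyStep I')).map f)
    ((CategoryTheory.Quotient.functor (HomotopyStep I')).map g)
  exact congrArg F.map this

end Homotopy

/-! ### Graded algebras and graded presentations -/

section Graded

variable {k : Type u} [Field k] {B : Type w} [Ring B] [Algebra k B]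
  (ℬ : ℕ → Submodule k B) [GradedAlgebra ℬ]

theorem gradedProj_of_mem {n : ℕ} {b : B} (h : b ∈ ℬ n) : GradedAlgebra.proj ℬ n b = b := by
  rw [GradedAlgebra.proj_apply, DirectSum.decompose_of_mem_same _ h]

theorem gradedProj_of_mem_ne {n m : ℕ} {b : B} (h : b ∈ ℬ n) (hnm : n ≠ m) :
    GradedAlgebra.proj ℬ m b = 0 := by
  rw [GradedAlgebra.proj_apply, DirectSum.decompose_of_mem_ne _ h hnm]

theorem gradedProj_mem (n : ℕ) (b : B) : GradedAlgebra.proj ℬ n b ∈ ℬ n := by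
  rw [GradedAlgebra.proj_apply]
  exact SetLike.coe_mem _

theorem gradedProj_mul (n : ℕ) (x y : B) : GradedAlgebra.proj ℬ n (x * y) =
    ∑ ij ∈ Finset.HasAntidiagonal.antidiagonal n,
      GradedAlgebra.proj ℬ ij.1 x * GradedAlgebra.proj ℬ ij.2 y := by
  simp only [GradedAlgebra.proj_apply]
  rw [DirectSum.decompose_mul, DirectSum.coe_mul_apply_eq_sum_antidiagonal]

theorem gradedProj_zero_mul (x y : B) : GradedAlgebra.proj ℬ 0 (x * y) =
    GradedAlgebra.proj ℬ 0 x * GradedAlgebra.proj ℬ 0 y := by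
  rw [gradedProj_mul]; simp

theorem eq_zero_of_gradedProj {b : B} (h : ∀ n, GradedAlgebra.proj ℬ n b = 0) : b = 0 := by
  classical
  rw [← DirectSum.sum_support_decompose ℬ b]
  exact Finset.sum_eq_zero fun i _ => h i

theorem eq_sum_gradedProj (b : B) : ∃ N, b = ∑ n ∈ Finset.range N, GradedAlgebra.proj ℬ n b := by
  classical
  obtain ⟨N, hN⟩ := ((DirectSum.decompose ℬ b).support).exists_nat_subset_range
  refine ⟨N, ?_⟩
  conv_lhs => rw [← DirectSum.sum_support_decompose ℬ b]
  refine Finset.sum_subset hN fun i _ hi => ?_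
  simpa using hi

/-- The elements with components of degree at least `n` only. -/
def gradedTail (n : ℕ) : Submodule k B :=
  ⨅ j : Fin n, LinearMap.ker (GradedAlgebra.proj ℬ j)

theorem mem_gradedTail {n : ℕ} {b : B} :
    b ∈ gradedTail ℬ n ↔ ∀ j < n, GradedAlgebra.proj ℬ j b = 0 := by
  simp only [gradedTail, Submodule.mem_iInf, LinearMap.mem_ker]
  exact ⟨fun h j hj => h ⟨j, hj⟩, fun h j => h j j.2⟩

theorem mem_gradedTail_of_mem {n m : ℕ} {b : B} (h : b ∈ ℬ m) (hnm : n ≤ m) :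
    b ∈ gradedTail ℬ n := by
  rw [mem_gradedTail]
  exact fun j hj => gradedProj_of_mem_ne ℬ h (by omega)

theorem gradedTail_anti {n m : ℕ} (h : n ≤ m) : gradedTail ℬ m ≤ gradedTail ℬ n := by
  intro b hb
  rw [mem_gradedTail] at hb ⊢
  exact fun j hj => hb j (by omega)

theorem mul_mem_gradedTail {n m : ℕ} {x y : B} (hx : x ∈ gradedTail ℬ n)
    (hy : y ∈ gradedTail ℬ m) : x * y ∈ gradedTail ℬ (n + m) := by
  rw [mem_gradedTail] at hx hy ⊢
  intro j hj
  rw [gradedProj_mul]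
  refine Finset.sum_eq_zero fun ij hij => ?_
  rw [Finset.HasAntidiagonal.mem_antidiagonal] at hij
  by_cases h : ij.1 < n
  · rw [hx _ h, zero_mul]
  · rw [hy _ (by omega), mul_zero]

theorem gradedProj_mul_of_mem_gradedTail {n m : ℕ} {x y : B} (hx : x ∈ gradedTail ℬ n)
    (hy : y ∈ gradedTail ℬ m) : GradedAlgebra.proj ℬ (n + m) (x * y) =
      GradedAlgebra.proj ℬ n x * GradedAlgebra.proj ℬ m y := by
  rw [mem_gradedTail] at hx hy
  rw [gradedProj_mul, Finset.sum_eq_single (n, m)]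
  · rintro ⟨i, j⟩ hij hne
    rw [Finset.HasAntidiagonal.mem_antidiagonal] at hij
    simp only at hij
    by_cases h : i < n
    · rw [hx _ h, zero_mul]
    · have : j < m := by
        by_contra h'
        exact hne (Prod.ext (by simp; omega) (by simp; omega))
      rw [hy _ this, mul_zero]
  · intro h
    exact absurd (Finset.HasAntidiagonal.mem_antidiagonal.2 (by rfl)) h

theorem mem_gradedTail_succ {n : ℕ} {b : B} (h : b ∈ gradedTail ℬ n)
    (h' : GradedAlgebra.proj ℬ n b = 0) : b ∈ gradedTail ℬ (n + 1) := by
  rw [mem_gradedTail] at h ⊢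
  intro j hj
  obtain hj | rfl := Nat.lt_succ_iff_lt_or_eq.1 hj
  · exact h j hj
  · exact h'

open PathAlgebra

/-- A presentation of a graded algebra by a quiver which is compatible with the gradings. -/
structure IsGradedPresentation {V : Type} [Fintype V] [Quiver.{0} V]
    (ρ : PathAlgebra k V →ₐ[k] B) : Prop where
  mem : ∀ p, ρ (ofPath k p) ∈ ℬ p.length
  surjective : Function.Surjective ρ
  two_le : ∀ x, ρ x = 0 → ∀ p, coeff p x ≠ 0 → 2 ≤ p.length

namespace IsGradedPresentation

variable {ℬ} {V : Type} [Fintype V] [Quiver.{0} V] {ρ : PathAlgebra k V →ₐ[k] B}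
  (hρ : IsGradedPresentation ℬ ρ)

include hρ

theorem proj_apply (n : ℕ) (x : PathAlgebra k V) :
    GradedAlgebra.proj ℬ n (ρ x) = ρ (restrict (fun p => p.length = n) x) := by
  have h : GradedAlgebra.proj ℬ n ∘ₗ ρ.toLinearMap =
      ρ.toLinearMap ∘ₗ restrict (fun p => p.length = n) := by
    apply linearMap_ext
    intro p
    simp only [LinearMap.comp_apply, AlgHom.toLinearMap_apply, restrict_ofPath]
    split_ifs with h
    · exact gradedProj_of_mem ℬ (h ▸ hρ.mem p)
    · rw [map_zero]
      exact gradedProj_of_mem_ne ℬ (hρ.mem p) h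
  exact LinearMap.congr_fun h x

theorem exists_of_mem {n : ℕ} {b : B} (hb : b ∈ ℬ n) :
    ∃ x, ρ (restrict (fun p => p.length = n) x) = b := by
  obtain ⟨x, rfl⟩ := hρ.surjective b
  exact ⟨x, by rw [← hρ.proj_apply, gradedProj_of_mem ℬ hb]⟩

theorem span_eq (n : ℕ) :
    ℬ n = Submodule.span k {b | ∃ p : AnyPath V, p.length = n ∧ b = ρ (ofPath k p)} := by
  classical
  apply le_antisymm
  · intro b hb
    obtain ⟨x, rfl⟩ := hρ.exists_of_mem hb
    induction x using PathAlgebra.induction with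
    | zero => simp
    | add x y hx hy =>
      have key : ∀ z : PathAlgebra k V, ρ (restrict (fun p => p.length = n) z) ∈ ℬ n := by
        intro z
        rw [← hρ.proj_apply]
        exact gradedProj_mem ℬ n _
      rw [map_add, map_add]
      exact Submodule.add_mem _ (hx (key x)) (hy (key y))
    | smul c p =>
      rw [map_smul, map_smul, restrict_ofPath]
      apply Submodule.smul_mem
      split_ifs with h
      · exact Submodule.subset_span ⟨p, h, rfl⟩
      · rw [map_zero]; exact Submodule.zero_mem _
  · rw [Submodule.span_le]
    rintro _ ⟨p, rfl, rfl⟩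
    exact hρ.mem p

omit [GradedAlgebra ℬ] in
theorem vertex_ne_zero (a : V) : ρ (ofPath k (vertex a)) ≠ 0 := by
  intro h
  have := hρ.two_le _ h (vertex a) (by simp [coeff_ofPath])
  simp [AnyPath.length] at this

theorem exists_vertex_mul {b : B} (hb : b ∈ ℬ 0) :
    ∃ c : V → k, b = ∑ a, c a • ρ (ofPath k (vertex a)) ∧
      ∀ a, ρ (ofPath k (vertex a)) * b = c a • ρ (ofPath k (vertex a)) := by
  obtain ⟨x, rfl⟩ := hρ.exists_of_mem hb
  have h1 : restrict (fun p => p.length = 0) x =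
      ∑ a, coeff (vertex a) x • ofPath k (vertex a) := by
    have : restrict (fun p => p.length = 0) =
        ∑ a : V, (coeff (k := k) (vertex a)).smulRight (ofPath k (vertex a)) := by
      classical
      apply linearMap_ext
      intro p
      rw [restrict_ofPath, LinearMap.sum_apply]
      simp only [LinearMap.smulRight_apply, coeff_ofPath]
      split_ifs with h
      · rw [Finset.sum_eq_single p.1]
        · rw [if_pos (eq_vertex_of_length h), one_smul, ← eq_vertex_of_length h]
        · intro a _ ha
          rw [if_neg, zero_smul]
          rintro rfl
          exact ha rfl
        · simp
      · refine (Finset.sum_eq_zero fun a _ => ?_).symm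
        rw [if_neg, zero_smul]
        rintro rfl
        exact h rfl
    rw [this, LinearMap.sum_apply]
    rfl
  refine ⟨fun a => coeff (vertex a) x, by rw [h1, map_sum]; simp, fun a => ?_⟩
  rw [h1, ← map_mul, Finset.mul_sum, Finset.sum_eq_single a]
  · rw [mul_smul_comm, comp_mul, Quiver.Path.nil_comp, map_smul]
  · intro b _ hb
    rw [mul_smul_comm, mul_of_ne (by exact hb.symm), smul_zero]
  · simp

/-- The degree-zero part is spanned by orthogonal idempotents, hence is a product of copies of `k`,
which is reduced. -/
theorem eq_zero_of_pow {b : B} (hb : b ∈ ℬ 0) {n : ℕ} (h : b ^ n = 0) : b = 0 := by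
  obtain ⟨c, hc, hmul⟩ := hρ.exists_vertex_mul hb
  have key : ∀ a, ρ (ofPath k (vertex a)) * b ^ n = c a ^ n • ρ (ofPath k (vertex a)) := by
    intro a
    clear h
    induction n with
    | zero => simp
    | succ n ih => rw [pow_succ, ← mul_assoc, ih, smul_mul_assoc, hmul, smul_smul, pow_succ]
  rw [hc]
  refine Finset.sum_eq_zero fun a _ => ?_
  have := key a
  rw [h, mul_zero] at this
  have := (smul_eq_zero.1 this.symm).resolve_right (hρ.vertex_ne_zero a)
  rw [eq_zero_of_pow_eq_zero this, zero_smul]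

end IsGradedPresentation

/-- A finite spanning set involves only finitely many degrees. -/
theorem exists_forall_eq_bot_of_finite [Module.Finite k B] : ∃ N, ∀ n, N ≤ n → ℬ n = ⊥ := by
  classical
  obtain ⟨s, hs⟩ := Module.Finite.fg_top (R := k) (M := B)
  choose N hN using eq_sum_gradedProj ℬ
  refine ⟨s.sup N, fun n hn => ?_⟩
  have h0 : GradedAlgebra.proj ℬ n = 0 := by
    apply LinearMap.ext_on hs
    intro b hb
    have : N b ≤ n := (Finset.le_sup hb).trans hn
    rw [hN b, map_sum, LinearMap.zero_apply]
    refine Finset.sum_eq_zero fun j hj => ?_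
    rw [Finset.mem_range] at hj
    exact gradedProj_of_mem_ne ℬ (gradedProj_mem ℬ j b) (by omega)
  rw [eq_bot_iff]
  intro b hb
  rw [← gradedProj_of_mem ℬ hb, h0]
  rfl

omit [GradedAlgebra ℬ] in
-- The containment of the kernel in `J ^ 2` is part of a graded presentation. Boundedness of the
-- grading supplies the other half of admissibility, since a path of length `n` is sent into `ℬ n`.
theorem IsGradedPresentation.isPresentation {V : Type} [Fintype V] [Quiver.{0} V]
    {ρ : PathAlgebra k V →ₐ[k] B} (hρ : IsGradedPresentation ℬ ρ)
    (hN : ∃ N, ∀ n, N ≤ n → ℬ n = ⊥) : IsPresentation (TwoSidedIdeal.ker ρ) B := by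
  refine ⟨⟨fun x hx p hp => ?_, ?_⟩, ⟨?_⟩⟩
  · exact hρ.two_le x ((TwoSidedIdeal.mem_ker ρ).1 hx) p ((mem_support_iff x p).1 hp)
  · obtain ⟨N, hN⟩ := hN
    refine ⟨N, fun p hp => (TwoSidedIdeal.mem_ker ρ).2 ?_⟩
    have := hρ.mem p
    rwa [hN _ hp, Submodule.mem_bot] at this
  · refine AlgEquiv.ofBijective (RingCon.liftₐ _ ρ fun _ _ h => h) ⟨?_, ?_⟩
    · intro x y
      obtain ⟨x, rfl⟩ := RingCon.mk'_surjective _ x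
      obtain ⟨y, rfl⟩ := RingCon.mk'_surjective _ y
      intro h
      exact (RingCon.eq _).2 h
    · intro b
      obtain ⟨x, rfl⟩ := hρ.surjective b
      exact ⟨RingCon.mk' _ x, rfl⟩

theorem IsPresentation.exists_algHom {V : Type} [Fintype V] [Quiver.{0} V]
    {I : TwoSidedIdeal (PathAlgebra k V)} (hI : IsPresentation I B) :
    ∃ φ : PathAlgebra k V →ₐ[k] B, Function.Surjective φ ∧ ∀ x, φ x = 0 ↔ x ∈ I := by
  obtain ⟨-, ⟨e⟩⟩ := hI
  refine ⟨e.toAlgHom.comp (RingCon.mkₐ k I.ringCon),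
    e.surjective.comp (RingCon.mk'_surjective _), fun x => ?_⟩
  have : (e.toAlgHom.comp (RingCon.mkₐ k I.ringCon)) x = e (x : I.ringCon.Quotient) := rfl
  rw [this, EmbeddingLike.map_eq_zero_iff, I.mem_iff]
  exact RingCon.eq _

end Graded

/-! ### The associated graded presentation -/

section Symbol

open PathAlgebra

variable {k : Type u} [Field k] {B : Type w} [Ring B] [Algebra k B]
  {ℬ : ℕ → Submodule k B} [GradedAlgebra ℬ]
  {V₀ : Type} [Fintype V₀] [Quiver.{0} V₀] {ρ₀ : PathAlgebra k V₀ →ₐ[k] B}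
  {V : Type} [Fintype V] [Quiver.{0} V] {φ : PathAlgebra k V →ₐ[k] B}

theorem ofPath_pow_succ (p : AnyPath V) (n : ℕ) : ofPath k p ^ (n + 1) = 0 ∨
    ∃ q : AnyPath V, ofPath k p ^ (n + 1) = ofPath k q ∧ (n + 1) * p.length ≤ q.length := by
  induction n with
  | zero => exact Or.inr ⟨p, by simp, by simp⟩
  | succ n ih =>
    obtain h | ⟨⟨a, b, q⟩, h, hq⟩ := ih
    · exact Or.inl (by rw [pow_succ, h, zero_mul])
    · obtain ⟨b', c, p⟩ := p
      by_cases hb : b = b'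
      · subst hb
        refine Or.inr ⟨⟨a, c, q.comp p⟩, by rw [pow_succ, h, comp_mul], ?_⟩
        rw [length_comp, add_mul, one_mul]
        exact Nat.add_le_add_right hq _
      · exact Or.inl (by rw [pow_succ, h, mul_of_ne (by exact hb)])

variable (hρ₀ : IsGradedPresentation ℬ ρ₀) (hφ : Function.Surjective φ)
  (htwo : ∀ x, φ x = 0 → ∀ p, coeff p x ≠ 0 → 2 ≤ p.length)
  (hnil : ∃ m : ℕ, ∀ p : AnyPath V, m ≤ p.length → φ (ofPath k p) = 0)

include hρ₀ hnil

/-- By `hnil` the image of a non-trivial path is nilpotent, hence so is its degree-zero component.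
That component lies in the reduced ring `ℬ 0`, for which the auxiliary graded presentation `ρ₀` is
needed. -/
theorem map_ofPath_mem_gradedTail_one (p : AnyPath V) (hp : 1 ≤ p.length) :
    φ (ofPath k p) ∈ gradedTail ℬ 1 := by
  obtain ⟨m, hm⟩ := hnil
  rw [mem_gradedTail]
  intro j hj
  obtain rfl : j = 0 := by omega
  have hpow : φ (ofPath k p) ^ (m + 1) = 0 := by
    rw [← map_pow]
    obtain h | ⟨q, h, hq⟩ := ofPath_pow_succ (k := k) p m
    · rw [h, map_zero]
    · rw [h]
      refine hm q ?_
      nlinarith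
  refine hρ₀.eq_zero_of_pow (gradedProj_mem ℬ 0 _) (n := m + 1) ?_
  have key : ∀ n, GradedAlgebra.proj ℬ 0 (φ (ofPath k p)) ^ (n + 1) =
      GradedAlgebra.proj ℬ 0 (φ (ofPath k p) ^ (n + 1)) := by
    intro n
    induction n with
    | zero => simp
    | succ n ih => rw [pow_succ _ (n + 1), ih, ← gradedProj_zero_mul, ← pow_succ]
  rw [key, hpow, map_zero]

theorem map_ofPath_mem_gradedTail (p : AnyPath V) :
    φ (ofPath k p) ∈ gradedTail ℬ p.length := by
  obtain ⟨a, b, p⟩ := p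
  induction p with
  | nil =>
    rw [mem_gradedTail]
    intro j hj
    exact absurd hj (Nat.not_lt_zero j)
  | cons p α ih =>
    rw [← Quiver.Path.comp_toPath_eq_cons, length_comp, ← comp_mul, map_mul]
    exact mul_mem_gradedTail ℬ ih (map_ofPath_mem_gradedTail_one hρ₀ hnil (arrow α) le_rfl)

theorem map_mem_gradedTail {n : ℕ} (x : PathAlgebra k V) :
    φ (restrict (fun p => n ≤ p.length) x) ∈ gradedTail ℬ n := by
  induction x using PathAlgebra.induction with
  | zero => simp
  | add x y hx hy => rw [map_add, map_add]; exact Submodule.add_mem _ hx hy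
  | smul c p =>
    rw [map_smul, map_smul, restrict_ofPath]
    apply Submodule.smul_mem
    split_ifs with h
    · exact gradedTail_anti ℬ h (map_ofPath_mem_gradedTail hρ₀ hnil p)
    · rw [map_zero]; exact Submodule.zero_mem _

omit [Fintype V₀] [Quiver V₀] hρ₀ hnil in
include htwo in
-- An idempotent without degree-zero component lies in every `gradedTail`, so it is zero. But a
-- vertex is not a relation.
theorem gradedProj_map_vertex_ne_zero (a : V) :
    GradedAlgebra.proj ℬ 0 (φ (ofPath k (vertex a))) ≠ 0 := by
  intro h
  have h1 : φ (ofPath k (vertex a)) ∈ gradedTail ℬ 1 := by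
    rw [mem_gradedTail]
    intro j hj
    obtain rfl : j = 0 := by omega
    exact h
  have hid : φ (ofPath k (vertex a)) * φ (ofPath k (vertex a)) = φ (ofPath k (vertex a)) := by
    rw [← map_mul, comp_mul, Quiver.Path.nil_comp]
  have hn : ∀ n, φ (ofPath k (vertex a)) ∈ gradedTail ℬ n := by
    intro n
    induction n with
    | zero => exact gradedTail_anti ℬ (Nat.zero_le 1) h1
    | succ n ih =>
      rw [← hid]
      exact mul_mem_gradedTail ℬ ih h1
  have h0 : φ (ofPath k (vertex a)) = 0 :=
    eq_zero_of_gradedProj ℬ fun n => (mem_gradedTail ℬ).1 (hn (n + 1)) n (Nat.lt_succ_self n)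
  have := htwo _ h0 (vertex a) (by simp [coeff_ofPath])
  simp [AnyPath.length] at this

include hφ htwo in
-- Any preimage has vanishing vertex coefficients: multiplying by a vertex isolates one coefficient
-- in degree zero, and the image of that vertex has non-zero degree-zero component.
theorem exists_map_eq_of_mem_gradedTail_one {b : B} (hb : b ∈ gradedTail ℬ 1) :
    ∃ x, φ (restrict (fun p => 1 ≤ p.length) x) = b := by
  obtain ⟨x, rfl⟩ := hφ b
  refine ⟨x, ?_⟩
  have h0 : restrict (fun p => p.length = 0) x = 0 := by
    apply ext_coeff
    intro p
    rw [coeff_restrict, map_zero]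
    split_ifs with hp
    · have hp' := eq_vertex_of_length hp
      set a := p.1
      have e1 : GradedAlgebra.proj ℬ 0 (φ (restrict (fun p => p.length = 0) x)) = 0 := by
        have h1 := (mem_gradedTail ℬ).1 hb 0 one_pos
        have h2 := (mem_gradedTail ℬ).1 (map_mem_gradedTail (n := 1) hρ₀ hnil x) 0 one_pos
        rwa [← restrict_zero_add_restrict_one x, map_add, map_add, h2, add_zero] at h1
      have e2 : ofPath k (vertex a) * restrict (fun p => p.length = 0) x =
          coeff p x • ofPath k (vertex a) := by
        have : mulLin k (ofPath k (vertex a)) ∘ₗ restrict (fun p => p.length = 0) =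
            (coeff (k := k) p).smulRight (ofPath k (vertex a)) := by
          apply linearMap_ext
          intro q
          rw [LinearMap.comp_apply, restrict_ofPath, ← mul_def, LinearMap.smulRight_apply,
            coeff_ofPath]
          by_cases hq : q.length = 0
          · rw [if_pos hq, eq_vertex_of_length hq]
            by_cases hqa : q.1 = a
            · rw [hqa, ← hp', if_pos rfl, one_smul, hp', comp_mul, Quiver.Path.nil_comp]
            · rw [mul_of_ne (Ne.symm hqa), if_neg, zero_smul]
              rw [hp']
              intro h
              have := congrArg Sigma.fst h
              exact hqa this
          · rw [if_neg hq, mul_def, map_zero, if_neg, zero_smul]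
            rintro rfl
            exact hq hp
        exact LinearMap.congr_fun this x
      have e3 : coeff p x • GradedAlgebra.proj ℬ 0 (φ (ofPath k (vertex a))) = 0 := by
        rw [← map_smul, ← map_smul, ← e2, map_mul, gradedProj_zero_mul, e1, mul_zero]
      exact (smul_eq_zero.1 e3).resolve_right (gradedProj_map_vertex_ne_zero htwo a)
    · rfl
  have hsum := restrict_zero_add_restrict_one x
  rw [h0, zero_add] at hsum
  rw [hsum]

include hφ htwo in
-- By `ρ₀` the degree-`n` part is spanned by products of `n` elements of degree one, and each of
-- these is the image of an element of the arrow ideal. Together with `map_mem_gradedTail` this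
-- identifies the two filtrations.
theorem exists_map_eq_of_mem {n : ℕ} {b : B} (hb : b ∈ ℬ n) :
    ∃ x, φ (restrict (fun p => n ≤ p.length) x) = b := by
  rw [hρ₀.span_eq] at hb
  induction hb using Submodule.span_induction with
  | zero => exact ⟨0, by simp⟩
  | add x y _ _ hx hy =>
    obtain ⟨x', rfl⟩ := hx
    obtain ⟨y', rfl⟩ := hy
    exact ⟨x' + y', by simp⟩
  | smul c x _ hx =>
    obtain ⟨x', rfl⟩ := hx
    exact ⟨c • x', by simp⟩
  | mem x hx =>
    obtain ⟨p, rfl, rfl⟩ := hx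
    obtain ⟨a, b, p⟩ := p
    induction p with
    | nil =>
      obtain ⟨x, hx⟩ := hφ (ρ₀ (ofPath k (vertex a)))
      refine ⟨x, ?_⟩
      rw [← hx]
      congr 1
      apply ext_coeff
      intro p
      rw [coeff_restrict, if_pos]
      exact Nat.zero_le _
    | cons p α ih =>
      obtain ⟨x, hx⟩ := ih
      obtain ⟨y, hy⟩ := exists_map_eq_of_mem_gradedTail_one hρ₀ hφ htwo hnil
        (mem_gradedTail_of_mem ℬ (hρ₀.mem (arrow α)) le_rfl)
      refine ⟨restrict (fun q => AnyPath.length ⟨a, _, p⟩ ≤ q.length) x *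
        restrict (fun p => 1 ≤ p.length) y, ?_⟩
      rw [← Quiver.Path.comp_toPath_eq_cons, length_comp, ← comp_mul, map_mul ρ₀]
      have := restrict_mul_restrict (AnyPath.length ⟨a, _, p⟩) 1 x y
      refine (congrArg φ this).trans ?_
      rw [map_mul, hx, hy]

include hφ htwo in
theorem exists_map_eq_of_mem_gradedTail {n : ℕ} {b : B} (hb : b ∈ gradedTail ℬ n) :
    ∃ x, φ (restrict (fun p => n ≤ p.length) x) = b := by
  have key : b ∈
      LinearMap.range (φ.toLinearMap ∘ₗ restrict (fun p : AnyPath V => n ≤ p.length)) := by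
    obtain ⟨N, hN⟩ := eq_sum_gradedProj ℬ b
    rw [hN]
    refine sum_mem fun j _ => ?_
    by_cases hj : j < n
    · rw [(mem_gradedTail ℬ).1 hb j hj]
      exact Submodule.zero_mem _
    · obtain ⟨x, hx⟩ := exists_map_eq_of_mem hρ₀ hφ htwo hnil (gradedProj_mem ℬ j b)
      refine ⟨restrict (fun p => j ≤ p.length) x, ?_⟩
      rw [LinearMap.comp_apply, restrict_restrict, AlgHom.toLinearMap_apply, ← hx]
      congr 3
      ext p
      constructor
      · exact fun h => h.2
      · exact fun h => ⟨by omega, h⟩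
  obtain ⟨x, hx⟩ := key
  exact ⟨x, hx⟩

/-- The leading terms of a presentation of a graded algebra form a graded presentation. -/
def symbolHom : PathAlgebra k V →ₐ[k] B :=
  algHomOfPath (fun p => GradedAlgebra.proj ℬ p.length (φ (ofPath k p)))
    (by
      rw [← gradedProj_of_mem ℬ (SetLike.GradedOne.one_mem (A := ℬ)), ← map_one φ, one_def,
        map_sum, map_sum]
      rfl)
    (fun p q => by
      rw [length_comp, ← comp_mul, map_mul]
      exact gradedProj_mul_of_mem_gradedTail ℬ (map_ofPath_mem_gradedTail hρ₀ hnil _)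
        (map_ofPath_mem_gradedTail hρ₀ hnil _))
    (fun p q h => by
      rw [← gradedProj_mul_of_mem_gradedTail ℬ (map_ofPath_mem_gradedTail hρ₀ hnil _)
        (map_ofPath_mem_gradedTail hρ₀ hnil _), ← map_mul, mul_of_ne h, map_zero, map_zero])

theorem symbolHom_ofPath (p : AnyPath V) : symbolHom hρ₀ hnil (ofPath k p) =
    GradedAlgebra.proj ℬ p.length (φ (ofPath k p)) :=
  algHomOfPath_ofPath _ _ _ _ p

theorem symbolHom_restrict (n : ℕ) (x : PathAlgebra k V) :
    symbolHom hρ₀ hnil (restrict (fun p => p.length = n) x) =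
      GradedAlgebra.proj ℬ n (φ (restrict (fun p => n ≤ p.length) x)) := by
  have : (symbolHom hρ₀ hnil).toLinearMap ∘ₗ restrict (fun p => p.length = n) =
      GradedAlgebra.proj ℬ n ∘ₗ φ.toLinearMap ∘ₗ restrict (fun p => n ≤ p.length) := by
    apply linearMap_ext
    intro p
    simp only [LinearMap.comp_apply, AlgHom.toLinearMap_apply, restrict_ofPath]
    by_cases h : p.length = n
    · rw [if_pos h, if_pos h.ge, symbolHom_ofPath, h]
    · rw [if_neg h, map_zero]
      split_ifs with h'
      · exact ((mem_gradedTail ℬ).1 (map_ofPath_mem_gradedTail hρ₀ hnil p) n (by omega)).symm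
      · simp
  exact LinearMap.congr_fun this x

theorem gradedProj_symbolHom (n : ℕ) (x : PathAlgebra k V) :
    GradedAlgebra.proj ℬ n (symbolHom hρ₀ hnil x) =
      symbolHom hρ₀ hnil (restrict (fun p => p.length = n) x) := by
  have h : GradedAlgebra.proj ℬ n ∘ₗ (symbolHom hρ₀ hnil).toLinearMap =
      (symbolHom hρ₀ hnil).toLinearMap ∘ₗ restrict (fun p => p.length = n) := by
    apply linearMap_ext
    intro p
    simp only [LinearMap.comp_apply, AlgHom.toLinearMap_apply, restrict_ofPath]
    rw [symbolHom_ofPath]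
    split_ifs with h
    · rw [symbolHom_ofPath, h, gradedProj_of_mem ℬ (gradedProj_mem ℬ _ _)]
    · rw [map_zero, gradedProj_of_mem_ne ℬ (gradedProj_mem ℬ _ _) h]
  exact LinearMap.congr_fun h x

include hφ htwo in
-- If the leading term of a form of length `n` vanishes, its image lies in filtration degree `n +
-- 1`, which is reached by combinations of longer paths. Hence the form is the initial form of an
-- element of the kernel of `φ`.
theorem exists_sub_of_symbolHom_eq_zero {x : PathAlgebra k V} (hx : symbolHom hρ₀ hnil x = 0)
    (n : ℕ) : ∃ y, φ (restrict (fun p => p.length = n) x -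
      restrict (fun p => n + 1 ≤ p.length) y) = 0 := by
  have h1 : symbolHom hρ₀ hnil (restrict (fun p => p.length = n) x) = 0 := by
    rw [← gradedProj_symbolHom, hx, map_zero]
  have h2 : restrict (fun p => n ≤ p.length) (restrict (fun p => p.length = n) x) =
      restrict (fun p => p.length = n) x := by
    rw [restrict_restrict]
    congr 2
    ext p
    exact ⟨fun h => h.2, fun h => ⟨h.ge, h⟩⟩
  have h3 : restrict (fun p => p.length = n) (restrict (fun p => p.length = n) x) =
      restrict (fun p => p.length = n) x := by
    rw [restrict_restrict]
    simp only [and_self]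
  rw [← h3, symbolHom_restrict, h2] at h1
  have h4 := map_mem_gradedTail (n := n) hρ₀ hnil (restrict (fun p => p.length = n) x)
  rw [h2] at h4
  obtain ⟨y, hy⟩ := exists_map_eq_of_mem_gradedTail hρ₀ hφ htwo hnil
    (mem_gradedTail_succ ℬ h4 h1)
  exact ⟨y, by rw [map_sub, hy, sub_self]⟩

include hφ htwo in
theorem isGradedPresentation_symbolHom :
    IsGradedPresentation ℬ (symbolHom (φ := φ) hρ₀ hnil) where
  mem p := by
    rw [symbolHom_ofPath]
    exact gradedProj_mem ℬ _ _
  surjective := by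
    rw [← AlgHom.coe_toLinearMap, ← LinearMap.range_eq_top, eq_top_iff]
    intro b _
    obtain ⟨N, hN⟩ := eq_sum_gradedProj ℬ b
    rw [hN]
    refine sum_mem fun j _ => ?_
    obtain ⟨x, hx⟩ := exists_map_eq_of_mem hρ₀ hφ htwo hnil (gradedProj_mem ℬ j b)
    refine ⟨restrict (fun p => p.length = j) x, ?_⟩
    rw [AlgHom.toLinearMap_apply, symbolHom_restrict, hx,
      gradedProj_of_mem ℬ (gradedProj_mem ℬ _ _)]
  two_le x hx p hp := by
    obtain ⟨y, hy⟩ := exists_sub_of_symbolHom_eq_zero hρ₀ hφ htwo hnil hx p.length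
    apply htwo _ hy p
    rw [map_sub, coeff_restrict, coeff_restrict, if_pos rfl, if_neg (by omega), sub_zero]
    exact hp

include hφ htwo in
-- Taking components commutes with truncating by length. If `x` has initial-form lifts in `I`, their
-- components lie in `I` and lift the forms of the component of `x`.
theorem isHomogeneous_ker_symbolHom {I : TwoSidedIdeal (PathAlgebra k V)}
    (hI : ∀ x, φ x = 0 ↔ x ∈ I) {Γ : PathDegree V} (hΓ : Γ.IsHomogeneous I) :
    Γ.IsHomogeneous (TwoSidedIdeal.ker (symbolHom (φ := φ) hρ₀ hnil)) := by
  intro x hx t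
  rw [TwoSidedIdeal.mem_ker] at hx ⊢
  apply eq_zero_of_gradedProj ℬ
  intro n
  obtain ⟨y, hy⟩ := exists_sub_of_symbolHom_eq_zero hρ₀ hφ htwo hnil hx n
  have h1 := (hI _).2 (hΓ _ ((hI _).1 hy) t)
  rw [gradedProj_symbolHom]
  have comm : ∀ (s : AnyPath V → Prop) (z : PathAlgebra k V),
      Γ.component t (restrict s z) = restrict s (Γ.component t z) := by
    intro s z
    rw [PathDegree.component, restrict_restrict, restrict_restrict]
    congr 2
    ext p
    exact and_comm
  rw [map_sub, map_sub, comm, comm, sub_eq_zero] at h1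
  set z := Γ.component t x
  have h3 : restrict (fun p => p.length = n) (restrict (fun p => p.length = n) z) =
      restrict (fun p => p.length = n) z := by
    rw [restrict_restrict]
    simp only [and_self]
  have h2 : restrict (fun p => n ≤ p.length) (restrict (fun p => p.length = n) z) =
      restrict (fun p => p.length = n) z := by
    rw [restrict_restrict]
    congr 2
    ext p
    exact ⟨fun h => h.2, fun h => ⟨h.ge, h⟩⟩
  rw [← h3, symbolHom_restrict, h2, h1]
  exact (mem_gradedTail ℬ).1 (map_mem_gradedTail hρ₀ hnil _) n (Nat.lt_succ_self n)

omit hnil in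
/-- Every presentation of a graded algebra degenerates to a graded presentation on the same
quiver, which is homogeneous with respect to every degree for which the given one is. -/
theorem exists_isGradedPresentation {I : TwoSidedIdeal (PathAlgebra k V)}
    (hI : IsPresentation I B) : ∃ ρ : PathAlgebra k V →ₐ[k] B, IsGradedPresentation ℬ ρ ∧
      ∀ Γ : PathDegree V, Γ.IsHomogeneous I → Γ.IsHomogeneous (TwoSidedIdeal.ker ρ) := by
  obtain ⟨φ, hφ, hφI⟩ := hI.exists_algHom
  have htwo : ∀ x, φ x = 0 → ∀ p, coeff p x ≠ 0 → 2 ≤ p.length := fun x hx p hp =>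
    hI.1.1 x ((hφI x).1 hx) p ((mem_support_iff x p).2 hp)
  have hnil : ∃ m : ℕ, ∀ p : AnyPath V, m ≤ p.length → φ (ofPath k p) = 0 := by
    obtain ⟨m, hm⟩ := hI.1.2
    exact ⟨m, fun p hp => (hφI _).2 (hm p hp)⟩
  exact ⟨symbolHom hρ₀ hnil, isGradedPresentation_symbolHom hρ₀ hφ htwo hnil,
    fun Γ hΓ => isHomogeneous_ker_symbolHom hρ₀ hφ htwo hnil hφI hΓ⟩

end Symbol

/-! ### The grading of the Yoneda algebra -/

namespace ExtAlgebra

section Grading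

variable {C : Type u} [Category.{v} C] [Abelian C] [HasExt.{w} C] (X : C)
  (k : Type*) [Field k] [Linear k C]

/-- The inclusion of a homogeneous component. -/
def of (n : ℕ) : Ext.{w} X X n →ₗ[k] ExtAlgebra X :=
  DirectSum.lof k ℕ (fun n => Ext.{w} X X n) n

theorem of_mul_of {m n l : ℕ} (x : Ext.{w} X X m) (y : Ext.{w} X X n) (h : n + m = l) :
    of X k m x * of X k n y = of X k l (y.comp x h) := by
  subst h
  refine (DirectSum.of_mul_of (A := fun n => Ext.{w} X X n) x y).trans ?_
  -- The ring structure places the product in degree `m + n`, while the composite of classes is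
  -- written in degree `n + m`; this moves between them.
  have key : ∀ l (h : n + m = l), DirectSum.of (fun n => Ext.{w} X X n) l (y.comp x h) =
      DirectSum.of (fun n => Ext.{w} X X n) (n + m) (y.comp x rfl) := by
    rintro _ rfl
    rfl
  exact key _ (add_comm n m)

theorem one_eq : (1 : ExtAlgebra X) = of X k 0 (Ext.mk₀ (𝟙 X)) := rfl

/-- The homogeneous components of the Yoneda algebra. -/
def grading (n : ℕ) : Submodule k (ExtAlgebra X) := LinearMap.range (of X k n)

/-- The decomposition of an element into its homogeneous components. -/
def decomposition : ExtAlgebra X →ₗ[k] DirectSum ℕ fun n => grading X k n :=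
  DirectSum.toModule k ℕ (M := fun n => Ext.{w} X X n) _ fun n =>
    DirectSum.lof k ℕ (fun n => grading X k n) n ∘ₗ (of X k n).rangeRestrict

theorem decomposition_of (n : ℕ) (x : Ext.{w} X X n) : decomposition X k (of X k n x) =
    DirectSum.lof k ℕ (fun n => grading X k n) n ⟨of X k n x, x, rfl⟩ :=
  DirectSum.toModule_lof (M := fun n => Ext.{w} X X n) k n x

theorem linearMap_ext {M : Type*} [AddCommGroup M] [Module k M] {f g : ExtAlgebra X →ₗ[k] M}
    (h : ∀ n x, f (of X k n x) = g (of X k n x)) : f = g :=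
  DirectSum.linearMap_ext (M := fun n => Ext.{w} X X n) k fun n => LinearMap.ext (h n)

instance : GradedAlgebra (grading X k) where
  one_mem := ⟨_, (one_eq X k).symm⟩
  mul_mem := by
    rintro i j _ _ ⟨x, rfl⟩ ⟨y, rfl⟩
    exact ⟨_, (of_mul_of X k x y (add_comm j i)).symm⟩
  toDecomposition := DirectSum.Decomposition.ofLinearMap _ (decomposition X k)
    (by
      apply linearMap_ext X k
      intro n x
      rw [LinearMap.comp_apply, decomposition_of, DirectSum.coeLinearMap_lof]
      rfl)
    (by
      apply DirectSum.linearMap_ext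
      intro n
      ext ⟨_, x, rfl⟩ : 1
      simp only [LinearMap.comp_apply, DirectSum.coeLinearMap_lof, decomposition_of]
      rfl)

theorem of_injective (n : ℕ) : Function.Injective (of X k n) :=
  DirectSum.of_injective (β := fun n => Ext.{w} X X n) n

end Grading

section Products

variable {C : Type u} [Category.{v} C] [Abelian C] [HasExt.{w} C] {X : C}
  (k : Type*) [Field k] [Linear k C]

/-- The elements of the Yoneda algebra that are obtained from a fixed class in `Extⁿ(X, Z)` by
composition with a morphism `Z ⟶ X`. -/
def ofComp {Z : C} {n : ℕ} (cls : Ext.{w} X Z n) : (Z ⟶ X) →ₗ[k] ExtAlgebra X where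
  toFun f := of X k n (cls.comp (Ext.mk₀ f) (add_zero n))
  map_add' f g := by rw [Ext.mk₀_add, Ext.comp_add, map_add]
  map_smul' c f := by rw [Ext.mk₀_smul, Ext.comp_smul, map_smul]; rfl

theorem ofComp_apply {Z : C} {n : ℕ} (cls : Ext.{w} X Z n) (f : Z ⟶ X) :
    ofComp k cls f = of X k n (cls.comp (Ext.mk₀ f) (add_zero n)) := rfl

theorem ofComp_smul {Z : C} {n : ℕ} (cls : Ext.{w} X Z n) (c : k) (f : Z ⟶ X) :
    ofComp k cls ((Linear.homModule Z X).smul c f) = c • ofComp k cls f :=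
  map_smul (ofComp k cls) c f

theorem ofComp_id (f : X ⟶ X) : ofComp k (Ext.mk₀ (𝟙 X)) f = of X k 0 (Ext.mk₀ f) := by
  rw [ofComp_apply, Ext.mk₀_id_comp]

theorem of_zero_mul_ofComp {Z : C} {n : ℕ} (cls : Ext.{w} X Z n) (s : X ⟶ X) (f : Z ⟶ X) :
    of X k 0 (Ext.mk₀ s) * ofComp k cls f = ofComp k cls (f ≫ s) := by
  rw [ofComp_apply, of_mul_of X k _ _ (add_zero n), Ext.comp_assoc_of_third_deg_zero,
    Ext.mk₀_comp_mk₀, ofComp_apply]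

/-- The product composes `cls`, `f`, `e'` and `g` in this order. The square `h` moves `f` past the
degree-one class, so the result is again a fixed class followed by a morphism. -/
theorem ofComp_mul_ofComp {Y Z Z' : C} {n : ℕ} (cls : Ext.{w} X Z n) (e : Ext.{w} Z Z' 1)
    (e' : Ext.{w} X Y 1) (f : Z ⟶ X) (f' : Z' ⟶ Y)
    (h : (Ext.mk₀ f).comp e' (zero_add 1) = e.comp (Ext.mk₀ f') (add_zero 1)) (g : Y ⟶ X) :
    ofComp k e' g * ofComp k cls f = ofComp k (cls.comp e rfl) (f' ≫ g) := by
  rw [ofComp_apply, ofComp_apply, of_mul_of X k _ _ rfl, ofComp_apply,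
    Ext.comp_assoc_of_second_deg_zero, ← Ext.comp_assoc_of_third_deg_zero (Ext.mk₀ f), h,
    Ext.comp_assoc_of_third_deg_zero, Ext.mk₀_comp_mk₀, Ext.comp_assoc_of_third_deg_zero]

theorem ofComp_injective {Z : C} {n : ℕ} {cls : Ext.{w} X Z n}
    (h : ∀ y : Ext.{w} Z X 0, cls.comp y (add_zero n) = 0 → y = 0) :
    Function.Injective (ofComp k cls) := by
  rw [injective_iff_map_eq_zero]
  intro f hf
  rw [ofComp_apply] at hf
  have := of_injective X k n (hf.trans (map_zero _).symm)
  exact (Ext.mk₀_eq_zero_iff f).1 (h _ this)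

theorem range_ofComp {Z : C} {n : ℕ} {cls : Ext.{w} X Z n}
    (h : ∀ x : Ext.{w} X X n, ∃ y : Ext.{w} Z X 0, cls.comp y (add_zero n) = x) :
    LinearMap.range (ofComp k cls) = grading X k n := by
  apply le_antisymm
  · rintro _ ⟨f, rfl⟩
    exact ⟨_, rfl⟩
  · rintro _ ⟨x, rfl⟩
    obtain ⟨y, rfl⟩ := h x
    exact ⟨Ext.homEquiv₀ y, by rw [ofComp_apply, Ext.mk₀_homEquiv₀_apply]⟩

end Products

/-- The kernel of the connecting map comes from `Ext` out of the projective `X₂`. This vanishes in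
positive degree; in degree zero it consists of morphisms whose restriction to `X₁` is zero by `hY`.
Minimality of the resolution provides `hY`. -/
theorem _root_.CategoryTheory.ShortComplex.ShortExact.eq_zero_of_extClass_comp_eq_zero
    {C : Type u} [Category.{v} C] [Abelian C] [HasExt.{w} C] {S : ShortComplex C}
    (hS : S.ShortExact) [Projective S.X₂] {Y : C} (hY : ∀ g : S.X₂ ⟶ Y, S.f ≫ g = 0) {m n : ℕ}
    (h : 1 + m = n) (y : Ext.{w} S.X₁ Y m) (hy : hS.extClass.comp y h = 0) : y = 0 := by
  obtain ⟨x, rfl⟩ := Ext.contravariant_sequence_exact₁ hS _ y h hy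
  cases m with
  | zero => rw [← Ext.mk₀_homEquiv₀_apply x, Ext.mk₀_comp_mk₀, hY, Ext.mk₀_zero]
  | succ m => rw [Ext.eq_zero_of_projective x, Ext.comp_zero]

/-- The obstruction is a class of positive degree on the projective object `X₂`. -/
theorem _root_.CategoryTheory.ShortComplex.ShortExact.exists_extClass_comp_eq
    {C : Type u} [Category.{v} C] [Abelian C] [HasExt.{w} C] {S : ShortComplex C}
    (hS : S.ShortExact) [Projective S.X₂] {Y : C} {m n : ℕ}
    (h : 1 + m = n) (x : Ext.{w} S.X₃ Y n) : ∃ y : Ext.{w} S.X₁ Y m, hS.extClass.comp y h = x := by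
  subst h
  have : 1 + m = m + 1 := add_comm 1 m
  refine Ext.contravariant_sequence_exact₃ hS _ x ?_ rfl
  -- Forgetting the form of the class allows the degree `1 + m` to be rewritten as `m + 1` in its
  -- type.
  generalize (Ext.mk₀ S.g).comp x _ = z
  revert z
  rw [this]
  exact Ext.eq_zero_of_projective

end ExtAlgebra

/-! ### Syzygies of a linear resolution -/

attribute [instance] LinearResolution.addCommGroup LinearResolution.module

section Syzygy

variable {k : Type u} [Field k] {A : Type v} [Ring A] [Algebra k A]
  {𝒜 : ℕ → Submodule k A} [GradedAlgebra 𝒜]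

variable (𝒜) in
/-- The augmentation ideal as a module. -/
abbrev AugmentationIdeal : Type v := (HomogeneousIdeal.irrelevant 𝒜).toIdeal

variable (𝒜) in
/-- The short complex `A₊ → A → A / A₊`. -/
abbrev augmentationComplex : ShortComplex (ModuleCat.{v} A) :=
  ShortComplex.mk (X₁ := ModuleCat.of A (AugmentationIdeal 𝒜)) (X₂ := ModuleCat.of A A)
    (X₃ := ModuleCat.of A (DegreeZeroModule 𝒜)) (ModuleCat.ofHom (Submodule.subtype _))
    (ModuleCat.ofHom (Submodule.mkQ _)) (by
      ext x
      exact (Submodule.Quotient.mk_eq_zero _).2 x.2)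

variable (𝒜) in
theorem augmentationComplex_shortExact : (augmentationComplex 𝒜).ShortExact := by
  apply ModuleCat.shortComplex_shortExact
  · exact LinearMap.exact_subtype_mkQ _
  · exact Subtype.val_injective
  · exact Submodule.mkQ_surjective _

instance : Projective (augmentationComplex 𝒜).X₂ :=
  (IsProjective.iff_projective (R := A) A).1 inferInstance

/-- The augmentation ideal is also stable under right multiplication, because the projection to
degree zero is multiplicative. -/
theorem smul_quotient_eq_zero {a : A} (ha : a ∈ (HomogeneousIdeal.irrelevant 𝒜).toIdeal)
    (s : DegreeZeroModule 𝒜) : a • s = 0 := by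
  obtain ⟨b, rfl⟩ := Submodule.Quotient.mk_surjective _ s
  rw [← Submodule.Quotient.mk_smul, Submodule.Quotient.mk_eq_zero]
  change a ∈ HomogeneousIdeal.irrelevant 𝒜 at ha
  change a * b ∈ HomogeneousIdeal.irrelevant 𝒜
  rw [HomogeneousIdeal.mem_irrelevant_iff] at ha ⊢
  have := gradedProj_zero_mul 𝒜 a b
  rw [GradedAlgebra.proj_apply, GradedAlgebra.proj_apply] at this
  rw [GradedRing.proj_apply] at ha ⊢
  rw [this, ha, zero_mul]

theorem map_smul_top_eq_zero {M : Type*} [AddCommGroup M] [Module A M]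
    (g : M →ₗ[A] DegreeZeroModule 𝒜) {x : M}
    (hx : x ∈ (HomogeneousIdeal.irrelevant 𝒜).toIdeal • (⊤ : Submodule A M)) : g x = 0 := by
  refine Submodule.smul_induction_on (p := fun x => g x = 0) hx ?_ ?_
  · intro a ha m _
    rw [map_smul, smul_quotient_eq_zero ha]
  · intro x y hx hy
    rw [map_add, hx, hy, add_zero]

/-- Reconciles the pointwise `k`-action on homomorphisms with the action on morphisms of modules,
where scalars act through `algebraMap`. -/
theorem ofHom_smul_eq {M : Type v} [AddCommGroup M] [Module A M] (c : k)
    (f : M →ₗ[A] DegreeZeroModule 𝒜) : ModuleCat.ofHom (c • f) =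
      (Linear.homModule (R := k) (ModuleCat.of A M) (ModuleCat.of A (DegreeZeroModule 𝒜))).smul c
        (ModuleCat.ofHom f) := by
  apply ModuleCat.hom_ext
  apply LinearMap.ext
  intro x
  change c • f x = algebraMap k A c • f x
  exact (algebraMap_smul A c (f x)).symm

/-- The elements of the Yoneda algebra that are obtained from a fixed class in `Extⁿ(A₍₀₎, M)` by
composition with a homomorphism `M → A₍₀₎`. -/
def compToYoneda {M : Type v} [AddCommGroup M] [Module A M] {n : ℕ}
    (cls : Ext.{v} (ModuleCat.of A (DegreeZeroModule 𝒜)) (ModuleCat.of A M) n) :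
    (M →ₗ[A] DegreeZeroModule 𝒜) →ₗ[k] YonedaAlgebra 𝒜 where
  toFun f := ExtAlgebra.ofComp k cls (ModuleCat.ofHom f)
  map_add' f g := (congrArg _ (ModuleCat.ofHom_add f g)).trans (map_add _ _ _)
  map_smul' c f := (congrArg _ (ofHom_smul_eq c f)).trans
    (ExtAlgebra.ofComp_smul k cls c _)

theorem compToYoneda_injective {M : Type v} [AddCommGroup M] [Module A M] {n : ℕ}
    {cls : Ext.{v} (ModuleCat.of A (DegreeZeroModule 𝒜)) (ModuleCat.of A M) n}
    (h : ∀ y : Ext.{v} (ModuleCat.of A M) (ModuleCat.of A (DegreeZeroModule 𝒜)) 0,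
      cls.comp y (add_zero n) = 0 → y = 0) : Function.Injective (compToYoneda (k := k) cls) := by
  intro f g hfg
  exact congrArg ModuleCat.Hom.hom (ExtAlgebra.ofComp_injective k h hfg)

theorem range_compToYoneda {M : Type v} [AddCommGroup M] [Module A M] {n : ℕ}
    {cls : Ext.{v} (ModuleCat.of A (DegreeZeroModule 𝒜)) (ModuleCat.of A M) n}
    (h : ∀ x : Ext.{v} (ModuleCat.of A (DegreeZeroModule 𝒜))
      (ModuleCat.of A (DegreeZeroModule 𝒜)) n,
      ∃ y : Ext.{v} (ModuleCat.of A M) (ModuleCat.of A (DegreeZeroModule 𝒜)) 0,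
        cls.comp y (add_zero n) = x) :
    LinearMap.range (compToYoneda cls) = ExtAlgebra.grading _ k n := by
  rw [← ExtAlgebra.range_ofComp k h]
  ext x
  constructor
  · rintro ⟨f, rfl⟩
    exact ⟨_, rfl⟩
  · rintro ⟨f, rfl⟩
    exact ⟨f.hom, rfl⟩

/-- `F'`, `F` and `f` form a morphism of short exact sequences to `A₊ → A → A / A₊`. Ext¹ of `A₍₀₎`
is represented through this fixed sequence, so a product with a degree-one class on the left amounts
to lifting `f` to `F` and restricting to `F'`. -/
theorem extClass_naturality_augmentation {M₁ M₂ M₃ : Type v} [AddCommGroup M₁] [AddCommGroup M₂]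
    [AddCommGroup M₃] [Module A M₁] [Module A M₂] [Module A M₃] {i : M₁ →ₗ[A] M₂}
    {p : M₂ →ₗ[A] M₃} {w}
    (hS : (ShortComplex.mk (ModuleCat.ofHom i) (ModuleCat.ofHom p) w).ShortExact)
    (f : M₃ →ₗ[A] DegreeZeroModule 𝒜) (F : M₂ →ₗ[A] A) (F' : M₁ →ₗ[A] AugmentationIdeal 𝒜)
    (hF : ∀ x, Submodule.Quotient.mk (F x) = f (p x)) (hF' : ∀ z, (F' z : A) = F (i z)) :
    (Ext.mk₀ (ModuleCat.ofHom f)).comp (augmentationComplex_shortExact 𝒜).extClass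
      (zero_add 1) = hS.extClass.comp (Ext.mk₀ (ModuleCat.ofHom F')) (add_zero 1) :=
  (ShortComplex.ShortExact.extClass_naturality hS (augmentationComplex_shortExact 𝒜)
    { τ₁ := ModuleCat.ofHom F'
      τ₂ := ModuleCat.ofHom F
      τ₃ := ModuleCat.ofHom f
      comm₁₂ := ModuleCat.hom_ext (LinearMap.ext hF')
      comm₂₃ := ModuleCat.hom_ext (LinearMap.ext hF) }).symm

variable (𝒜) in
/-- The class in the Yoneda algebra of a homomorphism from the augmentation ideal to `A₍₀₎`. -/
def augToYoneda : (AugmentationIdeal 𝒜 →ₗ[A] DegreeZeroModule 𝒜) →ₗ[k] YonedaAlgebra 𝒜 :=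
  compToYoneda (augmentationComplex_shortExact 𝒜).extClass

/-- A homomorphism from `A` to the semisimple quotient kills the augmentation ideal, so the
connecting map is injective. -/
theorem augToYoneda_injective : Function.Injective (augToYoneda 𝒜) := by
  refine compToYoneda_injective fun y hy => ?_
  refine (augmentationComplex_shortExact 𝒜).eq_zero_of_extClass_comp_eq_zero ?_ _ y hy
  intro g
  apply ModuleCat.hom_ext
  apply LinearMap.ext
  rintro ⟨z, hz⟩
  refine map_smul_top_eq_zero (M := A) g.hom ?_
  have h := Submodule.smul_mem_smul hz (Submodule.mem_top (x := (1 : A)))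
  rwa [show z • (1 : A) = z from mul_one z] at h

theorem range_augToYoneda :
    LinearMap.range (augToYoneda 𝒜) = ExtAlgebra.grading _ k 1 :=
  range_compToYoneda fun x =>
    (augmentationComplex_shortExact 𝒜).exists_extClass_comp_eq (add_zero 1) x

variable (𝒜) in
/-- The class in the Yoneda algebra of an endomorphism of `A₍₀₎`. -/
def endToYoneda : (DegreeZeroModule 𝒜 →ₗ[A] DegreeZeroModule 𝒜) →ₗ[k] YonedaAlgebra 𝒜 :=
  compToYoneda (Ext.mk₀ (𝟙 _))

theorem endToYoneda_apply (f : DegreeZeroModule 𝒜 →ₗ[A] DegreeZeroModule 𝒜) :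
    endToYoneda 𝒜 f = ExtAlgebra.of _ k 0 (Ext.mk₀ (ModuleCat.ofHom f)) :=
  ExtAlgebra.ofComp_id k _

theorem endToYoneda_injective : Function.Injective (endToYoneda 𝒜) :=
  compToYoneda_injective fun y hy => (Ext.mk₀_id_comp y).symm.trans hy

theorem range_endToYoneda :
    LinearMap.range (endToYoneda 𝒜) = ExtAlgebra.grading _ k 0 :=
  range_compToYoneda fun x => ⟨x, Ext.mk₀_id_comp x⟩

variable (𝒜) in
theorem endToYoneda_id : endToYoneda 𝒜 LinearMap.id = 1 := endToYoneda_apply _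

theorem endToYoneda_mul_endToYoneda (s t : DegreeZeroModule 𝒜 →ₗ[A] DegreeZeroModule 𝒜) :
    endToYoneda 𝒜 s * endToYoneda 𝒜 t = endToYoneda 𝒜 (s ∘ₗ t) := by
  rw [endToYoneda_apply s]
  exact ExtAlgebra.of_zero_mul_ofComp k (Ext.mk₀ (𝟙 _)) (ModuleCat.ofHom s) (ModuleCat.ofHom t)

theorem endToYoneda_mul_augToYoneda (s : DegreeZeroModule 𝒜 →ₗ[A] DegreeZeroModule 𝒜)
    (f : AugmentationIdeal 𝒜 →ₗ[A] DegreeZeroModule 𝒜) :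
    endToYoneda 𝒜 s * augToYoneda 𝒜 f = augToYoneda 𝒜 (s ∘ₗ f) := by
  rw [endToYoneda_apply s]
  exact ExtAlgebra.of_zero_mul_ofComp k (augmentationComplex_shortExact 𝒜).extClass
    (ModuleCat.ofHom s) (ModuleCat.ofHom f)

/-- The case of `extClass_naturality_augmentation` in which both sequences are the augmentation
sequence. -/
theorem augToYoneda_mul_endToYoneda (g : AugmentationIdeal 𝒜 →ₗ[A] DegreeZeroModule 𝒜)
    (f : DegreeZeroModule 𝒜 →ₗ[A] DegreeZeroModule 𝒜) (F : A →ₗ[A] A)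
    (F' : AugmentationIdeal 𝒜 →ₗ[A] AugmentationIdeal 𝒜)
    (hF : ∀ x, Submodule.Quotient.mk (F x) = f (Submodule.Quotient.mk x))
    (hF' : ∀ z, (F' z : A) = F z) :
    augToYoneda 𝒜 g * endToYoneda 𝒜 f = augToYoneda 𝒜 (g ∘ₗ F') := by
  refine (ExtAlgebra.ofComp_mul_ofComp k (Ext.mk₀ (𝟙 _)) _ _ (ModuleCat.ofHom f) _
    (extClass_naturality_augmentation (augmentationComplex_shortExact 𝒜) f F F' hF hF')
    (ModuleCat.ofHom g)).trans ?_
  rw [Ext.mk₀_id_comp]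
  rfl

/-- `A₍₀₎` is a finitely generated module, so its projective dimension is bounded and its higher
self-extensions vanish. -/
theorem exists_grading_eq_bot (hgl : HasFiniteGlobalDimension A) :
    ∃ N, ∀ n, N ≤ n →
      ExtAlgebra.grading (ModuleCat.of A (DegreeZeroModule 𝒜)) k n = ⊥ := by
  obtain ⟨d, hd⟩ := hgl
  have := hd (ModuleCat.of A (DegreeZeroModule 𝒜))
    (inferInstanceAs (Module.Finite A (DegreeZeroModule 𝒜)))
  refine ⟨d + 1, fun n hn => ?_⟩
  rw [eq_bot_iff]
  rintro _ ⟨x, rfl⟩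
  rw [Ext.eq_zero_of_hasProjectiveDimensionLT x (d + 1) hn, map_zero]
  exact Submodule.zero_mem _

namespace LinearResolution

variable (L : LinearResolution 𝒜)

/-- The syzygies as objects of the category of modules. -/
def syzygyObj : ℕ → ModuleCat.{v} A
  | 0 => ModuleCat.of A (DegreeZeroModule 𝒜)
  | n + 1 => ModuleCat.of A (LinearMap.range (L.d n))

/-- The syzygies `Z 0 = A₍₀₎` and `Z (n + 1) = ker (P n → Z n)`. -/
def Z (n : ℕ) : Type v := L.syzygyObj n

instance (n : ℕ) : AddCommGroup (L.Z n) := inferInstanceAs (AddCommGroup (L.syzygyObj n))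

instance (n : ℕ) : Module A (L.Z n) := inferInstanceAs (Module A (L.syzygyObj n))

/-- The projection onto a syzygy. -/
def proj : ∀ n, L.P n →ₗ[A] L.Z n
  | 0 => L.ε
  | n + 1 => (L.d n).rangeRestrict

/-- The inclusion of a syzygy. -/
def incl (n : ℕ) : L.Z (n + 1) →ₗ[A] L.P n := Submodule.subtype (LinearMap.range (L.d n))

theorem incl_proj (n : ℕ) (x : L.P (n + 1)) : L.incl n (L.proj (n + 1) x) = L.d n x := rfl

theorem proj_surjective : ∀ n, Function.Surjective (L.proj n)
  | 0 => L.ε_surjective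
  | n + 1 => (L.d n).surjective_rangeRestrict

theorem incl_injective (n : ℕ) : Function.Injective (L.incl n) := Subtype.val_injective

theorem exact_incl_proj (n : ℕ) : Function.Exact (L.incl n) (L.proj n) := by
  intro y
  have h1 : y ∈ Set.range (L.incl n) ↔ y ∈ Set.range (L.d n) := by
    constructor
    · rintro ⟨⟨_, x, rfl⟩, rfl⟩
      exact ⟨x, rfl⟩
    · rintro ⟨x, rfl⟩
      exact ⟨L.proj (n + 1) x, rfl⟩
  rw [h1]
  cases n with
  | zero => exact L.exact_zero y
  | succ n =>
    rw [← L.exact_succ n y]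
    exact Subtype.ext_iff

/-- The short complex `Z (n + 1) → P n → Z n`. -/
abbrev syzygyComplex (n : ℕ) : ShortComplex (ModuleCat.{v} A) :=
  ShortComplex.mk (X₁ := ModuleCat.of A (L.Z (n + 1))) (X₂ := ModuleCat.of A (L.P n))
    (X₃ := ModuleCat.of A (L.Z n)) (ModuleCat.ofHom (L.incl n)) (ModuleCat.ofHom (L.proj n)) (by
      ext x
      exact (L.exact_incl_proj n _).2 ⟨x, rfl⟩)

theorem syzygyComplex_shortExact (n : ℕ) : (L.syzygyComplex n).ShortExact :=
  ModuleCat.shortComplex_shortExact _ (L.exact_incl_proj n) (L.incl_injective n)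
    (L.proj_surjective n)

instance (n : ℕ) : Projective (L.syzygyComplex n).X₂ :=
  (IsProjective.iff_projective (R := A) (L.P n)).1 (L.projective n)

theorem incl_mem (n : ℕ) (z : L.Z (n + 1)) :
    L.incl n z ∈ (HomogeneousIdeal.irrelevant 𝒜).toIdeal • (⊤ : Submodule A (L.P n)) := by
  obtain ⟨x, rfl⟩ := L.proj_surjective (n + 1) z
  rw [incl_proj]
  exact L.minimal n x

/-- The class of the first `n` steps of the resolution. -/
def resClass : ∀ n, Ext.{v} (ModuleCat.of A (DegreeZeroModule 𝒜)) (ModuleCat.of A (L.Z n)) n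
  | 0 => Ext.mk₀ (𝟙 (ModuleCat.of A (DegreeZeroModule 𝒜)))
  | n + 1 => (resClass n).comp (L.syzygyComplex_shortExact n).extClass rfl

/-- Iterated dimension shifting: each short exact sequence of syzygies has a projective middle term.
-/
theorem exists_resClass_comp {Y : ModuleCat.{v} A} (j m : ℕ) :
    ∀ n (h : j + m = n) (x : Ext.{v} (ModuleCat.of A (DegreeZeroModule 𝒜)) Y n),
      ∃ y : Ext.{v} (ModuleCat.of A (L.Z j)) Y m, (L.resClass j).comp y h = x := by
  induction j generalizing m with
  | zero =>
    intro n h x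
    obtain rfl : m = n := by omega
    exact ⟨x, Ext.mk₀_id_comp x⟩
  | succ j ih =>
    intro n h x
    obtain ⟨y, rfl⟩ := ih (m + 1) n (by omega) x
    obtain ⟨z, rfl⟩ := (L.syzygyComplex_shortExact j).exists_extClass_comp_eq (add_comm 1 m) y
    exact ⟨z, Ext.comp_assoc _ _ _ rfl (add_comm 1 m) (by omega)⟩

/-- Dimension shifting is also injective for the target `A₍₀₎`: by minimality, `Z (j + 1)` lies in
`A₊ P j`, and homomorphisms to `A₍₀₎` vanish there. -/
theorem eq_zero_of_resClass_comp (j : ℕ) : ∀ (m n : ℕ) (h : j + m = n)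
    (y : Ext.{v} (ModuleCat.of A (L.Z j)) (ModuleCat.of A (DegreeZeroModule 𝒜)) m),
    (L.resClass j).comp y h = 0 → y = 0 := by
  induction j with
  | zero =>
    intro m n h y hy
    obtain rfl : m = n := by omega
    exact (Ext.mk₀_id_comp y).symm.trans hy
  | succ j ih =>
    intro m n h y hy
    have h1 := (Ext.comp_assoc (L.resClass j) (L.syzygyComplex_shortExact j).extClass y rfl
      (add_comm 1 m) (a := n) (by omega)).symm.trans hy
    have h2 := ih (m + 1) n (by omega) _ h1
    refine (L.syzygyComplex_shortExact j).eq_zero_of_extClass_comp_eq_zero ?_ _ y h2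
    intro g
    apply ModuleCat.hom_ext
    apply LinearMap.ext
    intro z
    exact map_smul_top_eq_zero g.hom (L.incl_mem j z)

/-- The class in the Yoneda algebra of a homomorphism from a syzygy to `A₍₀₎`. -/
def toYoneda (n : ℕ) : (L.Z n →ₗ[A] DegreeZeroModule 𝒜) →ₗ[k] YonedaAlgebra 𝒜 :=
  compToYoneda (L.resClass n)

theorem toYoneda_injective (n : ℕ) : Function.Injective (L.toYoneda n) :=
  compToYoneda_injective fun y hy => L.eq_zero_of_resClass_comp n 0 n rfl y hy

theorem range_toYoneda (n : ℕ) :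
    LinearMap.range (L.toYoneda n) = ExtAlgebra.grading _ k n :=
  range_compToYoneda fun x => L.exists_resClass_comp n 0 n rfl x

theorem endToYoneda_mul_toYoneda (n : ℕ) (s : DegreeZeroModule 𝒜 →ₗ[A] DegreeZeroModule 𝒜)
    (f : L.Z n →ₗ[A] DegreeZeroModule 𝒜) :
    endToYoneda 𝒜 s * L.toYoneda n f = L.toYoneda n (s ∘ₗ f) := by
  rw [endToYoneda_apply s]
  exact ExtAlgebra.of_zero_mul_ofComp k (L.resClass n) (ModuleCat.ofHom s) (ModuleCat.ofHom f)

/-- The Yoneda product with an element of degree one is computed by lifting. -/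
theorem augToYoneda_mul_toYoneda (n : ℕ) (g : AugmentationIdeal 𝒜 →ₗ[A] DegreeZeroModule 𝒜)
    (f : L.Z n →ₗ[A] DegreeZeroModule 𝒜) (F : L.P n →ₗ[A] A)
    (F' : L.Z (n + 1) →ₗ[A] AugmentationIdeal 𝒜)
    (hF : ∀ x, Submodule.Quotient.mk (F x) = f (L.proj n x))
    (hF' : ∀ z, (F' z : A) = F (L.incl n z)) :
    augToYoneda 𝒜 g * L.toYoneda n f = L.toYoneda (n + 1) (g ∘ₗ F') :=
  ExtAlgebra.ofComp_mul_ofComp k (L.resClass n) _ _ (ModuleCat.ofHom f) _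
    (extClass_naturality_augmentation (L.syzygyComplex_shortExact n) f F F' hF hF')
    (ModuleCat.ofHom g)

end LinearResolution

end Syzygy

/-! ### Coefficients of vertices and arrows -/

/-- The arrows of a quiver, with arbitrary end points. -/
structure QuiverArrow (V : Type) [Quiver.{0} V] where
  /-- The source. -/
  src : V
  /-- The target. -/
  tgt : V
  /-- The arrow. -/
  hom : src ⟶ tgt

instance (V : Type) [Quiver.{0} V] [Finite V] [∀ a b : V, Finite (a ⟶ b)] :
    Finite (QuiverArrow V) :=
  Finite.of_injective (fun α => (⟨α.src, α.tgt, α.hom⟩ : Σ a b : V, (a ⟶ b)))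
    (fun α β h => by
      cases α
      cases β
      simp only [Sigma.mk.injEq] at h
      obtain ⟨rfl, h⟩ := h
      simp only [heq_eq_eq, Sigma.mk.injEq] at h
      obtain ⟨rfl, h⟩ := h
      rw [eq_of_heq h])

instance (V : Type) [Quiver.{0} V] [Fintype V] [∀ a b : V, Finite (a ⟶ b)] :
    Fintype (QuiverArrow V) := Fintype.ofFinite _

/-- An arrow as a path. -/
abbrev QuiverArrow.path {V : Type} [Quiver.{0} V] (α : QuiverArrow V) : AnyPath V :=
  PathAlgebra.arrow α.hom

namespace PathAlgebra

section

variable {V : Type} [Quiver.{0} V]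

theorem vertex_injective : Function.Injective (vertex : V → AnyPath V) :=
  fun _ _ h => congrArg Sigma.fst h

theorem path_injective : Function.Injective (QuiverArrow.path : QuiverArrow V → AnyPath V) := by
  rintro ⟨a, b, α⟩ ⟨a', b', α'⟩ h
  simp only [QuiverArrow.path, arrow, Sigma.mk.injEq] at h
  obtain ⟨rfl, h⟩ := h
  simp only [heq_eq_eq, Sigma.mk.injEq] at h
  obtain ⟨rfl, h⟩ := h
  simp only [heq_eq_eq] at h
  have : α = α' := by
    simpa [Quiver.Hom.toPath] using h
  rw [this]

theorem exists_path_of_length {p : AnyPath V} (h : p.length = 1) :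
    ∃ α : QuiverArrow V, p = α.path := by
  obtain ⟨a, b, c, q, α, rfl, hq⟩ := exists_cons_of_length h
  have hb : b = a := by
    cases q with
    | nil => rfl
    | cons q β => simp [AnyPath.length] at hq
  subst hb
  have : q = Quiver.Path.nil := Quiver.Path.eq_nil_of_length_zero q hq
  subst this
  exact ⟨⟨b, c, α⟩, by rw [Quiver.Path.nil_comp]⟩

theorem length_path (α : QuiverArrow V) : α.path.length = 1 := rfl

theorem length_vertex (a : V) : (vertex a).length = 0 := rfl

theorem path_ne_vertex (α : QuiverArrow V) (a : V) : α.path ≠ vertex a := by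
  intro h
  have := congrArg AnyPath.length h
  rw [length_path, length_vertex] at this
  omega

variable {k : Type u} [Field k]

/-- A concatenation is a trivial path only if both factors are. -/
theorem coeff_vertex_mul (a : V) (x y : PathAlgebra k V) :
    coeff (vertex a) (x * y) = coeff (vertex a) x * coeff (vertex a) y := by
  classical
  have : (mulLin k).compr₂ (coeff (k := k) (vertex a)) =
      (LinearMap.mul k k).compl₁₂ (coeff (vertex a)) (coeff (vertex a)) := by
    apply linearMap_ext
    intro p
    apply linearMap_ext
    intro q
    simp only [LinearMap.compr₂_apply, LinearMap.compl₁₂_apply, LinearMap.mul_apply', ← mul_def,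
      coeff_ofPath]
    obtain ⟨s, t, p⟩ := p
    obtain ⟨t', r, q⟩ := q
    by_cases h : t = t'
    · subst h
      rw [comp_mul, coeff_ofPath]
      by_cases hl : p.length + q.length = 0
      · have hp : p.length = 0 := by omega
        have hq : q.length = 0 := by omega
        cases p with
        | cons p α => simp at hp
        | nil =>
          cases q with
          | cons q α => simp at hq
          | nil =>
            rw [Quiver.Path.nil_comp]
            split_ifs <;> simp
      · rw [if_neg]
        · by_cases hp : p.length = 0
          · rw [if_neg (c := (⟨t, r, q⟩ : AnyPath V) = vertex a), mul_zero]
            intro h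
            have : q.length = 0 := congrArg AnyPath.length h
            omega
          · rw [if_neg (c := (⟨s, t, p⟩ : AnyPath V) = vertex a), zero_mul]
            intro h
            exact hp (congrArg AnyPath.length h)
        · intro h
          have := congrArg AnyPath.length h
          rw [length_comp] at this
          exact hl this
    · rw [mul_of_ne (by exact h), map_zero]
      split_ifs with h1 h2
      · simp only [Sigma.mk.injEq] at h1 h2
        obtain ⟨rfl, h1⟩ := h1
        simp only [heq_eq_eq, Sigma.mk.injEq] at h1
        exact absurd (h1.1.trans h2.1.symm) h
      all_goals simp
  exact LinearMap.congr_fun (LinearMap.congr_fun this x) y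

/-- A concatenation of length one consists of an arrow and a trivial path, on either side; hence a
Leibniz rule. -/
theorem coeff_path_mul (α : QuiverArrow V) (x y : PathAlgebra k V) :
    coeff α.path (x * y) = coeff (vertex α.src) x * coeff α.path y +
      coeff α.path x * coeff (vertex α.tgt) y := by
  classical
  have : (mulLin k).compr₂ (coeff (k := k) α.path) =
      (LinearMap.mul k k).compl₁₂ (coeff (vertex α.src)) (coeff α.path) +
      (LinearMap.mul k k).compl₁₂ (coeff α.path) (coeff (vertex α.tgt)) := by
    apply linearMap_ext
    intro p
    apply linearMap_ext
    intro q
    simp only [LinearMap.compr₂_apply, LinearMap.add_apply, LinearMap.compl₁₂_apply,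
      LinearMap.mul_apply', ← mul_def, coeff_ofPath]
    have hpq : ∀ (p q : AnyPath V) (b : V), p.length ≠ q.length → p ≠ q := by
      rintro p q - h rfl
      exact h rfl
    by_cases hp : p.length = 0
    · rw [if_neg (c := p = α.path) (hpq _ _ α.src (by rw [hp, length_path]; omega)), zero_mul,
        add_zero, eq_vertex_of_length hp]
      by_cases h : p.1 = q.1
      · rw [h, comp_mul, Quiver.Path.nil_comp, coeff_ofPath]
        by_cases hq : q = α.path
        · subst hq
          simp
        · rw [if_neg hq, mul_zero]
      · rw [mul_of_ne (by exact h), map_zero]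
        by_cases hq : q = α.path
        · subst hq
          rw [if_neg, zero_mul]
          exact fun h' => h (vertex_injective h')
        · rw [if_neg hq, mul_zero]
    · rw [if_neg (c := p = vertex α.src) (hpq _ _ α.src (by rw [length_vertex]; exact hp)),
        zero_mul, zero_add]
      by_cases hq : q.length = 0
      · rw [eq_vertex_of_length hq]
        obtain ⟨s, t, p⟩ := p
        by_cases h : t = q.1
        · subst h
          rw [comp_mul, Quiver.Path.comp_nil, coeff_ofPath]
          split_ifs with h1 h2
          · simp
          · exfalso
            have h3 : q.1 = α.tgt := by
              have := congrArg (fun r : AnyPath V => r.2.1) h1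
              exact this
            exact h2 (congrArg vertex h3)
          all_goals simp
        · rw [mul_of_ne (by exact h), map_zero]
          split_ifs with h1 h2
          · exfalso
            have h3 : t = α.tgt := congrArg (fun r : AnyPath V => r.2.1) h1
            exact h (h3.trans (vertex_injective h2).symm)
          all_goals simp
      · rw [if_neg (c := q = vertex α.tgt) (hpq _ _ α.src (by rw [length_vertex]; exact hq)),
          mul_zero]
        obtain ⟨s, t, p⟩ := p
        obtain ⟨t', r, q⟩ := q
        by_cases h : t = t'
        · subst h
          rw [comp_mul, coeff_ofPath, if_neg]
          apply hpq _ _ s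
          rw [length_comp, length_path]
          omega
        · rw [mul_of_ne (by exact h), map_zero]
  exact LinearMap.congr_fun (LinearMap.congr_fun this x) y

end


variable {k : Type u} [Field k] {V : Type} [Fintype V] [Quiver.{0} V]

theorem restrict_length_zero (x : PathAlgebra k V) :
    restrict (fun p => p.length = 0) x = ∑ a, coeff (vertex a) x • ofPath k (vertex a) := by
  classical
  have : restrict (fun p => p.length = 0) =
      ∑ a : V, (coeff (k := k) (vertex a)).smulRight (ofPath k (vertex a)) := by
    apply linearMap_ext
    intro p
    simp only [LinearMap.sum_apply, LinearMap.smulRight_apply, restrict_ofPath, coeff_ofPath]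
    split_ifs with h
    · rw [Finset.sum_eq_single p.1]
      · rw [if_pos (eq_vertex_of_length h), one_smul]
        exact congrArg (ofPath k) (eq_vertex_of_length h)
      · intro a _ ha
        rw [if_neg, zero_smul]
        rintro rfl
        exact ha rfl
      · simp
    · refine (Finset.sum_eq_zero fun a _ => ?_).symm
      rw [if_neg, zero_smul]
      rintro rfl
      exact h rfl
  rw [this]
  simp

theorem restrict_length_one [∀ a b : V, Finite (a ⟶ b)] (x : PathAlgebra k V) :
    restrict (fun p => p.length = 1) x =
      ∑ α : QuiverArrow V, coeff α.path x • ofPath k α.path := by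
  classical
  have : restrict (fun p => p.length = 1) =
      ∑ α : QuiverArrow V, (coeff (k := k) α.path).smulRight (ofPath k α.path) := by
    apply linearMap_ext
    intro p
    simp only [LinearMap.sum_apply, LinearMap.smulRight_apply, restrict_ofPath, coeff_ofPath]
    split_ifs with h
    · obtain ⟨α, rfl⟩ := exists_path_of_length h
      rw [Finset.sum_eq_single α]
      · rw [if_pos rfl, one_smul]
      · intro β _ hβ
        rw [if_neg, zero_smul]
        exact fun h => hβ (path_injective h).symm
      · simp
    · refine (Finset.sum_eq_zero fun α _ => ?_).symm
      rw [if_neg, zero_smul]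
      rintro rfl
      exact h rfl
  rw [this]
  simp

end PathAlgebra

open PathAlgebra

namespace IsGradedPresentation

variable {k : Type u} [Field k] {A : Type v} [Ring A] [Algebra k A]
  {𝒜 : ℕ → Submodule k A}
  {V : Type} [Fintype V] [Quiver.{0} V] {ρ : PathAlgebra k V →ₐ[k] A}
  (hρ : IsGradedPresentation 𝒜 ρ)

/-- The coefficient of a path of length at most one. -/
def lowCoeff (p : AnyPath V) (hp : p.length < 2) : A →ₗ[k] k where
  -- The choice of preimage does not matter: two preimages differ by a relation, and relations
  -- involve only paths of length at least two.
  toFun a := coeff p (Function.surjInv hρ.surjective a)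
  map_add' a b := by
    rw [← sub_eq_zero, ← map_add, ← map_sub]
    by_contra h
    have := hρ.two_le _ (by simp [Function.surjInv_eq]) p h
    omega
  map_smul' c a := by
    rw [RingHom.id_apply, ← map_smul, ← sub_eq_zero, ← map_sub]
    by_contra h
    have := hρ.two_le _ (by simp [Function.surjInv_eq]) p h
    omega

theorem lowCoeff_apply (p : AnyPath V) (hp : p.length < 2) (x : PathAlgebra k V) :
    hρ.lowCoeff p hp (ρ x) = coeff p x := by
  change coeff p (Function.surjInv hρ.surjective (ρ x)) = coeff p x
  rw [← sub_eq_zero, ← map_sub]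
  by_contra h
  have := hρ.two_le _ (by simp [Function.surjInv_eq]) p h
  omega

/-- The coefficient of a vertex. -/
def vertexCoeff (a : V) : A →ₗ[k] k := hρ.lowCoeff (vertex a) (by rw [length_vertex]; omega)

/-- The coefficient of an arrow. -/
def arrowCoeff (α : QuiverArrow V) : A →ₗ[k] k :=
  hρ.lowCoeff α.path (by rw [length_path]; omega)

/-- The idempotent of a vertex. -/
abbrev e (ρ : PathAlgebra k V →ₐ[k] A) (a : V) : A := ρ (ofPath k (vertex a))

/-- The image of an arrow. -/
abbrev x (ρ : PathAlgebra k V →ₐ[k] A) (α : QuiverArrow V) : A := ρ (ofPath k α.path)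

theorem vertexCoeff_apply (a : V) (y : PathAlgebra k V) :
    hρ.vertexCoeff a (ρ y) = coeff (vertex a) y := hρ.lowCoeff_apply _ _ y

theorem arrowCoeff_apply (α : QuiverArrow V) (y : PathAlgebra k V) :
    hρ.arrowCoeff α (ρ y) = coeff α.path y := hρ.lowCoeff_apply _ _ y

theorem vertexCoeff_mul (a : V) (y z : A) :
    hρ.vertexCoeff a (y * z) = hρ.vertexCoeff a y * hρ.vertexCoeff a z := by
  obtain ⟨y, rfl⟩ := hρ.surjective y
  obtain ⟨z, rfl⟩ := hρ.surjective z
  rw [← map_mul]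
  simp only [vertexCoeff_apply, coeff_vertex_mul]

theorem arrowCoeff_mul (α : QuiverArrow V) (y z : A) :
    hρ.arrowCoeff α (y * z) = hρ.vertexCoeff α.src y * hρ.arrowCoeff α z +
      hρ.arrowCoeff α y * hρ.vertexCoeff α.tgt z := by
  obtain ⟨y, rfl⟩ := hρ.surjective y
  obtain ⟨z, rfl⟩ := hρ.surjective z
  rw [← map_mul]
  simp only [vertexCoeff_apply, arrowCoeff_apply, coeff_path_mul]

open Classical in
theorem vertexCoeff_e (a b : V) : hρ.vertexCoeff a (e ρ b) = if b = a then 1 else 0 := by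
  rw [vertexCoeff_apply, coeff_ofPath]
  simp only [vertex_injective.eq_iff]

open Classical in
theorem arrowCoeff_x (α β : QuiverArrow V) :
    hρ.arrowCoeff α (x ρ β) = if β = α then 1 else 0 := by
  rw [arrowCoeff_apply, coeff_ofPath]
  simp only [path_injective.eq_iff]

theorem vertexCoeff_x (a : V) (β : QuiverArrow V) : hρ.vertexCoeff a (x ρ β) = 0 := by
  rw [vertexCoeff_apply, coeff_ofPath, if_neg (path_ne_vertex β a)]

theorem arrowCoeff_e (α : QuiverArrow V) (b : V) : hρ.arrowCoeff α (e ρ b) = 0 := by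
  rw [arrowCoeff_apply, coeff_ofPath, if_neg (path_ne_vertex α b).symm]

omit [Fintype V] in
theorem _root_.PathAlgebra.vertex_mul_path (α : QuiverArrow V) :
    ofPath k (vertex α.src) * ofPath k α.path = ofPath k α.path := by
  rw [comp_mul, Quiver.Path.nil_comp]

omit [Fintype V] in
theorem _root_.PathAlgebra.path_mul_vertex (α : QuiverArrow V) :
    ofPath k α.path * ofPath k (vertex α.tgt) = ofPath k α.path := by
  rw [comp_mul, Quiver.Path.comp_nil]

theorem e_mul_self (ρ : PathAlgebra k V →ₐ[k] A) (a : V) : e ρ a * e ρ a = e ρ a := by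
  rw [← map_mul, comp_mul, Quiver.Path.nil_comp]

theorem e_mul_of_ne (ρ : PathAlgebra k V →ₐ[k] A) {a b : V} (h : a ≠ b) :
    e ρ a * e ρ b = 0 := by
  rw [← map_mul, mul_of_ne (by exact h), map_zero]

theorem sum_e (ρ : PathAlgebra k V →ₐ[k] A) : ∑ a, e ρ a = 1 := by
  rw [← map_one ρ, one_def, map_sum]

theorem e_mul_x (ρ : PathAlgebra k V →ₐ[k] A) (α : QuiverArrow V) :
    e ρ α.src * x ρ α = x ρ α := by
  rw [← map_mul, vertex_mul_path]

theorem x_mul_e (ρ : PathAlgebra k V →ₐ[k] A) (α : QuiverArrow V) :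
    x ρ α * e ρ α.tgt = x ρ α := by
  rw [← map_mul, path_mul_vertex]

section Graded

variable [GradedAlgebra 𝒜]

theorem gradedProj_zero (y : A) :
    GradedAlgebra.proj 𝒜 0 y = ∑ a, hρ.vertexCoeff a y • e ρ a := by
  obtain ⟨y, rfl⟩ := hρ.surjective y
  simp only [hρ.proj_apply, restrict_length_zero, map_sum, map_smul, vertexCoeff_apply]

theorem gradedProj_one [∀ a b : V, Finite (a ⟶ b)] (y : A) :
    GradedAlgebra.proj 𝒜 1 y = ∑ α, hρ.arrowCoeff α y • x ρ α := by
  obtain ⟨y, rfl⟩ := hρ.surjective y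
  simp only [hρ.proj_apply, restrict_length_one, map_sum, map_smul, arrowCoeff_apply]

end Graded

end IsGradedPresentation

/-! ### The semisimple quotient -/

section Frame

variable {k : Type u} [Field k] {A : Type v} [Ring A] [Algebra k A]

/-- A basis of `A₍₀₎` consisting of orthogonal idempotents, together with the coordinate forms. -/
structure IsVertexFrame (𝒜 : ℕ → Submodule k A) [GradedAlgebra 𝒜] {V : Type} [Fintype V]
    (e : V → A) (c : V → A →ₗ[k] k) : Prop where
  proj_zero : ∀ y, GradedAlgebra.proj 𝒜 0 y = ∑ a, c a y • e a
  coeff_self : ∀ a, c a (e a) = 1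
  coeff_ne : ∀ a b, a ≠ b → c a (e b) = 0
  coeff_mul : ∀ a y z, c a (y * z) = c a y * c a z

theorem IsGradedPresentation.isVertexFrame {𝒜 : ℕ → Submodule k A} [GradedAlgebra 𝒜] {V : Type}
    [Fintype V] [Quiver.{0} V] {ρ : PathAlgebra k V →ₐ[k] A} (hρ : IsGradedPresentation 𝒜 ρ) :
    IsVertexFrame 𝒜 (IsGradedPresentation.e ρ) hρ.vertexCoeff where
  proj_zero := hρ.gradedProj_zero
  coeff_self a := by rw [hρ.vertexCoeff_e, if_pos rfl]
  coeff_ne a b h := by rw [hρ.vertexCoeff_e, if_neg h.symm]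
  coeff_mul := hρ.vertexCoeff_mul

variable {𝒜 : ℕ → Submodule k A} [GradedAlgebra 𝒜]

theorem mem_irrelevant_toIdeal_iff {y : A} :
    y ∈ (HomogeneousIdeal.irrelevant 𝒜).toIdeal ↔ GradedAlgebra.proj 𝒜 0 y = 0 :=
  HomogeneousIdeal.mem_irrelevant_iff 𝒜 y

theorem mem_irrelevant_of_mem {n : ℕ} {y : A} (hy : y ∈ 𝒜 (n + 1)) :
    y ∈ (HomogeneousIdeal.irrelevant 𝒜).toIdeal :=
  mem_irrelevant_toIdeal_iff.2 (gradedProj_of_mem_ne 𝒜 hy (by omega))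

theorem mul_mem_irrelevant {y : A} (hy : y ∈ (HomogeneousIdeal.irrelevant 𝒜).toIdeal) (z : A) :
    y * z ∈ (HomogeneousIdeal.irrelevant 𝒜).toIdeal := by
  rw [mem_irrelevant_toIdeal_iff] at hy ⊢
  rw [gradedProj_zero_mul, hy, zero_mul]

/-- Since `z` has nothing in degree zero, only the degree-zero part of `y` contributes. This is what
makes `IsVertexFrame.dual` linear over `A`. -/
theorem gradedProj_one_mul_of_mem_irrelevant (y : A) {z : A}
    (hz : z ∈ (HomogeneousIdeal.irrelevant 𝒜).toIdeal) :
    GradedAlgebra.proj 𝒜 1 (y * z) = GradedAlgebra.proj 𝒜 0 y * GradedAlgebra.proj 𝒜 1 z := by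
  rw [mem_irrelevant_toIdeal_iff] at hz
  rw [gradedProj_mul, Finset.sum_eq_single (0, 1)]
  · rintro ⟨i, j⟩ hij hne
    rw [Finset.HasAntidiagonal.mem_antidiagonal] at hij
    dsimp only at hij ⊢
    obtain rfl : j = 0 := by
      by_contra hj
      exact hne (Prod.ext (by dsimp only; omega) (by dsimp only; omega))
    rw [hz, mul_zero]
  · simp

variable (𝒜) in
/-- The class of an element in the semisimple quotient. -/
abbrev classZero (y : A) : DegreeZeroModule 𝒜 := Submodule.Quotient.mk y

theorem smul_classZero (y z : A) : y • classZero 𝒜 z = classZero 𝒜 (y * z) := rfl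

theorem classZero_smul (c : k) (z : A) : classZero 𝒜 (c • z) = c • classZero 𝒜 z := rfl

theorem classZero_sum {ι : Type*} (s : Finset ι) (f : ι → A) :
    classZero 𝒜 (∑ i ∈ s, f i) = ∑ i ∈ s, classZero 𝒜 (f i) :=
  map_sum (Submodule.mkQ _) f s

theorem classZero_gradedProj (y : A) : classZero 𝒜 (GradedAlgebra.proj 𝒜 0 y) = classZero 𝒜 y := by
  rw [Submodule.Quotient.eq, mem_irrelevant_toIdeal_iff, map_sub,
    gradedProj_of_mem 𝒜 (gradedProj_mem 𝒜 0 y), sub_self]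

variable (𝒜) in
/-- Right multiplication by an element of `A` on the semisimple quotient. -/
def rightMul (y : A) : DegreeZeroModule 𝒜 →ₗ[A] DegreeZeroModule 𝒜 :=
  Submodule.mapQ _ _ (LinearMap.toSpanSingleton A A y) fun _ hz => mul_mem_irrelevant hz y

theorem rightMul_classZero (y z : A) : rightMul 𝒜 y (classZero 𝒜 z) = classZero 𝒜 (z * y) := rfl

theorem semisimpleHom_ext {f g : DegreeZeroModule 𝒜 →ₗ[A] DegreeZeroModule 𝒜}
    (h : f (classZero 𝒜 1) = g (classZero 𝒜 1)) : f = g := by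
  apply LinearMap.ext
  intro s
  obtain ⟨y, rfl⟩ := Submodule.Quotient.mk_surjective _ s
  have : classZero 𝒜 y = y • classZero 𝒜 1 := by rw [smul_classZero, mul_one]
  change f (classZero 𝒜 y) = g (classZero 𝒜 y)
  rw [this, map_smul, map_smul, h]

theorem exists_eq_rightMul (f : DegreeZeroModule 𝒜 →ₗ[A] DegreeZeroModule 𝒜) :
    ∃ y ∈ 𝒜 0, f = rightMul 𝒜 y := by
  obtain ⟨y, hy⟩ := Submodule.Quotient.mk_surjective _ (f (classZero 𝒜 1))
  refine ⟨GradedAlgebra.proj 𝒜 0 y, gradedProj_mem 𝒜 0 y, semisimpleHom_ext ?_⟩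
  rw [rightMul_classZero, one_mul, classZero_gradedProj, ← hy]

/-- Right multiplications compose in reverse order. This does no harm for vertex idempotents, which
commute. -/
theorem rightMul_comp (y z : A) : rightMul 𝒜 y ∘ₗ rightMul 𝒜 z = rightMul 𝒜 (z * y) := by
  apply semisimpleHom_ext
  simp only [LinearMap.comp_apply, rightMul_classZero, one_mul]

theorem rightMul_injective {y : A} (hy : y ∈ 𝒜 0) (h : rightMul 𝒜 y = 0) : y = 0 := by
  have := LinearMap.congr_fun h (classZero 𝒜 1)
  rw [rightMul_classZero, one_mul, LinearMap.zero_apply, Submodule.Quotient.mk_eq_zero,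
    mem_irrelevant_toIdeal_iff, gradedProj_of_mem 𝒜 hy] at this
  exact this

theorem rightMul_one : rightMul 𝒜 1 = LinearMap.id := by
  apply semisimpleHom_ext
  rw [rightMul_classZero, one_mul, LinearMap.id_apply]

theorem rightMul_add (y z : A) : rightMul 𝒜 (y + z) = rightMul 𝒜 y + rightMul 𝒜 z := by
  apply semisimpleHom_ext
  rw [LinearMap.add_apply, rightMul_classZero, rightMul_classZero, rightMul_classZero, one_mul,
    one_mul, one_mul]
  rfl

theorem rightMul_smul (c : k) (y : A) : rightMul 𝒜 (c • y) = c • rightMul 𝒜 y := by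
  apply semisimpleHom_ext
  rw [LinearMap.smul_apply, rightMul_classZero, rightMul_classZero, one_mul, one_mul,
    classZero_smul]

variable (𝒜) in
/-- Right multiplication as a linear map. -/
def rightMulLin : A →ₗ[k] DegreeZeroModule 𝒜 →ₗ[A] DegreeZeroModule 𝒜 where
  toFun := rightMul 𝒜
  map_add' := rightMul_add
  map_smul' := rightMul_smul

namespace IsVertexFrame

variable {V : Type} [Fintype V] {e : V → A} {c : V → A →ₗ[k] k} (h : IsVertexFrame 𝒜 e c)
include h

theorem coeff_proj (a : V) (y : A) : c a (GradedAlgebra.proj 𝒜 0 y) = c a y := by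
  rw [h.proj_zero, map_sum, Finset.sum_eq_single a]
  · rw [map_smul, h.coeff_self, smul_eq_mul, mul_one]
  · intro b _ hb
    rw [map_smul, h.coeff_ne a b hb.symm, smul_zero]
  · simp

theorem coeff_of_mem_irrelevant (a : V) {y : A}
    (hy : y ∈ (HomogeneousIdeal.irrelevant 𝒜).toIdeal) : c a y = 0 := by
  rw [← h.coeff_proj, mem_irrelevant_toIdeal_iff.1 hy, map_zero]

theorem e_mem (a : V) : e a ∈ 𝒜 0 := by
  have : GradedAlgebra.proj 𝒜 0 (e a) = e a := by
    rw [h.proj_zero, Finset.sum_eq_single a]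
    · rw [h.coeff_self, one_smul]
    · intro b _ hb
      rw [h.coeff_ne b a hb, zero_smul]
    · simp
  rw [← this]
  exact gradedProj_mem 𝒜 0 _

theorem coeff_one (a : V) : c a 1 = 1 := by
  have := h.coeff_mul a 1 (e a)
  rw [one_mul, h.coeff_self, mul_one] at this
  exact this.symm

theorem eq_sum {y : A} (hy : y ∈ 𝒜 0) : y = ∑ a, c a y • e a := by
  rw [← h.proj_zero, gradedProj_of_mem 𝒜 hy]

theorem ext_coeff {y z : A} (hy : y ∈ 𝒜 0) (hz : z ∈ 𝒜 0) (hyz : ∀ a, c a y = c a z) : y = z := by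
  rw [h.eq_sum hy, h.eq_sum hz]
  simp only [hyz]

theorem e_mul (a : V) {y : A} (hy : y ∈ 𝒜 0) : e a * y = c a y • e a := by
  have h0 : e a * y ∈ 𝒜 0 := by simpa using SetLike.mul_mem_graded (h.e_mem a) hy
  refine h.ext_coeff h0 (Submodule.smul_mem _ _ (h.e_mem a)) fun b => ?_
  rw [h.coeff_mul, map_smul, smul_eq_mul]
  by_cases hb : b = a
  · subst hb
    rw [mul_comm]
  · rw [h.coeff_ne b a hb, zero_mul, mul_zero]

theorem mul_e (a : V) {y : A} (hy : y ∈ 𝒜 0) : y * e a = c a y • e a := by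
  have h0 : y * e a ∈ 𝒜 0 := by simpa using SetLike.mul_mem_graded hy (h.e_mem a)
  refine h.ext_coeff h0 (Submodule.smul_mem _ _ (h.e_mem a)) fun b => ?_
  rw [h.coeff_mul, map_smul, smul_eq_mul]
  by_cases hb : b = a
  · subst hb
    rfl
  · rw [h.coeff_ne b a hb, mul_zero, mul_zero]

/-- `A` acts on the simple module spanned by this class through the character `c a`. -/
theorem smul_classZero_e (a : V) (y : A) :
    y • classZero 𝒜 (e a) = c a y • classZero 𝒜 (e a) := by
  rw [smul_classZero, ← classZero_gradedProj, gradedProj_zero_mul,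
    gradedProj_of_mem 𝒜 (h.e_mem a), h.mul_e a (gradedProj_mem 𝒜 0 y), h.coeff_proj,
    classZero_smul]

theorem sum_e : ∑ a, e a = 1 := by
  have h1 : (1 : A) ∈ 𝒜 0 := SetLike.one_mem_graded 𝒜
  conv_rhs => rw [h.eq_sum h1]
  simp only [h.coeff_one, one_smul]

/-- The coordinate forms on the semisimple quotient. -/
def coord (a : V) : DegreeZeroModule 𝒜 →ₗ[k] k :=
  (Submodule.liftQ ((HomogeneousIdeal.irrelevant 𝒜).toIdeal.restrictScalars k) (c a)
    fun _ hy => h.coeff_of_mem_irrelevant a hy) ∘ₗ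
      (Submodule.Quotient.restrictScalarsEquiv k
        (HomogeneousIdeal.irrelevant 𝒜).toIdeal).symm.toLinearMap

theorem coord_classZero (a : V) (y : A) : h.coord a (classZero 𝒜 y) = c a y := rfl

theorem eq_sum_coord (s : DegreeZeroModule 𝒜) : s = ∑ a, h.coord a s • classZero 𝒜 (e a) := by
  obtain ⟨y, rfl⟩ := Submodule.Quotient.mk_surjective _ s
  change classZero 𝒜 y = ∑ a, h.coord a (classZero 𝒜 y) • classZero 𝒜 (e a)
  simp only [h.coord_classZero, ← classZero_smul, ← classZero_sum]
  rw [← h.proj_zero, classZero_gradedProj]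

theorem ext_coord {s t : DegreeZeroModule 𝒜} (hst : ∀ a, h.coord a s = h.coord a t) : s = t := by
  rw [h.eq_sum_coord s, h.eq_sum_coord t]
  simp only [hst]

theorem coord_smul (a : V) (y : A) (s : DegreeZeroModule 𝒜) :
    h.coord a (y • s) = c a y * h.coord a s := by
  obtain ⟨z, rfl⟩ := Submodule.Quotient.mk_surjective _ s
  exact h.coeff_mul a y z

theorem coord_rightMul (a : V) (y : A) (s : DegreeZeroModule 𝒜) :
    h.coord a (rightMul 𝒜 y s) = h.coord a s * c a y := by
  obtain ⟨z, rfl⟩ := Submodule.Quotient.mk_surjective _ s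
  exact h.coeff_mul a z y

/-- The sum of the coordinates. -/
def trace : DegreeZeroModule 𝒜 →ₗ[k] k := ∑ a, h.coord a

theorem trace_e_smul (a : V) (s : DegreeZeroModule 𝒜) : h.trace (e a • s) = h.coord a s := by
  rw [trace, LinearMap.sum_apply, Finset.sum_eq_single a]
  · rw [h.coord_smul, h.coeff_self, one_mul]
  · intro b _ hb
    rw [h.coord_smul, h.coeff_ne b a hb, zero_mul]
  · simp

theorem trace_eq_coord {a : V} {s : DegreeZeroModule 𝒜} (hs : rightMul 𝒜 (e a) s = s) :
    h.trace s = h.coord a s := by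
  rw [trace, LinearMap.sum_apply, Finset.sum_eq_single a]
  · intro b _ hb
    rw [← hs, h.coord_rightMul, h.coeff_ne b a hb, mul_zero]
  · simp

/-- A linear form on `A₍₁₎` induces a homomorphism from the augmentation ideal to the semisimple
quotient. -/
def dual (ψ : A →ₗ[k] k) : AugmentationIdeal 𝒜 →ₗ[A] DegreeZeroModule 𝒜 where
  toFun j := ∑ a, ψ (e a * GradedAlgebra.proj 𝒜 1 (j : A)) • classZero 𝒜 (e a)
  map_add' i j := by
    simp only [Submodule.coe_add, map_add, mul_add, add_smul, Finset.sum_add_distrib]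
  map_smul' y j := by
    rw [RingHom.id_apply, Finset.smul_sum]
    refine Finset.sum_congr rfl fun a _ => ?_
    rw [Submodule.coe_smul, smul_eq_mul, gradedProj_one_mul_of_mem_irrelevant y j.2, ← mul_assoc,
      h.e_mul a (gradedProj_mem 𝒜 0 y), h.coeff_proj, smul_mul_assoc, map_smul, smul_comm y,
      h.smul_classZero_e, smul_smul, smul_eq_mul, mul_comm]

theorem coord_dual (ψ : A →ₗ[k] k) (a : V) (j : AugmentationIdeal 𝒜) :
    h.coord a (h.dual ψ j) = ψ (e a * GradedAlgebra.proj 𝒜 1 (j : A)) := by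
  change h.coord a (∑ b, ψ (e b * GradedAlgebra.proj 𝒜 1 (j : A)) • classZero 𝒜 (e b)) = _
  rw [map_sum, Finset.sum_eq_single a]
  · rw [map_smul, h.coord_classZero, h.coeff_self, smul_eq_mul, mul_one]
  · intro b _ hb
    rw [map_smul, h.coord_classZero, h.coeff_ne a b hb.symm, smul_zero]
  · simp

theorem trace_dual (ψ : A →ₗ[k] k) (j : AugmentationIdeal 𝒜) :
    h.trace (h.dual ψ j) = ψ (GradedAlgebra.proj 𝒜 1 (j : A)) := by
  rw [trace, LinearMap.sum_apply]
  simp only [h.coord_dual]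
  rw [← map_sum, ← Finset.sum_mul, h.sum_e, one_mul]

end IsVertexFrame

end Frame

/-! ### Paths that start or end with a given arrow -/

namespace PathAlgebra

variable {k : Type u} [Field k] {V : Type} [Fintype V] [Quiver.{0} V]
  [∀ a b : V, Finite (a ⟶ b)]

theorem exists_eq_sum_mul_path (n : ℕ) (w : PathAlgebra k V) :
    ∃ w' : QuiverArrow V → PathAlgebra k V,
      restrict (fun p => p.length = n + 1) w = ∑ α, w' α * ofPath k α.path ∧
      ∀ α, restrict (fun p => p.length = n) (w' α) = w' α ∧
        w' α * ofPath k (vertex α.src) = w' α := by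
  classical
  induction w using PathAlgebra.induction with
  | zero => exact ⟨0, by simp, by simp⟩
  | add x y hx hy =>
    obtain ⟨x', hx, hx'⟩ := hx
    obtain ⟨y', hy, hy'⟩ := hy
    refine ⟨x' + y', ?_, fun α => ?_⟩
    · simp only [map_add, hx, hy, Pi.add_apply, add_mul, Finset.sum_add_distrib]
    · rw [Pi.add_apply, map_add, (hx' α).1, (hy' α).1, add_mul, (hx' α).2, (hy' α).2]
      exact ⟨rfl, rfl⟩
  | smul c p =>
    by_cases hp : p.length = n + 1
    · obtain ⟨a, b, d, q, α, rfl, hq⟩ := exists_cons_of_length hp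
      refine ⟨Pi.single ⟨b, d, α⟩ (c • ofPath k ⟨a, b, q⟩), ?_, fun β => ?_⟩
      · rw [Finset.sum_eq_single ⟨b, d, α⟩, Pi.single_eq_same, map_smul, restrict_ofPath,
          if_pos hp, smul_mul_assoc, comp_mul]
        · intro β _ hβ
          rw [Pi.single_eq_of_ne hβ, zero_mul]
        · simp
      · by_cases hβ : β = ⟨b, d, α⟩
        · subst hβ
          rw [Pi.single_eq_same, map_smul, restrict_ofPath, if_pos hq, smul_mul_assoc, comp_mul,
            Quiver.Path.comp_nil]
          exact ⟨rfl, rfl⟩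
        · rw [Pi.single_eq_of_ne hβ, map_zero, zero_mul]
          exact ⟨rfl, rfl⟩
    · refine ⟨0, ?_, by simp⟩
      rw [map_smul, restrict_ofPath, if_neg hp]
      simp

theorem exists_eq_sum_path_mul (n : ℕ) (w : PathAlgebra k V) :
    ∃ w' : QuiverArrow V → PathAlgebra k V,
      restrict (fun p => p.length = n + 1) w = ∑ α, ofPath k α.path * w' α ∧
      ∀ α, restrict (fun p => p.length = n) (w' α) = w' α ∧
        ofPath k (vertex α.tgt) * w' α = w' α := by
  classical
  induction w using PathAlgebra.induction with
  | zero => exact ⟨0, by simp, by simp⟩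
  | add x y hx hy =>
    obtain ⟨x', hx, hx'⟩ := hx
    obtain ⟨y', hy, hy'⟩ := hy
    refine ⟨x' + y', ?_, fun α => ?_⟩
    · simp only [map_add, hx, hy, Pi.add_apply, mul_add, Finset.sum_add_distrib]
    · rw [Pi.add_apply, map_add, (hx' α).1, (hy' α).1, mul_add, (hx' α).2, (hy' α).2]
      exact ⟨rfl, rfl⟩
  | smul c p =>
    by_cases hp : p.length = n + 1
    · obtain ⟨a, b, d, α, q, rfl, hq⟩ := exists_comp_of_length hp
      refine ⟨Pi.single ⟨a, b, α⟩ (c • ofPath k ⟨b, d, q⟩), ?_, fun β => ?_⟩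
      · rw [Finset.sum_eq_single ⟨a, b, α⟩, Pi.single_eq_same, map_smul, restrict_ofPath,
          if_pos hp, mul_smul_comm, comp_mul]
        · intro β _ hβ
          rw [Pi.single_eq_of_ne hβ, mul_zero]
        · simp
      · by_cases hβ : β = ⟨a, b, α⟩
        · subst hβ
          rw [Pi.single_eq_same, map_smul, restrict_ofPath, if_pos hq, mul_smul_comm, comp_mul,
            Quiver.Path.nil_comp]
          exact ⟨rfl, rfl⟩
        · rw [Pi.single_eq_of_ne hβ, map_zero, mul_zero]
          exact ⟨rfl, rfl⟩
    · refine ⟨0, ?_, by simp⟩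
      rw [map_smul, restrict_ofPath, if_neg hp]
      simp

end PathAlgebra

/-! ### Arrows as generators of the augmentation ideal, and their dual homomorphisms. -/

namespace IsGradedPresentation

variable {k : Type u} [Field k] {A : Type v} [Ring A] [Algebra k A]
  {𝒜 : ℕ → Submodule k A} [GradedAlgebra 𝒜]
  {V : Type} [Fintype V] [Quiver.{0} V] {ρ : PathAlgebra k V →ₐ[k] A}
  (hρ : IsGradedPresentation 𝒜 ρ)
include hρ

omit [GradedAlgebra 𝒜] in
theorem e_mem (a : V) : e ρ a ∈ 𝒜 0 := hρ.mem (vertex a)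

omit [GradedAlgebra 𝒜] in
theorem x_mem (α : QuiverArrow V) : x ρ α ∈ 𝒜 1 := hρ.mem α.path

theorem x_mem_irrelevant (α : QuiverArrow V) :
    x ρ α ∈ (HomogeneousIdeal.irrelevant 𝒜).toIdeal := mem_irrelevant_of_mem (hρ.x_mem α)

theorem apply_mem {n : ℕ} {w : PathAlgebra k V} (hw : restrict (fun p => p.length = n) w = w) :
    ρ w ∈ 𝒜 n := by
  rw [← hw, ← hρ.proj_apply]
  exact gradedProj_mem 𝒜 n _

variable [∀ a b : V, Finite (a ⟶ b)]

theorem exists_eq_sum_mul_x {n : ℕ} {y : A} (hy : y ∈ 𝒜 (n + 1)) :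
    ∃ y' : QuiverArrow V → A, y = ∑ α, y' α * x ρ α ∧ ∀ α, y' α ∈ 𝒜 n := by
  obtain ⟨w, rfl⟩ := hρ.exists_of_mem hy
  obtain ⟨w', hw, hw'⟩ := exists_eq_sum_mul_path n w
  refine ⟨fun α => ρ (w' α), ?_, fun α => hρ.apply_mem (hw' α).1⟩
  rw [hw, map_sum]
  simp only [map_mul]

theorem exists_eq_sum_mul_x_of_mem_irrelevant {y : A}
    (hy : y ∈ (HomogeneousIdeal.irrelevant 𝒜).toIdeal) :
    ∃ y' : QuiverArrow V → A, y = ∑ α, y' α * x ρ α := by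
  obtain ⟨N, hN⟩ := eq_sum_gradedProj 𝒜 y
  have key : ∀ n, ∃ y' : QuiverArrow V → A, GradedAlgebra.proj 𝒜 n y = ∑ α, y' α * x ρ α := by
    intro n
    cases n with
    | zero => exact ⟨0, by rw [mem_irrelevant_toIdeal_iff.1 hy]; simp⟩
    | succ n =>
      obtain ⟨y', h, -⟩ := hρ.exists_eq_sum_mul_x (gradedProj_mem 𝒜 (n + 1) y)
      exact ⟨y', h⟩
  choose y' hy' using key
  refine ⟨fun α => ∑ n ∈ Finset.range N, y' n α, ?_⟩
  conv_lhs => rw [hN]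
  simp only [hy', Finset.sum_mul]
  exact Finset.sum_comm

/-- The arrows generate the augmentation ideal as a left ideal. -/
theorem augmentationHom_ext {f g : AugmentationIdeal 𝒜 →ₗ[A] DegreeZeroModule 𝒜}
    (hfg : ∀ α, f ⟨x ρ α, hρ.x_mem_irrelevant α⟩ = g ⟨x ρ α, hρ.x_mem_irrelevant α⟩) : f = g := by
  apply LinearMap.ext
  rintro ⟨y, hy⟩
  obtain ⟨y', h⟩ := hρ.exists_eq_sum_mul_x_of_mem_irrelevant hy
  have : (⟨y, hy⟩ : AugmentationIdeal 𝒜) =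
      ∑ α, y' α • (⟨x ρ α, hρ.x_mem_irrelevant α⟩ : AugmentationIdeal 𝒜) := by
    apply Subtype.ext
    refine h.trans ?_
    exact (map_sum (Submodule.subtype (HomogeneousIdeal.irrelevant 𝒜).toIdeal)
      (fun α => y' α • (⟨x ρ α, hρ.x_mem_irrelevant α⟩ : AugmentationIdeal 𝒜)) _).symm
  rw [this, map_sum, map_sum]
  simp only [map_smul, hfg]

omit [∀ a b : V, Finite (a ⟶ b)]

theorem arrowCoeff_gradedProj_one [∀ a b : V, Finite (a ⟶ b)] (α : QuiverArrow V) (y : A) :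
    hρ.arrowCoeff α (GradedAlgebra.proj 𝒜 1 y) = hρ.arrowCoeff α y := by
  classical
  rw [hρ.gradedProj_one, map_sum]
  simp [arrowCoeff_x]

/-- The homomorphism from the augmentation ideal to the semisimple quotient dual to an arrow. -/
def arrowDual (α : QuiverArrow V) : AugmentationIdeal 𝒜 →ₗ[A] DegreeZeroModule 𝒜 :=
  hρ.isVertexFrame.dual (hρ.arrowCoeff α)

theorem trace_arrowDual [∀ a b : V, Finite (a ⟶ b)] (α : QuiverArrow V)
    (j : AugmentationIdeal 𝒜) :
    hρ.isVertexFrame.trace (hρ.arrowDual α j) = hρ.arrowCoeff α (j : A) := by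
  rw [arrowDual, IsVertexFrame.trace_dual, hρ.arrowCoeff_gradedProj_one]

open Classical in
theorem coord_arrowDual [∀ a b : V, Finite (a ⟶ b)] (α : QuiverArrow V) (a : V)
    (j : AugmentationIdeal 𝒜) :
    hρ.isVertexFrame.coord a (hρ.arrowDual α j) =
      if a = α.src then hρ.arrowCoeff α (j : A) else 0 := by
  rw [arrowDual, IsVertexFrame.coord_dual, hρ.arrowCoeff_mul, hρ.arrowCoeff_e, zero_mul, add_zero,
    hρ.arrowCoeff_gradedProj_one, hρ.vertexCoeff_e]
  split_ifs <;> simp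

end IsGradedPresentation

/-! ### Degrees in a linear resolution -/

section LinearAlgebra

theorem LinearMap.exists_factor_of_surjective {R M N M' : Type*} [Ring R] [AddCommGroup M]
    [AddCommGroup N] [AddCommGroup M'] [Module R M] [Module R N] [Module R M'] (p : M →ₗ[R] N)
    (hp : Function.Surjective p) (g : M →ₗ[R] M') (h : ∀ z, p z = 0 → g z = 0) :
    ∃ f : N →ₗ[R] M', ∀ z, f (p z) = g z := by
  refine ⟨(LinearMap.ker p).liftQ g h ∘ₗ (p.quotKerEquivOfSurjective hp).symm.toLinearMap,
    fun z => ?_⟩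
  have : (p.quotKerEquivOfSurjective hp).symm (p z) = Submodule.Quotient.mk z := by
    rw [LinearEquiv.symm_apply_eq]
    rfl
  rw [LinearMap.comp_apply, LinearEquiv.coe_coe, this]
  rfl

/-- The values of `f` on the image of `W` under `p` are forced and consistent; they are then
extended to all of `N`. -/
theorem LinearMap.exists_factor {K M N M' : Type*} [Field K] [AddCommGroup M] [AddCommGroup N]
    [AddCommGroup M'] [Module K M] [Module K N] [Module K M'] (p : M →ₗ[K] N) (g : M →ₗ[K] M')
    (W : Submodule K M) (h : ∀ z ∈ W, p z = 0 → g z = 0) :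
    ∃ f : N →ₗ[K] M', ∀ z ∈ W, f (p z) = g z := by
  obtain ⟨f, hf⟩ := LinearMap.exists_factor_of_surjective (p ∘ₗ W.subtype).rangeRestrict
    (p ∘ₗ W.subtype).surjective_rangeRestrict (g ∘ₗ W.subtype)
    (fun z hz => h z z.2 (congrArg Subtype.val hz))
  obtain ⟨f', hf'⟩ := LinearMap.exists_extend f
  refine ⟨f', fun z hz => ?_⟩
  have := hf ⟨z, hz⟩
  rw [← hf'] at this
  exact this

end LinearAlgebra

namespace LinearResolution

variable {k : Type u} [Field k] {A : Type v} [Ring A] [Algebra k A]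
  {𝒜 : ℕ → Submodule k A} [GradedAlgebra 𝒜] (L : LinearResolution 𝒜)

instance instModuleField (n : ℕ) : Module k (L.P n) := Module.compHom _ (algebraMap k A)

instance (n : ℕ) : IsScalarTower k A (L.P n) :=
  ⟨fun c a z => by
    rw [Algebra.smul_def, mul_smul]
    rfl⟩

instance (n : ℕ) : DirectSum.Decomposition (L.grading n) := (L.isInternal n).chooseDecomposition

theorem field_smul_def (n : ℕ) (c : k) (z : L.P n) : c • z = algebraMap k A c • z := rfl

theorem algebraMap_mem (c : k) : algebraMap k A c ∈ 𝒜 0 := SetLike.algebraMap_mem_graded 𝒜 c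

theorem smul_mem_of_mem_zero {n m : ℕ} {a : A} (ha : a ∈ 𝒜 0) {z : L.P n}
    (hz : z ∈ L.grading n m) : a • z ∈ L.grading n m := by
  simpa using L.smul_mem n 0 m a z ha hz

/-- The homogeneous components of a term of the resolution, as subspaces. -/
def piece (n m : ℕ) : Submodule k (L.P n) where
  __ := (L.grading n m).toAddSubmonoid
  smul_mem' c _ hz := L.smul_mem_of_mem_zero (algebraMap_mem c) hz

theorem smul_mem_piece {n m l : ℕ} {a : A} (ha : a ∈ 𝒜 l) {z : L.P n} (hz : z ∈ L.piece n m) :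
    a • z ∈ L.piece n (l + m) := L.smul_mem n l m a z ha hz

theorem smul_mem_piece_zero {n m : ℕ} {a : A} (ha : a ∈ 𝒜 0) {z : L.P n}
    (hz : z ∈ L.piece n m) : a • z ∈ L.piece n m := L.smul_mem_of_mem_zero ha hz

theorem d_mem_piece {n m : ℕ} {z : L.P (n + 1)} (hz : z ∈ L.piece (n + 1) m) :
    L.d n z ∈ L.piece n m := L.d_mem n m z hz

/-- The homogeneous components of an element. -/
def comp (n m : ℕ) : L.P n →+ L.P n where
  toFun z := (DirectSum.decompose (L.grading n) z m : L.P n)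
  map_zero' := by rw [DirectSum.decompose_zero]; rfl
  map_add' x y := by rw [DirectSum.decompose_add]; rfl

theorem comp_mem (n m : ℕ) (z : L.P n) : L.comp n m z ∈ L.piece n m :=
  (DirectSum.decompose (L.grading n) z m).2

theorem comp_of_mem {n m : ℕ} {z : L.P n} (hz : z ∈ L.piece n m) : L.comp n m z = z :=
  DirectSum.decompose_of_mem_same _ hz

theorem comp_of_mem_ne {n m l : ℕ} {z : L.P n} (hz : z ∈ L.piece n m) (h : m ≠ l) :
    L.comp n l z = 0 :=
  DirectSum.decompose_of_mem_ne _ hz h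

theorem exists_eq_sum_comp {n : ℕ} (z : L.P n) :
    ∃ s : Finset ℕ, z = ∑ m ∈ s, L.comp n m z := by
  classical
  exact ⟨_, (DirectSum.sum_support_decompose (L.grading n) z).symm⟩

theorem comp_d (n m : ℕ) (z : L.P (n + 1)) : L.comp n m (L.d n z) = L.d n (L.comp (n + 1) m z) := by
  obtain ⟨s, hs⟩ := L.exists_eq_sum_comp z
  have h : ∀ l, L.comp n m (L.d n (L.comp (n + 1) l z)) =
      if l = m then L.d n (L.comp (n + 1) m z) else 0 := by
    intro l
    split_ifs with hl
    · subst hl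
      exact L.comp_of_mem (L.d_mem_piece (L.comp_mem _ _ z))
    · exact L.comp_of_mem_ne (L.d_mem_piece (L.comp_mem _ _ z)) hl
  have h0 : m ∉ s → L.comp (n + 1) m z = 0 := by
    intro hm
    rw [hs, map_sum]
    exact Finset.sum_eq_zero fun l hl =>
      L.comp_of_mem_ne (L.comp_mem _ _ z) (by rintro rfl; exact hm hl)
  conv_lhs => rw [hs, map_sum, map_sum]
  simp only [h]
  rw [Finset.sum_ite_eq' s m fun _ => L.d n (L.comp (n + 1) m z)]
  split_ifs with hm
  · rfl
  · rw [h0 hm, map_zero]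

/-- The component of `a • z` for an element `z` of degree `m`. -/
theorem comp_smul {n m : ℕ} (l : ℕ) (a : A) {z : L.P n} (hz : z ∈ L.piece n m) :
    L.comp n (l + m) (a • z) = GradedAlgebra.proj 𝒜 l a • z := by
  obtain ⟨N, hN⟩ := eq_sum_gradedProj 𝒜 a
  have h : ∀ i, L.comp n (l + m) (GradedAlgebra.proj 𝒜 i a • z) =
      if i = l then GradedAlgebra.proj 𝒜 l a • z else 0 := by
    intro i
    have hi : GradedAlgebra.proj 𝒜 i a • z ∈ L.piece n (i + m) :=
      L.smul_mem_piece (gradedProj_mem 𝒜 i a) hz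
    split_ifs with hl
    · subst hl
      exact L.comp_of_mem hi
    · exact L.comp_of_mem_ne hi (by omega)
  have h0 : l ∉ Finset.range N → GradedAlgebra.proj 𝒜 l a = 0 := by
    intro hl
    rw [hN, map_sum]
    exact Finset.sum_eq_zero fun i hi =>
      gradedProj_of_mem_ne 𝒜 (gradedProj_mem 𝒜 i a) (by rintro rfl; exact hl hi)
  conv_lhs => rw [hN, Finset.sum_smul, map_sum]
  simp only [h]
  rw [Finset.sum_ite_eq']
  split_ifs with hl
  · rfl
  · rw [h0 hl, zero_smul]

/-- Every element is a combination of elements of lowest degree. -/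
theorem exists_eq_sum_smul {n : ℕ} (z : L.P n) :
    ∃ (N : ℕ) (a : Fin N → A) (m : Fin N → L.P n), z = ∑ i, a i • m i ∧
      ∀ i, m i ∈ L.piece n n := by
  have hz : z ∈ Submodule.span A (L.grading n n : Set (L.P n)) := by
    rw [L.generated n]
    trivial
  rw [Submodule.mem_span_set'] at hz
  obtain ⟨N, a, m, h⟩ := hz
  exact ⟨N, a, fun i => m i, h.symm, fun i => (m i).2⟩

/-- `P n` is generated in degree `n`, so it has nothing below that degree, and only the degree-zero
part of `a` can contribute to degree `n`. -/
theorem comp_lowest_smul {n : ℕ} (a : A) (z : L.P n) :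
    L.comp n n (a • z) = GradedAlgebra.proj 𝒜 0 a • L.comp n n z := by
  obtain ⟨N, b, m, rfl, hm⟩ := L.exists_eq_sum_smul z
  rw [Finset.smul_sum, map_sum, map_sum, Finset.smul_sum]
  refine Finset.sum_congr rfl fun i _ => ?_
  have h1 := L.comp_smul 0 (a * b i) (hm i)
  have h2 := L.comp_smul 0 (b i) (hm i)
  rw [zero_add] at h1 h2
  rw [smul_smul, h1, h2, gradedProj_zero_mul, mul_smul]

/-- The lowest component, as a linear map. -/
def lowest (n : ℕ) : L.P n →ₗ[k] L.P n where
  __ := L.comp n n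
  map_smul' c z := by
    refine (L.comp_lowest_smul (algebraMap k A c) z).trans ?_
    rw [gradedProj_of_mem 𝒜 (algebraMap_mem c)]
    rfl

theorem lowest_of_mem {n : ℕ} {z : L.P n} (hz : z ∈ L.piece n n) : L.lowest n z = z :=
  L.comp_of_mem hz

theorem lowest_smul {n : ℕ} (a : A) (z : L.P n) :
    L.lowest n (a • z) = GradedAlgebra.proj 𝒜 0 a • L.lowest n z := L.comp_lowest_smul a z

theorem lowest_of_mem_smul_top {n : ℕ} {z : L.P n}
    (hz : z ∈ (HomogeneousIdeal.irrelevant 𝒜).toIdeal • (⊤ : Submodule A (L.P n))) :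
    L.lowest n z = 0 := by
  refine Submodule.smul_induction_on (p := fun x => L.lowest n x = 0) hz ?_ ?_
  · intro a ha m _
    rw [lowest_smul, mem_irrelevant_toIdeal_iff.1 ha, zero_smul]
  · intro x y hx hy
    rw [map_add, hx, hy, add_zero]

/-- By minimality the kernel of the projection lies in `A₊ P n`, which has no part in the lowest
degree. -/
theorem lowest_of_proj_eq_zero {n : ℕ} {z : L.P n} (hz : L.proj n z = 0) : L.lowest n z = 0 := by
  obtain ⟨y, rfl⟩ := (L.exact_incl_proj n z).1 hz
  exact L.lowest_of_mem_smul_top (L.incl_mem n y)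

/-- `A₊` kills the target, so in a combination of lowest-degree elements only the degree-zero parts
of the coefficients matter. -/
theorem proj_lowest {n : ℕ} (f : L.Z n →ₗ[A] DegreeZeroModule 𝒜) (z : L.P n) :
    f (L.proj n (L.lowest n z)) = f (L.proj n z) := by
  obtain ⟨N, a, m, rfl, hm⟩ := L.exists_eq_sum_smul z
  simp only [map_sum]
  refine Finset.sum_congr rfl fun i _ => ?_
  rw [lowest_smul, L.lowest_of_mem (hm i), map_smul, map_smul, map_smul, map_smul, ← sub_eq_zero,
    ← sub_smul]
  apply smul_quotient_eq_zero
  rw [mem_irrelevant_toIdeal_iff, map_sub, gradedProj_of_mem 𝒜 (gradedProj_mem 𝒜 0 _), sub_self]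

/-- The kernel of `d n` is the kernel of the projection to `Z (n + 1)`, which does not meet the
lowest degree. This is the injectivity from which everything is dualized. -/
theorem eq_zero_of_d_eq_zero {n : ℕ} {z : L.P (n + 1)} (hz : z ∈ L.piece (n + 1) (n + 1))
    (h : L.d n z = 0) : z = 0 := by
  rw [← L.lowest_of_mem hz]
  apply L.lowest_of_proj_eq_zero
  apply L.incl_injective n
  rw [L.incl_proj, h, map_zero]

/-- Exactness holds degree by degree: replace a preimage by its component of degree `m`. -/
theorem exists_d_eq {n m : ℕ} {z : L.P (n + 1)} (hz : z ∈ L.piece (n + 1) m)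
    (h : L.d n z = 0) : ∃ y ∈ L.piece (n + 2) m, L.d (n + 1) y = z := by
  obtain ⟨y, rfl⟩ := (L.exact_succ n z).1 h
  refine ⟨L.comp (n + 2) m y, L.comp_mem _ _ y, ?_⟩
  rw [← L.comp_d, L.comp_of_mem hz]

theorem exists_d_eq_of_ε {m : ℕ} {z : L.P 0} (hz : z ∈ L.piece 0 m) (h : L.ε z = 0) :
    ∃ y ∈ L.piece 1 m, L.d 0 y = z := by
  obtain ⟨y, rfl⟩ := (L.exact_zero z).1 h
  refine ⟨L.comp 1 m y, L.comp_mem _ _ y, ?_⟩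
  rw [← L.comp_d, L.comp_of_mem hz]

/-- A homomorphism to the semisimple quotient lifts to `A`. -/
theorem exists_lift {n : ℕ} (f : L.Z n →ₗ[A] DegreeZeroModule 𝒜) :
    ∃ (F : L.P n →ₗ[A] A) (F' : L.Z (n + 1) →ₗ[A] AugmentationIdeal 𝒜),
      (∀ z, classZero 𝒜 (F z) = f (L.proj n z)) ∧ ∀ z, (F' z : A) = F (L.incl n z) := by
  have := L.projective n
  obtain ⟨F, hF⟩ := Module.projective_lifting_property
    (Submodule.mkQ (HomogeneousIdeal.irrelevant 𝒜).toIdeal) (f ∘ₗ L.proj n)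
    (Submodule.mkQ_surjective _)
  have hF' : ∀ z, classZero 𝒜 (F z) = f (L.proj n z) := LinearMap.congr_fun hF
  refine ⟨F, LinearMap.codRestrict _ (F ∘ₗ L.incl n) fun z => ?_, hF', fun z => rfl⟩
  rw [← Submodule.Quotient.mk_eq_zero]
  refine (hF' _).trans ?_
  rw [(L.exact_incl_proj n _).2 ⟨z, rfl⟩, map_zero]

section Presented

variable {V : Type} [Fintype V] [Quiver.{0} V] {ρ : PathAlgebra k V →ₐ[k] A}
  (hρ : IsGradedPresentation 𝒜 ρ)
include hρ

open IsGradedPresentation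

/-- In a combination of lowest-degree elements, only the degree-one parts of the coefficients
contribute to degree `n + 1`, and these are combinations of arrows. -/
theorem exists_eq_sum_x_smul [∀ a b : V, Finite (a ⟶ b)] {n : ℕ} {z : L.P n}
    (hz : z ∈ L.piece n (n + 1)) :
    ∃ m : QuiverArrow V → L.P n, z = ∑ α, x ρ α • m α ∧ ∀ α, m α ∈ L.piece n n := by
  obtain ⟨N, a, m, h, hm⟩ := L.exists_eq_sum_smul z
  refine ⟨fun α => ∑ i, hρ.arrowCoeff α (a i) • m i, ?_, fun α =>
    Submodule.sum_mem _ fun i _ => Submodule.smul_mem _ _ (hm i)⟩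
  rw [← L.comp_of_mem hz]
  conv_lhs => rw [h]
  rw [map_sum]
  simp only [Finset.smul_sum]
  rw [Finset.sum_comm]
  refine Finset.sum_congr rfl fun i _ => ?_
  rw [add_comm, L.comp_smul 1 (a i) (hm i), hρ.gradedProj_one, Finset.sum_smul]
  refine Finset.sum_congr rfl fun α _ => ?_
  rw [smul_comm (x ρ α), smul_assoc]

/-- A linear form on the lowest component induces a homomorphism to the semisimple quotient. -/
theorem exists_hom (n : ℕ) (l : L.P n →ₗ[k] k) : ∃ f : L.Z n →ₗ[A] DegreeZeroModule 𝒜,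
    ∀ m ∈ L.piece n n, ∀ a, hρ.isVertexFrame.coord a (f (L.proj n m)) = l (e ρ a • m) := by
  have hf := hρ.isVertexFrame
  let g : L.P n →ₗ[A] DegreeZeroModule 𝒜 :=
    { toFun z := ∑ a, l (e ρ a • L.lowest n z) • classZero 𝒜 (e ρ a)
      map_add' y z := by
        simp only [map_add, smul_add, add_smul, Finset.sum_add_distrib]
      map_smul' b z := by
        rw [RingHom.id_apply, Finset.smul_sum]
        refine Finset.sum_congr rfl fun a _ => ?_
        rw [lowest_smul, smul_smul, hf.e_mul a (gradedProj_mem 𝒜 0 b), hf.coeff_proj, smul_assoc,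
          map_smul, smul_comm b, hf.smul_classZero_e, smul_smul, smul_eq_mul, mul_comm] }
  -- `g` depends only on the lowest component, which vanishes on the kernel of the projection.
  obtain ⟨f, hfg⟩ := LinearMap.exists_factor_of_surjective (L.proj n) (L.proj_surjective n) g
    (fun z hz => by
      change ∑ a, l (e ρ a • L.lowest n z) • classZero 𝒜 (e ρ a) = 0
      rw [L.lowest_of_proj_eq_zero hz]
      simp)
  refine ⟨f, fun m hm a => ?_⟩
  rw [hfg]
  change hf.coord a (∑ b, l (e ρ b • L.lowest n m) • classZero 𝒜 (e ρ b)) = _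
  rw [L.lowest_of_mem hm, map_sum, Finset.sum_eq_single a]
  · rw [map_smul, hf.coord_classZero, hf.coeff_self, smul_eq_mul, mul_one]
  · intro b _ hb
    rw [map_smul, hf.coord_classZero, hf.coeff_ne a b hb.symm, smul_zero]
  · simp

theorem coord_eq_trace {n : ℕ} (f : L.Z n →ₗ[A] DegreeZeroModule 𝒜) (a : V) (m : L.P n) :
    hρ.isVertexFrame.coord a (f (L.proj n m)) =
      hρ.isVertexFrame.trace (f (L.proj n (e ρ a • m))) := by
  rw [map_smul, map_smul, IsVertexFrame.trace_e_smul]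

/-- The coordinate at `a` is the trace after acting by the idempotent of `a`. With `exists_hom`,
this identifies Extⁿ with the dual of the lowest part of `P n`, so identities in the Yoneda algebra
can be tested by pairing. -/
theorem hom_ext {n : ℕ} {f g : L.Z n →ₗ[A] DegreeZeroModule 𝒜}
    (h : ∀ m ∈ L.piece n n, hρ.isVertexFrame.trace (f (L.proj n m)) =
      hρ.isVertexFrame.trace (g (L.proj n m))) : f = g := by
  apply LinearMap.ext
  intro z
  obtain ⟨z, rfl⟩ := L.proj_surjective n z
  rw [← L.proj_lowest f, ← L.proj_lowest g]
  refine hρ.isVertexFrame.ext_coord fun a => ?_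
  rw [L.coord_eq_trace hρ, L.coord_eq_trace hρ]
  exact h _ (L.smul_mem_piece_zero (hρ.e_mem a) (L.comp_mem _ _ z))

variable [∀ a b : V, Finite (a ⟶ b)]

/-- Pairing the product of an arrow of the Yoneda algebra with the resolution. -/
theorem arrowCoeff_lift {n : ℕ} {f : L.Z n →ₗ[A] DegreeZeroModule 𝒜} {F : L.P n →ₗ[A] A}
    (hF : ∀ z, classZero 𝒜 (F z) = f (L.proj n z)) (α : QuiverArrow V)
    (m : QuiverArrow V → L.P n) :
    hρ.arrowCoeff α (F (∑ β, x ρ β • m β)) =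
      hρ.isVertexFrame.coord α.tgt (f (L.proj n (m α))) := by
  classical
  rw [map_sum, map_sum, Finset.sum_eq_single α]
  · rw [map_smul, smul_eq_mul, hρ.arrowCoeff_mul, hρ.vertexCoeff_x, hρ.arrowCoeff_x, if_pos rfl,
      zero_mul, zero_add, one_mul, ← hF, IsVertexFrame.coord_classZero]
  · intro β _ hβ
    rw [map_smul, smul_eq_mul, hρ.arrowCoeff_mul, hρ.vertexCoeff_x, hρ.arrowCoeff_x, if_neg hβ,
      zero_mul, zero_mul, zero_add]
  · simp

/-- The product with the dual of an arrow. -/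
theorem exists_arrowDual_mul {n : ℕ} (f : L.Z n →ₗ[A] DegreeZeroModule 𝒜) (α : QuiverArrow V) :
    ∃ g : L.Z (n + 1) →ₗ[A] DegreeZeroModule 𝒜,
      augToYoneda 𝒜 (hρ.arrowDual α) * L.toYoneda n f = L.toYoneda (n + 1) g ∧
      ∀ (y : L.P (n + 1)) (m : QuiverArrow V → L.P n), L.d n y = ∑ β, x ρ β • m β →
        hρ.isVertexFrame.trace (g (L.proj (n + 1) y)) =
          hρ.isVertexFrame.coord α.tgt (f (L.proj n (m α))) := by
  obtain ⟨F, F', hF, hF'⟩ := L.exists_lift f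
  refine ⟨hρ.arrowDual α ∘ₗ F', L.augToYoneda_mul_toYoneda n _ f F F' hF hF', fun y m hy => ?_⟩
  rw [LinearMap.comp_apply, hρ.trace_arrowDual, hF', L.incl_proj, hy, L.arrowCoeff_lift hρ hF]

/-- The Yoneda algebra is generated in degrees zero and one. -/
theorem exists_eq_sum_arrowDual_mul {n : ℕ} (g : L.Z (n + 1) →ₗ[A] DegreeZeroModule 𝒜) :
    ∃ f : QuiverArrow V → L.Z n →ₗ[A] DegreeZeroModule 𝒜,
      L.toYoneda (n + 1) g = ∑ α, augToYoneda 𝒜 (hρ.arrowDual α) * L.toYoneda n (f α) := by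
  have hfr := hρ.isVertexFrame
  let dk : L.P (n + 1) →ₗ[k] L.P n := (L.d n).restrictScalars k
  let gk : L.P (n + 1) →ₗ[k] k :=
    { toFun z := hfr.trace (g (L.proj (n + 1) z))
      map_add' y z := by simp only [map_add]
      map_smul' c z := by
        rw [L.field_smul_def, map_smul, map_smul, algebraMap_smul, map_smul, RingHom.id_apply] }
  -- As `d` is injective on the lowest part, the linear form of `g` factors as `ψ ∘ d`. The forms `m
  -- ↦ ψ (x_α m)` then define the factors `f α`.
  obtain ⟨ψ, hψ⟩ := LinearMap.exists_factor dk gk (L.piece (n + 1) (n + 1))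
    (fun z hz h => by rw [L.eq_zero_of_d_eq_zero hz h, map_zero])
  have hlin : ∀ α : QuiverArrow V, ∃ l : L.P n →ₗ[k] k, ∀ m, l m = ψ (x ρ α • m) := fun α =>
    ⟨ψ ∘ₗ Algebra.lsmul k k (L.P n) (x ρ α), fun m => rfl⟩
  choose l hl using hlin
  choose f hf using fun α => L.exists_hom hρ n (l α)
  choose g' hg' hg'' using fun α => L.exists_arrowDual_mul hρ (f α) α
  refine ⟨f, ?_⟩
  simp only [hg']
  rw [← map_sum]
  congr 1
  refine L.hom_ext hρ fun y hy => ?_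
  obtain ⟨m, hm, hm'⟩ := L.exists_eq_sum_x_smul hρ (L.d_mem_piece hy)
  rw [LinearMap.sum_apply, map_sum]
  simp only [hg'' _ y m hm, hf _ _ (hm' _), hl, smul_smul, x_mul_e]
  rw [← map_sum, ← hm]
  exact (hψ y hy).symm

end Presented

end LinearResolution

/-! ### Relations of the Yoneda algebra -/

namespace LinearResolution

open IsGradedPresentation

variable {k : Type u} [Field k] {A : Type v} [Ring A] [Algebra k A]
  {𝒜 : ℕ → Submodule k A} [GradedAlgebra 𝒜] (L : LinearResolution 𝒜)
  {V : Type} [Fintype V] [Quiver.{0} V] [∀ a b : V, Finite (a ⟶ b)]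
  {ρ : PathAlgebra k V →ₐ[k] A} (hρ : IsGradedPresentation 𝒜 ρ)
include hρ

/-- The relations of the Yoneda algebra are generated by the quadratic ones. -/
theorem exists_of_sum_arrowDual_mul_eq_zero {n : ℕ} {ι : Type*} [Fintype ι]
    (u : Module.Basis ι k A) (f : QuiverArrow V → L.Z (n + 1) →ₗ[A] DegreeZeroModule 𝒜)
    (hf : ∀ α, rightMul 𝒜 (e ρ α.tgt) ∘ₗ f α = f α)
    (h : ∑ α, augToYoneda 𝒜 (hρ.arrowDual α) * L.toYoneda (n + 1) (f α) = 0) :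
    ∃ g : ι → L.Z n →ₗ[A] DegreeZeroModule 𝒜, ∀ α, L.toYoneda (n + 1) (f α) =
      ∑ β, ∑ s, u.repr (x ρ α * x ρ β) s •
        (augToYoneda 𝒜 (hρ.arrowDual β) * L.toYoneda n (g s)) := by
  classical
  have hfr := hρ.isVertexFrame
  choose F F' hF hF' using fun α => L.exists_lift (f α)
  choose G hG hG' using fun α => L.exists_arrowDual_mul hρ (f α) α
  let dk : L.P (n + 1) →ₗ[k] L.P n := (L.d n).restrictScalars k
  -- The total form `∑ x_β m_β ↦ ∑ f_α(m_α)`. Defining it through the lifts `F α` makes it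
  -- independent of the chosen expression.
  let hk : L.P (n + 1) →ₗ[k] k := ∑ α, hρ.arrowCoeff α ∘ₗ (F α).restrictScalars k
  have hk_apply : ∀ m : QuiverArrow V → L.P (n + 1), hk (∑ β, x ρ β • m β) =
      ∑ α, hρ.isVertexFrame.coord α.tgt (f α (L.proj (n + 1) (m α))) := by
    intro m
    rw [LinearMap.sum_apply]
    exact Finset.sum_congr rfl fun α _ => L.arrowCoeff_lift hρ (hF α) α m
  -- A cycle of degree `n + 2` is the boundary of some `y` in the lowest part of `P (n + 2)`. On it
  -- `hk` is the pairing of `y` with the vanishing sum of products, so `hk` factors through `d` in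
  -- this degree.
  obtain ⟨ψ, hψ⟩ := LinearMap.exists_factor dk hk (L.piece (n + 1) (n + 2)) (by
    intro z hz hdz
    obtain ⟨y, hy, rfl⟩ := L.exists_d_eq hz hdz
    obtain ⟨m, hm, -⟩ := L.exists_eq_sum_x_smul hρ hz
    simp only [hG] at h
    rw [← map_sum] at h
    have h0 := L.toYoneda_injective (n + 2) (h.trans (map_zero _).symm)
    have h1 := congrArg hρ.isVertexFrame.trace
      (LinearMap.congr_fun h0 (L.proj (n + 2) y))
    rw [LinearMap.sum_apply, map_sum, LinearMap.zero_apply, map_zero] at h1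
    rw [hm, hk_apply, ← h1]
    exact Finset.sum_congr rfl fun α _ => (hG' α y m hm).symm)
  -- Expand `ψ (x_α x_β m)` in the basis `u` of `A`: its coefficients are those of `x_α x_β`, and `g
  -- s` is the class of the form `m ↦ ψ (u_s m)`.
  choose g hg using fun s => L.exists_hom hρ n (ψ ∘ₗ Algebra.lsmul k k (L.P n) (u s))
  refine ⟨g, fun α => ?_⟩
  choose K hK hK' using fun β s => L.exists_arrowDual_mul hρ (g s) β
  simp only [hK, ← map_smul, ← map_sum]
  congr 1
  refine L.hom_ext hρ fun m hm => ?_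
  obtain ⟨m', hm', hm''⟩ := L.exists_eq_sum_x_smul hρ (L.d_mem_piece hm)
  -- Evaluating `hk` on `x_α m` isolates `f α`; the condition `hf` turns the coordinate at the
  -- target of `α` into the full trace.
  have h1 : hρ.isVertexFrame.trace (f α (L.proj (n + 1) m)) = hk (x ρ α • m) := by
    have h2 : x ρ α • m = ∑ β, x ρ β • (Pi.single α m : QuiverArrow V → L.P (n + 1)) β := by
      rw [Finset.sum_eq_single α, Pi.single_eq_same]
      · intro β _ hβ
        rw [Pi.single_eq_of_ne hβ, smul_zero]
      · simp
    rw [h2, hk_apply, Finset.sum_eq_single α, Pi.single_eq_same]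
    · exact hρ.isVertexFrame.trace_eq_coord (LinearMap.congr_fun (hf α) _)
    · intro β _ hβ
      rw [Pi.single_eq_of_ne hβ, map_zero, map_zero, map_zero]
    · simp
  have h3 : x ρ α • m ∈ L.piece (n + 1) (n + 2) := by
    have := L.smul_mem_piece (hρ.x_mem α) hm
    rwa [show 1 + (n + 1) = n + 2 by omega] at this
  have h4 : dk (x ρ α • m) = ∑ β, (x ρ α * x ρ β) • m' β := by
    change L.d n (x ρ α • m) = _
    rw [map_smul, hm', Finset.smul_sum]
    simp only [smul_smul]
  rw [h1, ← hψ _ h3, h4]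
  simp only [LinearMap.sum_apply, map_sum, LinearMap.smul_apply, map_smul]
  refine Finset.sum_congr rfl fun β _ => ?_
  simp only [hK' β _ m m' hm', hg _ _ (hm'' β), LinearMap.comp_apply, Algebra.lsmul_coe]
  rw [← x_mul_e ρ β, ← mul_assoc]
  conv_lhs => rw [mul_smul, ← u.sum_repr (x ρ α * x ρ β), Finset.sum_smul, map_sum]
  rw [mul_assoc, x_mul_e]
  refine Finset.sum_congr rfl fun s _ => ?_
  rw [smul_assoc, map_smul]

theorem exists_arrowDual_eq (β : QuiverArrow V) :
    ∃ g : L.Z 1 →ₗ[A] DegreeZeroModule 𝒜,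
      augToYoneda 𝒜 (hρ.arrowDual β) = L.toYoneda 1 g ∧
      ∀ (y : L.P 1) (m : QuiverArrow V → L.P 0), L.d 0 y = ∑ γ, x ρ γ • m γ →
        hρ.isVertexFrame.trace (g (L.proj 1 y)) =
          hρ.isVertexFrame.coord β.tgt (L.ε (m β)) := by
  obtain ⟨g, hg, hg'⟩ := L.exists_arrowDual_mul hρ (n := 0) LinearMap.id β
  refine ⟨g, ?_, hg'⟩
  rw [← hg]
  exact ((congrArg _ (endToYoneda_id 𝒜)).trans (mul_one _)).symm

omit [∀ a b : V, Finite (a ⟶ b)] in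
theorem x_mul_of_mem_zero (β : QuiverArrow V) {y : A} (hy : y ∈ 𝒜 0) :
    x ρ β * y = hρ.vertexCoeff β.tgt y • x ρ β := by
  rw [← x_mul_e ρ β, mul_assoc, hρ.isVertexFrame.e_mul _ hy, mul_smul_comm]

theorem exists_arrowDual_mul_arrowDual (α β : QuiverArrow V) :
    ∃ g : L.Z 2 →ₗ[A] DegreeZeroModule 𝒜,
      augToYoneda 𝒜 (hρ.arrowDual α) * augToYoneda 𝒜 (hρ.arrowDual β) = L.toYoneda 2 g ∧
      ∀ (y : L.P 2) (m : QuiverArrow V → L.P 1) (m' : QuiverArrow V → L.P 0),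
        L.d 1 y = ∑ γ, x ρ γ • m γ → L.d 0 (e ρ α.tgt • m α) = ∑ γ, x ρ γ • m' γ →
        hρ.isVertexFrame.trace (g (L.proj 2 y)) =
          hρ.isVertexFrame.coord β.tgt (L.ε (m' β)) := by
  obtain ⟨f, hf, hf'⟩ := L.exists_arrowDual_eq hρ β
  obtain ⟨g, hg, hg'⟩ := L.exists_arrowDual_mul hρ f α
  refine ⟨g, by rw [hf, hg], fun y m m' hm hm' => ?_⟩
  rw [hg' y m hm, L.coord_eq_trace hρ, hf' _ m' hm']

include L in
/-- The quadratic relations of the Yoneda algebra that come from linear forms on `A₍₂₎`. -/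
theorem sum_arrowDual_mul_arrowDual (φ : A →ₗ[k] k) :
    ∑ α, ∑ β, φ (x ρ α * x ρ β) •
      (augToYoneda 𝒜 (hρ.arrowDual α) * augToYoneda 𝒜 (hρ.arrowDual β)) = 0 := by
  choose G hG hG' using fun α β => L.exists_arrowDual_mul_arrowDual hρ α β
  simp only [hG, ← map_smul, ← map_sum]
  rw [← map_zero (L.toYoneda 2)]
  congr 1
  refine L.hom_ext hρ fun y hy => ?_
  obtain ⟨m, hm, hm'⟩ := L.exists_eq_sum_x_smul hρ (L.d_mem_piece hy)
  choose n hn hn' using fun α : QuiverArrow V => L.exists_eq_sum_x_smul hρ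
    (L.d_mem_piece (L.smul_mem_piece_zero (hρ.e_mem α.tgt) (hm' α)))
  -- Applying `d` twice to `y` gives a linear dependence among the products `x_α x_β` with
  -- coefficients in `P 0`.
  have hdd : ∑ α, ∑ β, (x ρ α * x ρ β) • n α β = 0 := by
    have h1 : L.d 0 (L.d 1 y) = 0 := (L.exact_succ 0).apply_apply_eq_zero y
    rw [hm, map_sum] at h1
    rw [← h1]
    refine Finset.sum_congr rfl fun α _ => ?_
    simp only [mul_smul]
    rw [← Finset.smul_sum, ← hn, map_smul, map_smul, smul_smul, x_mul_e]
  -- `Θ : P 0 → A` lifts the augmentation. The degree-two part of its value on the dependence is a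
  -- relation in `A` whose coefficients are the pairings with `y`; the form `φ` is then applied.
  obtain ⟨Θ, -, hΘ, -⟩ := L.exists_lift (n := 0) LinearMap.id
  have h2 : ∑ α, ∑ β, hρ.vertexCoeff β.tgt (Θ (n α β)) • (x ρ α * x ρ β) = 0 := by
    have h3 := congrArg (GradedAlgebra.proj 𝒜 2) (congrArg Θ hdd)
    simp only [map_sum, map_smul, map_zero, smul_eq_mul] at h3
    rw [← h3]
    refine Finset.sum_congr rfl fun α _ => Finset.sum_congr rfl fun β _ => ?_
    have h4 : x ρ α * x ρ β ∈ gradedTail 𝒜 2 :=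
      mem_gradedTail_of_mem 𝒜 (SetLike.mul_mem_graded (hρ.x_mem α) (hρ.x_mem β)) le_rfl
    have h5 : x ρ α * x ρ β ∈ 𝒜 2 := SetLike.mul_mem_graded (hρ.x_mem α) (hρ.x_mem β)
    have h6 := gradedProj_mul_of_mem_gradedTail 𝒜 (m := 0) (y := Θ (n α β)) h4
      (by rw [mem_gradedTail]; intro j hj; omega)
    rw [add_zero] at h6
    rw [h6, gradedProj_of_mem 𝒜 h5, mul_assoc,
      x_mul_of_mem_zero hρ β (gradedProj_mem 𝒜 0 _), hρ.isVertexFrame.coeff_proj, mul_smul_comm]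
  have h7 := congrArg φ h2
  simp only [map_sum, map_smul, map_zero, smul_eq_mul] at h7
  simp only [LinearMap.sum_apply, LinearMap.smul_apply, map_sum, map_smul, smul_eq_mul,
    LinearMap.zero_apply, map_zero, hG' _ _ y m (n _) hm (hn _)]
  rw [← h7]
  refine Finset.sum_congr rfl fun α _ => Finset.sum_congr rfl fun β _ => ?_
  rw [mul_comm]
  congr 1
  exact congrArg (hρ.isVertexFrame.coord β.tgt) (hΘ (n α β)).symm

omit hρ [Fintype V] [Quiver.{0} V] [∀ a b : V, Finite (a ⟶ b)] in
theorem exists_ε_eq_one : ∃ q ∈ L.piece 0 0, L.ε q = classZero 𝒜 1 := by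
  obtain ⟨q, hq⟩ := L.ε_surjective (classZero 𝒜 1)
  exact ⟨L.lowest 0 q, L.comp_mem _ _ q, (L.proj_lowest (n := 0) LinearMap.id q).trans hq⟩

omit [∀ a b : V, Finite (a ⟶ b)] in
theorem exists_d_eq_x_smul {q : L.P 0} (hq : q ∈ L.piece 0 0) (hq' : L.ε q = classZero 𝒜 1)
    (β : QuiverArrow V) : ∃ y ∈ L.piece 1 1, L.d 0 y = x ρ β • q := by
  have h1 : x ρ β • q ∈ L.piece 0 1 := L.smul_mem_piece (hρ.x_mem β) hq
  refine L.exists_d_eq_of_ε h1 ?_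
  rw [map_smul, hq', smul_quotient_eq_zero (hρ.x_mem_irrelevant β)]

include L in
/-- The quadratic relations of the Yoneda algebra are orthogonal to those of the algebra. -/
theorem sum_mul_eq_zero (κ r : QuiverArrow V → QuiverArrow V → k)
    (hκ : ∀ α β, α.tgt ≠ β.src → κ α β = 0)
    (hK : ∑ α, ∑ β, κ α β •
      (augToYoneda 𝒜 (hρ.arrowDual α) * augToYoneda 𝒜 (hρ.arrowDual β)) = 0)
    (hr : ∑ α, ∑ β, r α β • (x ρ α * x ρ β) = 0) : ∑ α, ∑ β, κ α β * r α β = 0 := by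
  classical
  obtain ⟨q, hq, hq'⟩ := L.exists_ε_eq_one
  -- The elements `y β` lift the arrows to the lowest part of `P 1`. A quadratic relation `r` then
  -- becomes a cycle of degree two.
  choose y hy hy' using L.exists_d_eq_x_smul hρ hq hq'
  choose G hG hG' using fun α β => L.exists_arrowDual_mul_arrowDual hρ α β
  have hz : ∑ α, x ρ α • ∑ β, r α β • y β ∈ L.piece 1 2 :=
    Submodule.sum_mem _ fun α _ => L.smul_mem_piece (hρ.x_mem α)
      (Submodule.sum_mem _ fun β _ => Submodule.smul_mem _ _ (hy β))
  have hd : ∀ α, L.d 0 (∑ β, r α β • y β) = ∑ β, r α β • x ρ β • q := by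
    intro α
    rw [map_sum]
    refine Finset.sum_congr rfl fun β _ => ?_
    rw [L.field_smul_def, map_smul, hy']
    rfl
  have hdz : L.d 0 (∑ α, x ρ α • ∑ β, r α β • y β) = 0 := by
    rw [map_sum, ← zero_smul A q, ← hr, Finset.sum_smul]
    refine Finset.sum_congr rfl fun α _ => ?_
    rw [map_smul, hd, Finset.smul_sum, Finset.sum_smul]
    refine Finset.sum_congr rfl fun β _ => ?_
    rw [smul_comm (x ρ α), smul_smul, smul_assoc]
  -- The class of `αβ` pairs with this `z` to `r α β` when the arrows are composable, so pairing
  -- `hK` with `z` gives the claim. Non-composable pairs are excluded by `hκ`.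
  obtain ⟨z, hz2, hz'⟩ := L.exists_d_eq hz hdz
  simp only [hG, ← map_smul, ← map_sum] at hK
  have h0 := L.toYoneda_injective 2 (hK.trans (map_zero _).symm)
  have h1 := congrArg hρ.isVertexFrame.trace (LinearMap.congr_fun h0 (L.proj 2 z))
  have hd' : ∀ α : QuiverArrow V, L.d 0 (e ρ α.tgt • ∑ β, r α β • y β) =
      ∑ β, x ρ β • (if α.tgt = β.src then r α β • q else 0) := by
    intro α
    rw [map_smul, hd, Finset.smul_sum]
    refine Finset.sum_congr rfl fun β _ => ?_
    rw [smul_comm (e ρ α.tgt), smul_smul]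
    split_ifs with h
    · rw [h, e_mul_x, smul_comm]
    · rw [← e_mul_x ρ β, ← mul_assoc, e_mul_of_ne ρ h, zero_mul, zero_smul, smul_zero, smul_zero]
  simp only [LinearMap.sum_apply, LinearMap.smul_apply, map_sum, map_smul, smul_eq_mul,
    LinearMap.zero_apply, map_zero, hG' _ _ z _ _ hz' (hd' _)] at h1
  rw [← h1]
  refine Finset.sum_congr rfl fun α _ => Finset.sum_congr rfl fun β _ => ?_
  split_ifs with h
  · congr 1
    rw [L.field_smul_def, map_smul, hq', algebraMap_smul, map_smul, IsVertexFrame.coord_classZero,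
      hρ.isVertexFrame.coeff_one, smul_eq_mul, mul_one]
  · rw [hκ _ _ h, zero_mul, zero_mul]

end LinearResolution

/-! ### Koszul algebras are quadratic -/

section Nakayama

variable {k : Type u} [Field k] {A : Type v} [Ring A] [Algebra k A]
  {𝒜 : ℕ → Submodule k A} [GradedAlgebra 𝒜]

variable (𝒜) in
/-- The left ideal of the elements of degree at least `n`. -/
def tailIdeal (n : ℕ) : Ideal A where
  __ := (gradedTail 𝒜 n).toAddSubmonoid
  smul_mem' y z hz := by
    have h := mul_mem_gradedTail 𝒜 (n := 0) (x := y)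
      (by rw [mem_gradedTail]; intro j hj; omega) hz
    rw [zero_add] at h
    exact h

theorem mem_tailIdeal {n : ℕ} {y : A} : y ∈ tailIdeal 𝒜 n ↔ y ∈ gradedTail 𝒜 n := Iff.rfl

theorem irrelevant_smul_tailIdeal_le (n : ℕ) :
    (HomogeneousIdeal.irrelevant 𝒜).toIdeal • tailIdeal 𝒜 n ≤ tailIdeal 𝒜 (n + 1) := by
  rw [Submodule.smul_le]
  intro y hy z hz
  have hy' : y ∈ gradedTail 𝒜 1 := by
    rw [mem_gradedTail]
    intro j hj
    obtain rfl : j = 0 := by omega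
    exact mem_irrelevant_toIdeal_iff.1 hy
  have := mul_mem_gradedTail 𝒜 hy' hz
  rwa [add_comm] at this

variable {M : Type*} [AddCommGroup M] [Module A M]

/-- Nakayama's lemma for the augmentation ideal of a bounded graded algebra. -/
theorem eq_bot_of_le_irrelevant_smul (hb : ∃ N, ∀ n, N ≤ n → 𝒜 n = ⊥) {W : Submodule A M}
    (hW : W ≤ (HomogeneousIdeal.irrelevant 𝒜).toIdeal • W) : W = ⊥ := by
  obtain ⟨N, hN⟩ := hb
  -- Iterating the inclusion pushes the coefficients into arbitrarily high degrees, where `A`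
  -- vanishes.
  have key : ∀ n, W ≤ tailIdeal 𝒜 n • W := by
    intro n
    induction n with
    | zero =>
      have : tailIdeal 𝒜 0 = ⊤ := by
        rw [eq_top_iff]
        intro y _
        rw [mem_tailIdeal, mem_gradedTail]
        intro j hj
        omega
      rw [this, Submodule.top_smul]
    | succ n ih =>
      refine hW.trans ((Submodule.smul_mono le_rfl ih).trans ?_)
      rw [← Submodule.smul_assoc]
      exact Submodule.smul_mono_left (irrelevant_smul_tailIdeal_le n)
  have h0 : tailIdeal 𝒜 N = ⊥ := by
    rw [eq_bot_iff]
    intro y hy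
    rw [mem_tailIdeal, mem_gradedTail] at hy
    refine eq_zero_of_gradedProj 𝒜 fun n => ?_
    by_cases hn : n < N
    · exact hy n hn
    · have := gradedProj_mem 𝒜 n y
      rwa [hN n (by omega), Submodule.mem_bot] at this
  rw [eq_bot_iff]
  refine (key N).trans ?_
  rw [h0, Submodule.bot_smul]

/-- A surjection onto a projective module with superfluous kernel is injective. -/
theorem eq_zero_of_projective (hb : ∃ N, ∀ n, N ≤ n → 𝒜 n = ⊥) {P : Type*} [AddCommGroup P]
    [Module A P] [Module.Projective A P] (p : M →ₗ[A] P) (hp : Function.Surjective p)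
    (h : ∀ z, p z = 0 → z ∈ (HomogeneousIdeal.irrelevant 𝒜).toIdeal • (⊤ : Submodule A M))
    {z : M} (hz : p z = 0) : z = 0 := by
  obtain ⟨s, hs⟩ := Module.projective_lifting_property p LinearMap.id hp
  have hs' : ∀ y, p (s y) = y := LinearMap.congr_fun hs
  -- A section makes `T` a projection onto the kernel. Applying it to the superfluous inclusion
  -- gives `ker p ≤ A₊ • ker p`, to which Nakayama applies.
  let T : M →ₗ[A] M := LinearMap.id - s ∘ₗ p
  have hT : Submodule.map T ⊤ ≤ LinearMap.ker p := by
    rintro _ ⟨y, -, rfl⟩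
    simp [T, hs']
  have hker : LinearMap.ker p = ⊥ := by
    refine eq_bot_of_le_irrelevant_smul hb fun y hy => ?_
    have hy' : T y = y := by
      have : p y = 0 := hy
      simp [T, this]
    have h1 : T y ∈ Submodule.map T
        ((HomogeneousIdeal.irrelevant 𝒜).toIdeal • (⊤ : Submodule A M)) := ⟨y, h y hy, rfl⟩
    rw [Submodule.map_smul'', hy'] at h1
    exact Submodule.smul_mono le_rfl hT h1
  have : z ∈ LinearMap.ker p := hz
  rwa [hker] at this

end Nakayama

/-! ### Elements of the path algebra homogeneous for length. -/

namespace PathAlgebra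

variable {k : Type u} [Field k] {V : Type} [Fintype V] [Quiver.{0} V]

theorem restrict_length_mul {m n l : ℕ} (h : m + n = l) {x y : PathAlgebra k V}
    (hx : restrict (fun p => p.length = m) x = x) (hy : restrict (fun p => p.length = n) y = y) :
    restrict (fun p => p.length = l) (x * y) = x * y := by
  rw [← hx, ← hy]
  clear hx hy
  induction x using PathAlgebra.induction with
  | zero => simp
  | add x x' h h' => rw [map_add, add_mul, map_add, h, h']
  | smul c p =>
    induction y using PathAlgebra.induction with
    | zero => simp
    | add y y' h h' => rw [map_add, mul_add, map_add, h, h']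
    | smul d q =>
      rw [map_smul, map_smul, smul_mul_smul_comm, map_smul]
      congr 1
      rw [restrict_ofPath, restrict_ofPath]
      split_ifs with h h'
      · obtain ⟨a, b, p⟩ := p
        obtain ⟨b', c, q⟩ := q
        by_cases hb : b = b'
        · subst hb
          rw [comp_mul, restrict_ofPath, if_pos]
          rw [length_comp]
          omega
        · rw [mul_of_ne (by exact hb), map_zero]
      · simp
      · simp
      · simp

omit [Fintype V] in
theorem restrict_length_path (α : QuiverArrow V) :
    restrict (fun p => p.length = 1) (ofPath k α.path) = ofPath k α.path := by
  rw [restrict_ofPath, if_pos (length_path α)]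

omit [Fintype V] in
theorem restrict_length_vertex (a : V) :
    restrict (fun p => p.length = 0) (ofPath k (vertex a)) = ofPath k (vertex a) := by
  rw [restrict_ofPath, if_pos (length_vertex a)]

omit [Fintype V] in
theorem restrict_self_restrict (s : AnyPath V → Prop) (x : PathAlgebra k V) :
    restrict s (restrict s x) = restrict s x := by
  rw [restrict_restrict]
  simp

theorem eq_sum_restrict_length (x : PathAlgebra k V) :
    ∃ N, x = ∑ n ∈ Finset.range N, restrict (fun p => p.length = n) x := by
  classical
  induction x using PathAlgebra.induction with
  | zero => exact ⟨0, by simp⟩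
  | add x y hx hy =>
    have mono : ∀ (z : PathAlgebra k V) (N M : ℕ), N ≤ M →
        z = ∑ n ∈ Finset.range N, restrict (fun p => p.length = n) z →
        z = ∑ n ∈ Finset.range M, restrict (fun p => p.length = n) z := by
      intro z N M hNM h
      refine h.trans (Finset.sum_subset (Finset.range_mono hNM) fun n _ hn => ?_)
      rw [h, map_sum]
      refine Finset.sum_eq_zero fun i hi => ?_
      rw [restrict_restrict]
      apply ext_coeff
      intro p
      rw [coeff_restrict, if_neg, map_zero]
      rintro ⟨h1, h2⟩
      rw [h1] at h2
      subst h2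
      exact hn hi
    obtain ⟨N, hx⟩ := hx
    obtain ⟨M, hy⟩ := hy
    refine ⟨max N M, ?_⟩
    simp only [map_add, Finset.sum_add_distrib]
    rw [← mono x N _ (le_max_left _ _) hx, ← mono y M _ (le_max_right _ _) hy]
  | smul c p =>
    refine ⟨p.length + 1, ?_⟩
    rw [Finset.sum_eq_single p.length, map_smul, restrict_ofPath, if_pos rfl]
    · intro n _ hn
      rw [map_smul, restrict_ofPath, if_neg hn.symm, smul_zero]
    · simp

end PathAlgebra

namespace IsGradedPresentation

variable {k : Type u} [Field k] {A : Type v} [Ring A] [Algebra k A]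
  {𝒜 : ℕ → Submodule k A}
  {V : Type} [Fintype V] [Quiver.{0} V] {ρ : PathAlgebra k V →ₐ[k] A}
  (hρ : IsGradedPresentation 𝒜 ρ)
include hρ

theorem eq_zero_of_length_lt {n : ℕ} (hn : n < 2) {w : PathAlgebra k V}
    (hw : restrict (fun p => p.length = n) w = w) (h : ρ w = 0) : w = 0 := by
  apply ext_coeff
  intro p
  rw [map_zero]
  by_contra hp
  have h2 := hρ.two_le w h p hp
  rw [← hw, coeff_restrict, if_neg (by omega)] at hp
  exact hp rfl

/-- The kernel of a graded presentation contains the length components of its elements, which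
permits induction on the length. -/
theorem ker_le_of_forall_length [GradedAlgebra 𝒜] {I : TwoSidedIdeal (PathAlgebra k V)}
    (h : ∀ n w, restrict (fun p => p.length = n) w = w → ρ w = 0 → w ∈ I) :
    TwoSidedIdeal.ker ρ ≤ I := by
  intro w hw
  obtain ⟨N, hN⟩ := eq_sum_restrict_length w
  rw [hN]
  refine sum_mem fun n _ => h n _ (restrict_self_restrict _ _) ?_
  rw [← hρ.proj_apply, (TwoSidedIdeal.mem_ker ρ).1 hw, map_zero]

end IsGradedPresentation

/-! ### The first two terms of the resolution and the quadratic relations. -/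

namespace LinearResolution

open IsGradedPresentation

variable {k : Type u} [Field k] {A : Type v} [Ring A] [Algebra k A]
  {𝒜 : ℕ → Submodule k A} [GradedAlgebra 𝒜] (L : LinearResolution 𝒜)
  (hb : ∃ N, ∀ n, N ≤ n → 𝒜 n = ⊥)

/-- The augmentation is injective on the lowest part of `P 0`, and the image of `q` generates
`A₍₀₎`. -/
theorem exists_eq_smul_of_ε_eq_one {q : L.P 0} (hq : q ∈ L.piece 0 0)
    (hq' : L.ε q = classZero 𝒜 1) {m : L.P 0} (hm : m ∈ L.piece 0 0) : ∃ a ∈ 𝒜 0, m = a • q := by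
  obtain ⟨a, ha⟩ := Submodule.Quotient.mk_surjective _ (L.ε m)
  refine ⟨GradedAlgebra.proj 𝒜 0 a, gradedProj_mem 𝒜 0 a, ?_⟩
  have h1 : m - GradedAlgebra.proj 𝒜 0 a • q ∈ L.piece 0 0 :=
    Submodule.sub_mem _ hm (L.smul_mem_piece_zero (gradedProj_mem 𝒜 0 a) hq)
  have h2 : L.ε (m - GradedAlgebra.proj 𝒜 0 a • q) = 0 := by
    rw [map_sub, map_smul, hq', ← ha, smul_classZero, mul_one, classZero_gradedProj, sub_self]
  have h3 := L.lowest_of_proj_eq_zero (n := 0) h2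
  rw [L.lowest_of_mem h1] at h3
  exact sub_eq_zero.1 h3

include hb in
-- `P 0` is free on `q`: the map `a ↦ a • q` is onto because `P 0` is generated in degree zero, and
-- its kernel lies in the augmentation ideal, hence is zero since `P 0` is projective.
theorem eq_zero_of_smul_eq_zero {q : L.P 0} (hq : q ∈ L.piece 0 0)
    (hq' : L.ε q = classZero 𝒜 1) {a : A} (ha : a • q = 0) : a = 0 := by
  have := L.projective 0
  refine eq_zero_of_projective hb (LinearMap.toSpanSingleton A (L.P 0) q) ?_ ?_ ha
  · intro z
    obtain ⟨N, b, m, rfl, hm⟩ := L.exists_eq_sum_smul z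
    choose c _ hc using fun i => L.exists_eq_smul_of_ε_eq_one hq hq' (hm i)
    refine ⟨∑ i, b i * c i, ?_⟩
    rw [LinearMap.toSpanSingleton_apply, Finset.sum_smul]
    exact Finset.sum_congr rfl fun i _ => by rw [mul_smul, ← hc]
  · intro z hz
    rw [LinearMap.toSpanSingleton_apply] at hz
    have h1 : classZero 𝒜 z = 0 := by
      have := congrArg L.ε hz
      rwa [map_smul, hq', smul_classZero, mul_one, map_zero] at this
    rw [Submodule.Quotient.mk_eq_zero] at h1
    convert Submodule.smul_mem_smul h1 (Submodule.mem_top (x := (1 : A)) (R := A)) using 1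
    exact (mul_one z).symm

section Presented

variable {V : Type} [Fintype V] [Quiver.{0} V] [∀ a b : V, Finite (a ⟶ b)]
  {ρ : PathAlgebra k V →ₐ[k] A} (hρ : IsGradedPresentation 𝒜 ρ)
include hρ

/-- The differential is injective on the lowest part of `P 1`, so it suffices to compare boundaries,
which are combinations of the `x_α q`. -/
theorem exists_eq_sum_smul_of_mem_piece_one {q : L.P 0} (hq : q ∈ L.piece 0 0)
    (hq' : L.ε q = classZero 𝒜 1) {y : QuiverArrow V → L.P 1} (hy : ∀ α, y α ∈ L.piece 1 1)
    (hy' : ∀ α, L.d 0 (y α) = x ρ α • q) {m : L.P 1} (hm : m ∈ L.piece 1 1) :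
    ∃ c : QuiverArrow V → k, m = ∑ α, c α • y α := by
  obtain ⟨m', hm', hm''⟩ := L.exists_eq_sum_x_smul hρ (L.d_mem_piece hm)
  choose a ha ha' using fun α => L.exists_eq_smul_of_ε_eq_one hq hq' (hm'' α)
  refine ⟨fun α => hρ.vertexCoeff α.tgt (a α), sub_eq_zero.1 (L.eq_zero_of_d_eq_zero
    (Submodule.sub_mem _ hm (Submodule.sum_mem _ fun α _ => Submodule.smul_mem _ _ (hy α))) ?_)⟩
  rw [map_sub, hm', map_sum, sub_eq_zero]
  refine Finset.sum_congr rfl fun α _ => ?_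
  rw [ha', smul_smul, x_mul_of_mem_zero hρ α (ha α), L.field_smul_def 1, map_smul, hy',
    algebraMap_smul, smul_assoc]

omit [∀ a b : V, Finite (a ⟶ b)] in
theorem e_smul_eq {q : L.P 0} {α : QuiverArrow V} {y : L.P 1} (hy : y ∈ L.piece 1 1)
    (hy' : L.d 0 y = x ρ α • q) : e ρ α.src • y = y := by
  refine sub_eq_zero.1 (L.eq_zero_of_d_eq_zero
    (Submodule.sub_mem _ (L.smul_mem_piece_zero (hρ.e_mem _) hy) hy) ?_)
  rw [map_sub, map_smul, hy', smul_smul, e_mul_x, sub_self]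

include hb in
-- `P 1` is the direct sum of the modules `A e_{src α}`, with generators `y α`. The natural
-- surjection from that sum has superfluous kernel: the degree-zero coefficients of an element of
-- the kernel give a linear relation among the arrows, hence vanish.
theorem eq_zero_of_sum_smul_eq_zero {q : L.P 0} (hq : q ∈ L.piece 0 0)
    (hq' : L.ε q = classZero 𝒜 1) {y : QuiverArrow V → L.P 1} (hy : ∀ α, y α ∈ L.piece 1 1)
    (hy' : ∀ α, L.d 0 (y α) = x ρ α • q) {c : QuiverArrow V → A}
    (hc : ∀ α, c α * e ρ α.src = c α) (h : ∑ α, c α • y α = 0) : c = 0 := by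
  classical
  have hey : ∀ α, e ρ α.src • y α = y α := fun α => L.e_smul_eq hρ (hy α) (hy' α)
  let Q : Submodule A (QuiverArrow V → A) :=
    { carrier := {c | ∀ α, c α * e ρ α.src = c α}
      add_mem' := fun {c d} hc hd α => by rw [Pi.add_apply, add_mul, hc, hd]
      zero_mem' := fun α => by rw [Pi.zero_apply, zero_mul]
      smul_mem' := fun b c hc α => by rw [Pi.smul_apply, smul_eq_mul, mul_assoc, hc] }
  -- `Q` is the direct sum of the left ideals `A e_{src α}`, and `p` is the candidate isomorphism
  -- onto `P 1`.
  let p : Q →ₗ[A] L.P 1 :=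
    { toFun c := ∑ α, c.1 α • y α
      map_add' c d := by
        simp only [Submodule.coe_add, Pi.add_apply, add_smul, Finset.sum_add_distrib]
      map_smul' b c := by
        simp only [Submodule.coe_smul, Pi.smul_apply, smul_assoc, Finset.smul_sum,
          RingHom.id_apply] }
  have := L.projective 1
  have key : (⟨c, hc⟩ : Q) = 0 := by
    refine eq_zero_of_projective hb p ?_ ?_ h
    · intro z
      obtain ⟨N, b, m, rfl, hm⟩ := L.exists_eq_sum_smul z
      choose l hl using fun i => L.exists_eq_sum_smul_of_mem_piece_one hρ hq hq' hy hy' (hm i)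
      refine ⟨⟨fun α => ∑ i, (b i * algebraMap k A (l i α)) * e ρ α.src, fun α => ?_⟩, ?_⟩
      · simp only [Finset.sum_mul, mul_assoc, e_mul_self]
      · change ∑ α, (∑ i, (b i * algebraMap k A (l i α)) * e ρ α.src) • y α = _
        simp only [Finset.sum_smul]
        rw [Finset.sum_comm]
        refine Finset.sum_congr rfl fun i _ => ?_
        conv_rhs => rw [hl i, Finset.smul_sum]
        refine Finset.sum_congr rfl fun α _ => ?_
        rw [mul_smul, mul_smul, hey]
        rfl
    · rintro ⟨d, hd⟩ hz
      have hz' : ∑ α, d α • y α = 0 := hz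
      have h0 : ∀ α, GradedAlgebra.proj 𝒜 0 (d α) = hρ.vertexCoeff α.src (d α) • e ρ α.src := by
        intro α
        rw [← hd α, gradedProj_zero_mul, gradedProj_of_mem 𝒜 (hρ.e_mem _),
          hρ.isVertexFrame.mul_e _ (gradedProj_mem 𝒜 0 _), hρ.isVertexFrame.coeff_proj, hd]
      have h1 : ∑ α, hρ.vertexCoeff α.src (d α) • y α = 0 := by
        have := congrArg (L.lowest 1) hz'
        rw [map_sum, map_zero] at this
        rw [← this]
        refine Finset.sum_congr rfl fun α _ => ?_
        rw [L.lowest_smul, L.lowest_of_mem (hy α), h0, smul_assoc, hey]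
      have h2 : (∑ α, hρ.vertexCoeff α.src (d α) • x ρ α) • q = 0 := by
        have := congrArg (L.d 0) h1
        rw [map_sum, map_zero] at this
        rw [← this, Finset.sum_smul]
        refine Finset.sum_congr rfl fun α _ => ?_
        rw [L.field_smul_def 1, map_smul, hy', algebraMap_smul, smul_assoc]
      have h3 := L.eq_zero_of_smul_eq_zero hb hq hq' h2
      have h4 : ∀ α, d α ∈ (HomogeneousIdeal.irrelevant 𝒜).toIdeal := by
        intro α
        have := congrArg (hρ.arrowCoeff α) h3
        simp only [map_sum, map_smul, hρ.arrowCoeff_x, map_zero, smul_eq_mul, mul_ite, mul_one,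
          mul_zero, Finset.sum_ite_eq', Finset.mem_univ, if_true] at this
        rw [mem_irrelevant_toIdeal_iff, h0, this, zero_smul]
      have hE : ∀ α : QuiverArrow V, (Pi.single α (e ρ α.src) : QuiverArrow V → A) ∈ Q := by
        intro α β
        by_cases hβ : β = α
        · subst hβ
          rw [Pi.single_eq_same, e_mul_self]
        · rw [Pi.single_eq_of_ne hβ, zero_mul]
      have h5 : (⟨d, hd⟩ : Q) = ∑ α, d α • (⟨_, hE α⟩ : Q) := by
        apply Subtype.ext
        refine Eq.trans ?_ (map_sum Q.subtype (fun α => d α • (⟨_, hE α⟩ : Q)) _).symm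
        funext β
        rw [Finset.sum_apply, Finset.sum_eq_single β]
        · simpa using (hd β).symm
        · intro α _ hα
          simp [Pi.single_eq_of_ne hα.symm]
        · simp
      rw [h5]
      exact Submodule.sum_mem _ fun α _ => Submodule.smul_mem_smul (h4 α) Submodule.mem_top
  exact congrArg Subtype.val key

include L hb in
/-- The relations of a Koszul algebra are generated by the quadratic ones. -/
theorem ker_le_span_quadratic : TwoSidedIdeal.ker ρ ≤
    TwoSidedIdeal.span {r | ρ r = 0 ∧ restrict (fun p => p.length = 2) r = r} := by
  obtain ⟨q, hq, hq'⟩ := L.exists_ε_eq_one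
  choose y hy hy' using L.exists_d_eq_x_smul hρ hq hq'
  refine hρ.ker_le_of_forall_length fun n => ?_
  induction n with
  | zero =>
    intro w hw h
    rw [hρ.eq_zero_of_length_lt (by omega) hw h]
    exact zero_mem _
  | succ n ih =>
    intro w hw h
    cases n with
    | zero =>
      rw [hρ.eq_zero_of_length_lt (by omega) hw h]
      exact zero_mem _
    | succ n =>
      obtain ⟨w', hw1, hw'⟩ := exists_eq_sum_mul_path (n + 1) w
      rw [hw] at hw1
      -- The relation `w` gives a cycle in `P 1`, hence the boundary of some `z` in `P 2`. Since `P
      -- 2` is generated in degree two, `z` has coefficients of degree `n` on generators `m j`.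
      have hz : ∑ α, ρ (w' α) • y α ∈ L.piece 1 (n + 1 + 1) :=
        Submodule.sum_mem _ fun α _ => L.smul_mem_piece (hρ.apply_mem (hw' α).1) (hy α)
      have hdz : L.d 0 (∑ α, ρ (w' α) • y α) = 0 := by
        have : ρ w • q = 0 := by rw [h, zero_smul]
        rw [← this, hw1, map_sum, map_sum, Finset.sum_smul]
        refine Finset.sum_congr rfl fun α _ => ?_
        rw [map_smul, hy', smul_smul, map_mul]
      obtain ⟨z, hz1, hz2⟩ := L.exists_d_eq hz hdz
      obtain ⟨N, a, m, hzm, hm⟩ := L.exists_eq_sum_smul z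
      have hzm' : z = ∑ j, GradedAlgebra.proj 𝒜 n (a j) • m j := by
        rw [← L.comp_of_mem hz1]
        conv_lhs => rw [hzm]
        rw [map_sum]
        exact Finset.sum_congr rfl fun j _ => L.comp_smul n (a j) (hm j)
      choose m1 hm1 hm1' using fun j => L.exists_eq_sum_x_smul hρ (L.d_mem_piece (hm j))
      choose c hc using fun j β =>
        L.exists_eq_sum_smul_of_mem_piece_one hρ hq hq' hy hy' (hm1' j β)
      choose b hb' using fun j => hρ.exists_of_mem (gradedProj_mem 𝒜 n (a j))
      let b' : Fin N → PathAlgebra k V := fun j => restrict (fun p => p.length = n) (b j)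
      have hbl : ∀ j, restrict (fun p => p.length = n) (b' j) = b' j := fun j =>
        restrict_self_restrict _ _
      -- The generator `m j` encodes this quadratic element. It is a relation because `d (d (m j)) =
      -- 0` and `P 0` is free on `q`.
      let r : Fin N → PathAlgebra k V := fun j =>
        ∑ β, ∑ α, c j β α • (ofPath k β.path * ofPath k α.path)
      have hr2 : ∀ j, restrict (fun p => p.length = 2) (r j) = r j := by
        intro j
        simp only [r, map_sum, map_smul]
        refine Finset.sum_congr rfl fun β _ => Finset.sum_congr rfl fun α _ => ?_
        rw [restrict_length_mul rfl (restrict_length_path β) (restrict_length_path α)]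
      have hr : ∀ j, ρ (r j) = 0 := by
        intro j
        refine L.eq_zero_of_smul_eq_zero hb hq hq' ?_
        have hdd : L.d 0 (L.d 1 (m j)) = 0 := (L.exact_succ 0).apply_apply_eq_zero (m j)
        rw [← hdd, hm1]
        simp only [r, map_sum, map_smul, map_mul, Finset.sum_smul]
        refine Finset.sum_congr rfl fun β _ => ?_
        rw [hc j β, map_sum, Finset.smul_sum]
        refine Finset.sum_congr rfl fun α _ => ?_
        rw [L.field_smul_def 1, map_smul, hy', algebraMap_smul, smul_assoc, mul_smul,
          smul_comm (x ρ β) (c j β α)]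
      let v : QuiverArrow V → PathAlgebra k V := fun α =>
        ∑ j, ∑ β, c j β α • (b' j * ofPath k β.path)
      have hv : ∀ α, restrict (fun p => p.length = n + 1) (v α) = v α := by
        intro α
        simp only [v, map_sum, map_smul]
        refine Finset.sum_congr rfl fun β _ => Finset.sum_congr rfl fun α _ => ?_
        rw [restrict_length_mul rfl (hbl _) (restrict_length_path _)]
      have hsum : ∑ α, ρ (v α) • y α = ∑ α, ρ (w' α) • y α := by
        rw [← hz2, hzm', map_sum]
        simp only [v, map_sum, map_smul, Finset.sum_smul]
        rw [Finset.sum_comm]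
        refine Finset.sum_congr rfl fun j _ => ?_
        rw [hm1 j, Finset.smul_sum, Finset.sum_comm]
        refine Finset.sum_congr rfl fun β _ => ?_
        rw [hc j β, Finset.smul_sum, Finset.smul_sum]
        refine Finset.sum_congr rfl fun α _ => ?_
        rw [map_mul, hb' j, smul_assoc, mul_smul, smul_comm (x ρ β), smul_comm _ (c j β α)]
      -- Both families of coefficients give the same element of `P 1`, so by freeness their
      -- differences are relations of length `n + 1`, covered by the induction hypothesis.
      have hzero := L.eq_zero_of_sum_smul_eq_zero hb hρ hq hq' hy hy'
        (c := fun α => ρ ((w' α - v α) * ofPath k (vertex α.src)))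
        (fun α => by rw [map_mul, mul_assoc, e_mul_self])
        (by
          simp only [map_mul, map_sub, mul_smul, L.e_smul_eq hρ (hy _) (hy' _), sub_smul,
            Finset.sum_sub_distrib]
          rw [hsum, sub_self])
      have hmem : ∀ α, (w' α - v α) * ofPath k (vertex α.src) ∈
          TwoSidedIdeal.span {r | ρ r = 0 ∧ restrict (fun p => p.length = 2) r = r} := by
        intro α
        refine ih _ (restrict_length_mul (add_zero _) ?_ (restrict_length_vertex _))
          (congrFun hzero α)
        rw [map_sub, (hw' α).1, hv]
      have hfin : w = ∑ α, ((w' α - v α) * ofPath k (vertex α.src)) * ofPath k α.path +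
          ∑ j, b' j * r j := by
        have h1 : ∑ j, b' j * r j = ∑ α, v α * ofPath k α.path := by
          simp only [r, v, Finset.mul_sum, Finset.sum_mul]
          conv_rhs => rw [Finset.sum_comm]
          refine Finset.sum_congr rfl fun j _ => ?_
          rw [Finset.sum_comm]
          refine Finset.sum_congr rfl fun α _ => Finset.sum_congr rfl fun β _ => ?_
          rw [mul_smul_comm, smul_mul_assoc, mul_assoc]
        rw [h1, ← Finset.sum_add_distrib, hw1]
        refine Finset.sum_congr rfl fun α _ => ?_
        rw [mul_assoc, vertex_mul_path, sub_mul, sub_add_cancel]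
      rw [hfin]
      exact add_mem (sum_mem fun α _ => TwoSidedIdeal.mul_mem_right _ _ _ (hmem α))
        (sum_mem fun j _ => TwoSidedIdeal.mul_mem_left _ _ _
          (TwoSidedIdeal.subset_span ⟨hr j, hr2 j⟩))

end Presented

end LinearResolution

/-! ### Dual presentations -/

/-- The product is a path or zero, so its component is everything or nothing. The scalar form avoids
separating composable from non-composable pairs. -/
theorem PathDegree.exists_component_eq_smul (k : Type u) [Field k] {V : Type} [Quiver.{0} V]
    (Γ : PathDegree V) (t : Γ.T) (p q : AnyPath V) :
    ∃ c : k, Γ.component t (ofPath k p * ofPath k q) = c • (ofPath k p * ofPath k q) := by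
  classical
  obtain ⟨a, b, p⟩ := p
  obtain ⟨b', d, q⟩ := q
  by_cases h : b = b'
  · subst h
    rw [comp_mul, PathDegree.component, restrict_ofPath]
    split_ifs
    · exact ⟨1, (one_smul _ _).symm⟩
    · exact ⟨0, (zero_smul _ _).symm⟩
  · rw [mul_of_ne (by exact h)]
    exact ⟨0, by simp⟩

/-- Since `ρ` respects degrees, the length components of a relation are relations. Independence of
the images of vertices and of arrows excludes lengths zero and one. -/
theorem isGradedPresentation_of_linearIndependent {k : Type u} [Field k] {B : Type v} [Ring B]
    [Algebra k B] {ℬ : ℕ → Submodule k B} [GradedAlgebra ℬ] {V : Type} [Fintype V]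
    [Quiver.{0} V] [∀ a b : V, Finite (a ⟶ b)] {ρ : PathAlgebra k V →ₐ[k] B}
    (hv : ∀ a, ρ (ofPath k (vertex a)) ∈ ℬ 0) (ha : ∀ α : QuiverArrow V, ρ (ofPath k α.path) ∈ ℬ 1)
    (hv' : LinearIndependent k fun a => ρ (ofPath k (vertex a)))
    (ha' : LinearIndependent k fun α : QuiverArrow V => ρ (ofPath k α.path))
    (hs : Function.Surjective ρ) : IsGradedPresentation ℬ ρ := by
  classical
  have hmem : ∀ p : AnyPath V, ρ (ofPath k p) ∈ ℬ p.length := by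
    rintro ⟨a, b, p⟩
    induction p with
    | nil => exact hv a
    | @cons b c p α ih =>
      have h1 : ofPath k (⟨a, c, p.cons α⟩ : AnyPath V) =
          ofPath k ⟨a, b, p⟩ * ofPath k (QuiverArrow.path ⟨b, c, α⟩) := by
        rw [comp_mul]
        rfl
      rw [h1, map_mul]
      exact SetLike.mul_mem_graded ih (ha ⟨b, c, α⟩)
  have hproj : ∀ n x, ρ x = 0 → ρ (restrict (fun p => p.length = n) x) = 0 := by
    intro n x hx
    have h : GradedAlgebra.proj ℬ n ∘ₗ ρ.toLinearMap =
        ρ.toLinearMap ∘ₗ restrict (fun p => p.length = n) := by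
      apply linearMap_ext
      intro p
      simp only [LinearMap.comp_apply, AlgHom.toLinearMap_apply, restrict_ofPath]
      split_ifs with h
      · subst h
        exact gradedProj_of_mem ℬ (hmem p)
      · rw [map_zero]
        exact gradedProj_of_mem_ne ℬ (hmem p) h
    have h1 := LinearMap.congr_fun h x
    simp only [LinearMap.comp_apply, AlgHom.toLinearMap_apply, hx, map_zero] at h1
    exact h1.symm
  refine ⟨hmem, hs, fun x hx p hp => ?_⟩
  by_contra hlt
  obtain h0 | h1 : p.length = 0 ∨ p.length = 1 := by omega
  · have h := hproj 0 x hx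
    rw [restrict_length_zero, map_sum] at h
    simp only [map_smul] at h
    have h2 := Fintype.linearIndependent_iff.1 hv' _ h p.1
    rw [eq_vertex_of_length h0] at hp
    exact hp h2
  · have h := hproj 1 x hx
    rw [restrict_length_one, map_sum] at h
    simp only [map_smul] at h
    obtain ⟨α, rfl⟩ := exists_path_of_length h1
    exact hp (Fintype.linearIndependent_iff.1 ha' _ h α)

/-! ### Right multiplication on the augmentation ideal. -/

section RightMul

variable {k : Type u} [Field k] {A : Type v} [Ring A] [Algebra k A]
  {𝒜 : ℕ → Submodule k A} [GradedAlgebra 𝒜]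

variable (𝒜) in
/-- Right multiplication by an element of `A` on the augmentation ideal. -/
def augRightMul (y : A) : AugmentationIdeal 𝒜 →ₗ[A] AugmentationIdeal 𝒜 :=
  LinearMap.codRestrict _ (LinearMap.toSpanSingleton A A y ∘ₗ Submodule.subtype _)
    fun j => mul_mem_irrelevant j.2 y

theorem coe_augRightMul (y : A) (j : AugmentationIdeal 𝒜) :
    (augRightMul 𝒜 y j : A) = j * y := rfl

theorem augToYoneda_mul_endToYoneda_rightMul
    (g : AugmentationIdeal 𝒜 →ₗ[A] DegreeZeroModule 𝒜) (y : A) :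
    augToYoneda 𝒜 g * endToYoneda 𝒜 (rightMul 𝒜 y) = augToYoneda 𝒜 (g ∘ₗ augRightMul 𝒜 y) :=
  augToYoneda_mul_endToYoneda g _ (LinearMap.toSpanSingleton A A y) (augRightMul 𝒜 y)
    (fun _ => rfl) (fun _ => rfl)

theorem endToYoneda_rightMul_mul (y z : A) :
    endToYoneda 𝒜 (rightMul 𝒜 y) * endToYoneda 𝒜 (rightMul 𝒜 z) =
      endToYoneda 𝒜 (rightMul 𝒜 (z * y)) := by
  rw [endToYoneda_mul_endToYoneda, rightMul_comp]

end RightMul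

namespace IsGradedPresentation

variable {k : Type u} [Field k] {A : Type v} [Ring A] [Algebra k A]
  {𝒜 : ℕ → Submodule k A} [GradedAlgebra 𝒜]
  {V : Type} [Fintype V] [Quiver.{0} V] [∀ a b : V, Finite (a ⟶ b)]
  {ρ : PathAlgebra k V →ₐ[k] A} (hρ : IsGradedPresentation 𝒜 ρ)

/-- The presentation `Ψ` of the Yoneda algebra is dual to the presentation `ρ` of the algebra. -/
structure IsYonedaDual (Ψ : PathAlgebra k V →ₐ[k] YonedaAlgebra 𝒜) : Prop where
  vertex : ∀ a, Ψ (ofPath k (vertex a)) = endToYoneda 𝒜 (rightMul 𝒜 (e ρ a))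
  arrow : ∀ α : QuiverArrow V, Ψ (ofPath k α.path) = augToYoneda 𝒜 (hρ.arrowDual α)

theorem rightMul_comp_arrowDual (α : QuiverArrow V) :
    rightMul 𝒜 (e ρ α.src) ∘ₗ hρ.arrowDual α = hρ.arrowDual α := by
  classical
  apply LinearMap.ext
  intro j
  refine hρ.isVertexFrame.ext_coord fun a => ?_
  rw [LinearMap.comp_apply, IsVertexFrame.coord_rightMul, hρ.coord_arrowDual, hρ.vertexCoeff_e]
  split_ifs with h1 h2 h2
  · rw [mul_one]
  · exact absurd h1.symm h2
  · rw [zero_mul]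
  · rw [zero_mul]

theorem arrowDual_comp_augRightMul (α : QuiverArrow V) :
    hρ.arrowDual α ∘ₗ augRightMul 𝒜 (e ρ α.tgt) = hρ.arrowDual α := by
  classical
  apply LinearMap.ext
  intro j
  refine hρ.isVertexFrame.ext_coord fun a => ?_
  rw [LinearMap.comp_apply, hρ.coord_arrowDual, hρ.coord_arrowDual, coe_augRightMul,
    hρ.arrowCoeff_mul, hρ.arrowCoeff_e, mul_zero, zero_add, hρ.vertexCoeff_e, if_pos rfl, mul_one]

/-- The homomorphism from the path algebra to the Yoneda algebra dual to a presentation. -/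
theorem exists_isYonedaDual : ∃ Ψ : PathAlgebra k V →ₐ[k] YonedaAlgebra 𝒜, hρ.IsYonedaDual Ψ := by
  have he : ∀ a : V, endToYoneda 𝒜 (rightMul 𝒜 (e ρ a)) * endToYoneda 𝒜 (rightMul 𝒜 (e ρ a)) =
      endToYoneda 𝒜 (rightMul 𝒜 (e ρ a)) := fun a => by
    rw [endToYoneda_rightMul_mul, e_mul_self]
  have hne : ∀ a b : V, a ≠ b →
      endToYoneda 𝒜 (rightMul 𝒜 (e ρ a)) * endToYoneda 𝒜 (rightMul 𝒜 (e ρ b)) = 0 :=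
    fun a b h => by
      rw [endToYoneda_rightMul_mul, e_mul_of_ne ρ h.symm]
      exact (congrArg _ (map_zero (rightMulLin 𝒜))).trans (map_zero _)
  have hone : ∑ a : V, endToYoneda 𝒜 (rightMul 𝒜 (e ρ a)) = 1 := by
    rw [← map_sum, ← endToYoneda_id, ← rightMul_one, ← sum_e ρ]
    exact congrArg _ (map_sum (rightMulLin 𝒜) _ _).symm
  let X : ∀ a b : V, (a ⟶ b) → YonedaAlgebra 𝒜 := fun a b α =>
    augToYoneda 𝒜 (hρ.arrowDual ⟨a, b, α⟩)
  have hl : ∀ (a b : V) (α : a ⟶ b), endToYoneda 𝒜 (rightMul 𝒜 (e ρ a)) * X a b α = X a b α :=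
    fun a b α => by
      rw [endToYoneda_mul_augToYoneda]
      exact congrArg _ (hρ.rightMul_comp_arrowDual ⟨a, b, α⟩)
  have hr : ∀ (a b : V) (α : a ⟶ b), X a b α * endToYoneda 𝒜 (rightMul 𝒜 (e ρ b)) = X a b α :=
    fun a b α => by
      rw [augToYoneda_mul_endToYoneda_rightMul]
      exact congrArg _ (hρ.arrowDual_comp_augRightMul ⟨a, b, α⟩)
  exact ⟨PathAlgebra.lift he hne hone hr, lift_vertex he hne hone hr,
    fun α => lift_arrow he hne hone hl hr α.hom⟩

variable {hρ}

namespace IsYonedaDual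

variable (L : LinearResolution 𝒜) {Ψ : PathAlgebra k V →ₐ[k] YonedaAlgebra 𝒜}
  (h : hρ.IsYonedaDual Ψ)
include L h

/-- Independence of the dual arrows is seen by evaluating on the arrows of `A`. Surjectivity is the
generation of the Yoneda algebra in degrees zero and one. -/
theorem isGradedPresentation : IsGradedPresentation (ExtAlgebra.grading _ k) Ψ := by
  classical
  refine isGradedPresentation_of_linearIndependent (fun a => ?_) (fun α => ?_) ?_ ?_ ?_
  · rw [h.vertex, ← range_endToYoneda]
    exact ⟨_, rfl⟩
  · rw [h.arrow, ← range_augToYoneda]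
    exact ⟨_, rfl⟩
  · rw [Fintype.linearIndependent_iff]
    intro c hc a
    simp only [h.vertex, ← map_smul, ← map_sum] at hc
    have h1 := endToYoneda_injective (hc.trans (map_zero _).symm)
    have h2 : rightMul 𝒜 (∑ a, c a • e ρ a) = 0 := by
      rw [← h1]
      change rightMulLin 𝒜 _ = _
      rw [map_sum]
      exact Finset.sum_congr rfl fun a _ => map_smul (rightMulLin 𝒜) (c a) (e ρ a)
    have h3 := rightMul_injective
      (Submodule.sum_mem _ fun a _ => Submodule.smul_mem _ _ (hρ.e_mem a)) h2
    have h4 := congrArg (hρ.vertexCoeff a) h3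
    simpa [hρ.vertexCoeff_e] using h4
  · rw [Fintype.linearIndependent_iff]
    intro c hc α
    simp only [h.arrow, ← map_smul, ← map_sum] at hc
    have h1 := augToYoneda_injective (hc.trans (map_zero _).symm)
    have h2 := congrArg hρ.isVertexFrame.trace
      (LinearMap.congr_fun h1 ⟨x ρ α, hρ.x_mem_irrelevant α⟩)
    rw [LinearMap.sum_apply, map_sum, LinearMap.zero_apply, map_zero,
      Finset.sum_eq_single α] at h2
    · rw [LinearMap.smul_apply, map_smul, hρ.trace_arrowDual, hρ.arrowCoeff_x, if_pos rfl,
        smul_eq_mul, mul_one] at h2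
      exact h2
    · intro β _ hβ
      rw [LinearMap.smul_apply, map_smul, hρ.trace_arrowDual, hρ.arrowCoeff_x, if_neg hβ.symm,
        smul_zero]
    · simp
  · have key : ∀ n, ExtAlgebra.grading _ k n ≤ LinearMap.range Ψ.toLinearMap := by
      intro n
      induction n with
      | zero =>
        rw [← range_endToYoneda]
        rintro _ ⟨f, rfl⟩
        obtain ⟨y, hy, rfl⟩ := exists_eq_rightMul f
        refine ⟨∑ a, hρ.vertexCoeff a y • ofPath k (PathAlgebra.vertex a), ?_⟩
        rw [AlgHom.toLinearMap_apply, map_sum]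
        simp only [map_smul, h.vertex]
        rw [hρ.isVertexFrame.eq_sum hy]
        change _ = endToYoneda 𝒜 (rightMulLin 𝒜 _)
        rw [map_sum, map_sum, ← hρ.isVertexFrame.eq_sum hy]
        refine Finset.sum_congr rfl fun a _ => ?_
        rw [map_smul, map_smul]
        rfl
      | succ n ih =>
        rw [← L.range_toYoneda]
        rintro _ ⟨g, rfl⟩
        obtain ⟨f, hf⟩ := L.exists_eq_sum_arrowDual_mul hρ g
        have hf' : ∀ α, ∃ w, Ψ w = L.toYoneda n (f α) := fun α =>
          ih (by rw [← L.range_toYoneda]; exact ⟨_, rfl⟩)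
        choose w hw using hf'
        refine ⟨∑ α, ofPath k α.path * w α, ?_⟩
        rw [AlgHom.toLinearMap_apply, map_sum, hf]
        simp only [map_mul, h.arrow, hw]
    intro y
    obtain ⟨N, hN⟩ := eq_sum_gradedProj (ExtAlgebra.grading _ k) y
    have : y ∈ LinearMap.range Ψ.toLinearMap := by
      rw [hN]
      exact Submodule.sum_mem _ fun n _ => key n (gradedProj_mem _ n y)
    exact this

end IsYonedaDual

/-- The quadratic element of the path algebra given by a linear form on `A`. -/
def quadraticDual (ρ : PathAlgebra k V →ₐ[k] A) (φ : A →ₗ[k] k) : PathAlgebra k V :=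
  ∑ α, ∑ β, φ (x ρ α * x ρ β) • (ofPath k α.path * ofPath k β.path)

namespace IsYonedaDual

variable (L : LinearResolution 𝒜) {Ψ : PathAlgebra k V →ₐ[k] YonedaAlgebra 𝒜}
  (h : hρ.IsYonedaDual Ψ)
include L h

theorem apply_quadraticDual (φ : A →ₗ[k] k) : Ψ (quadraticDual ρ φ) = 0 := by
  rw [quadraticDual, ← L.sum_arrowDual_mul_arrowDual hρ φ]
  simp only [map_sum, map_smul, map_mul, h.arrow]

/-- Induction on the length, splitting off the first arrow. By `exists_of_sum_arrowDual_mul_eq_zero`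
the remaining factors agree, up to shorter relations, with those that come from quadratic duals of
the coordinate forms of a basis of `A`. -/
theorem ker_le_span_quadraticDual [Module.Finite k A] :
    TwoSidedIdeal.ker Ψ ≤ TwoSidedIdeal.span (Set.range (quadraticDual ρ)) := by
  have hΨ := h.isGradedPresentation L
  let u := Module.finBasis k A
  refine hΨ.ker_le_of_forall_length fun n => ?_
  induction n with
  | zero =>
    intro w hw h
    rw [hΨ.eq_zero_of_length_lt (by omega) hw h]
    exact zero_mem _
  | succ n ih =>
    intro w hw hw0
    cases n with
    | zero =>
      rw [hΨ.eq_zero_of_length_lt (by omega) hw hw0]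
      exact zero_mem _
    | succ n =>
      obtain ⟨w', hw1, hw'⟩ := exists_eq_sum_path_mul (n + 1) w
      rw [hw] at hw1
      have hf : ∀ α, ∃ f, L.toYoneda (n + 1) f = Ψ (w' α) := fun α => by
        have := hΨ.apply_mem (hw' α).1
        rw [← L.range_toYoneda] at this
        exact this
      choose f hf using hf
      have hfe : ∀ α : QuiverArrow V, rightMul 𝒜 (e ρ α.tgt) ∘ₗ f α = f α := by
        intro α
        apply L.toYoneda_injective (n + 1)
        rw [← L.endToYoneda_mul_toYoneda, hf, ← h.vertex, ← map_mul, (hw' α).2]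
      obtain ⟨g, hg⟩ := L.exists_of_sum_arrowDual_mul_eq_zero hρ u f hfe (by
        simp only [hf, ← h.arrow, ← map_mul, ← map_sum]
        rw [← hw1, hw0])
      have hv : ∀ s, ∃ v, Ψ (restrict (fun p => p.length = n) v) = L.toYoneda n (g s) := fun s =>
        hΨ.exists_of_mem (by rw [← L.range_toYoneda]; exact ⟨_, rfl⟩)
      choose v hv using hv
      let v' := fun s => restrict (fun p => p.length = n) (v s)
      have hv' : ∀ s, restrict (fun p => p.length = n) (v' s) = v' s := fun s =>
        restrict_self_restrict _ _
      let w'' : QuiverArrow V → PathAlgebra k V := fun α =>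
        ∑ β, ∑ s, u.repr (x ρ α * x ρ β) s • (ofPath k β.path * v' s)
      have hmem : ∀ α, w' α - w'' α ∈ TwoSidedIdeal.span (Set.range (quadraticDual ρ)) := by
        intro α
        apply ih
        · rw [map_sub, (hw' α).1]
          congr 1
          simp only [w'', map_sum, map_smul]
          refine Finset.sum_congr rfl fun β _ => Finset.sum_congr rfl fun s _ => ?_
          rw [restrict_length_mul (add_comm 1 n) (restrict_length_path β) (hv' s)]
        · rw [map_sub, ← hf, hg, sub_eq_zero]
          simp only [w'', map_sum, map_smul, map_mul, h.arrow]
          refine Finset.sum_congr rfl fun β _ => Finset.sum_congr rfl fun s _ => ?_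
          rw [hv]
      have hfin : w = ∑ α, ofPath k α.path * (w' α - w'' α) +
          ∑ s, quadraticDual ρ (u.coord s) * v' s := by
        have h1 : ∑ s, quadraticDual ρ (u.coord s) * v' s = ∑ α, ofPath k α.path * w'' α := by
          simp only [w'', quadraticDual, Finset.mul_sum, Finset.sum_mul]
          rw [Finset.sum_comm]
          refine Finset.sum_congr rfl fun α _ => ?_
          rw [Finset.sum_comm]
          refine Finset.sum_congr rfl fun β _ => Finset.sum_congr rfl fun s _ => ?_
          rw [mul_smul_comm, smul_mul_assoc, mul_assoc]
          rfl
        rw [h1, ← Finset.sum_add_distrib, hw1]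
        refine Finset.sum_congr rfl fun α _ => ?_
        rw [mul_sub, sub_add_cancel]
      rw [hfin]
      exact add_mem (sum_mem fun α _ => TwoSidedIdeal.mul_mem_left _ _ _ (hmem α))
        (sum_mem fun s _ => TwoSidedIdeal.mul_mem_right _ _ _
          (TwoSidedIdeal.subset_span ⟨_, rfl⟩))

/-- Degrees pass from the algebra to the Yoneda algebra. -/
theorem isHomogeneous [Module.Finite k A] (Γ : PathDegree V)
    (hΓ : Γ.IsHomogeneous (TwoSidedIdeal.ker ρ)) : Γ.IsHomogeneous (TwoSidedIdeal.ker Ψ) := by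
  refine Γ.isHomogeneous_of_le_span (h.ker_le_span_quadraticDual L) ?_
  rintro _ ⟨φ, rfl⟩ t
  -- Homogeneity of the kernel of `ρ` makes `φ ∘ ρ ∘ component` factor through `ρ`. The resulting
  -- form `φ'` has as quadratic dual the component of that of `φ`, so the components of the
  -- generators are again generators.
  obtain ⟨φ', hφ'⟩ := LinearMap.exists_factor_of_surjective ρ.toLinearMap hρ.surjective
    (φ ∘ₗ ρ.toLinearMap ∘ₗ Γ.component t) (fun w hw => by
      have := hΓ w ((TwoSidedIdeal.mem_ker ρ).2 hw) t
      rw [TwoSidedIdeal.mem_ker] at this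
      simp only [LinearMap.comp_apply, AlgHom.toLinearMap_apply, this, map_zero])
  have h1 : Γ.component t (quadraticDual ρ φ) = quadraticDual ρ φ' := by
    simp only [quadraticDual, map_sum, map_smul]
    refine Finset.sum_congr rfl fun α _ => Finset.sum_congr rfl fun β _ => ?_
    have h2 := hφ' (ofPath k α.path * ofPath k β.path)
    obtain ⟨c, hc⟩ := Γ.exists_component_eq_smul k t α.path β.path
    simp only [LinearMap.comp_apply, AlgHom.toLinearMap_apply, hc, map_smul, map_mul] at h2
    rw [h2, hc, smul_smul, smul_eq_mul, mul_comm]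
  rw [h1, TwoSidedIdeal.mem_ker, h.apply_quadraticDual L]

/-- Degrees pass from the Yoneda algebra to the algebra. -/
theorem isHomogeneous_of_dual (hb : ∃ N, ∀ n, N ≤ n → 𝒜 n = ⊥) (Γ : PathDegree V)
    (hΓ : Γ.IsHomogeneous (TwoSidedIdeal.ker Ψ)) : Γ.IsHomogeneous (TwoSidedIdeal.ker ρ) := by
  refine Γ.isHomogeneous_of_le_span (L.ker_le_span_quadratic hb hρ) ?_
  rintro w ⟨hw0, hw⟩ t
  obtain ⟨w', hw1, hw'⟩ := exists_eq_sum_path_mul 1 w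
  have hw2 : w = ∑ α : QuiverArrow V, ∑ β : QuiverArrow V,
      coeff β.path (w' α) • (ofPath k α.path * ofPath k β.path) := by
    rw [← hw]
    refine hw1.trans (Finset.sum_congr rfl fun α _ => ?_)
    rw [← (hw' α).1, restrict_length_one, Finset.mul_sum]
    refine Finset.sum_congr rfl fun β _ => ?_
    rw [← restrict_length_one, (hw' α).1, mul_smul_comm]
  choose c hc using fun α β : QuiverArrow V =>
    Γ.exists_component_eq_smul k t α.path β.path
  rw [TwoSidedIdeal.mem_ker, ← Module.forall_dual_apply_eq_zero_iff k]
  intro φ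
  -- The form `φ` tests the component of `w`. The class selection `c` is moved from `w` to the dual
  -- element of `φ`: its component is a relation of the Yoneda algebra, hence orthogonal to `w`.
  have h1 := L.sum_mul_eq_zero hρ (fun α β => φ (x ρ α * x ρ β) * c α β)
    (fun α β => coeff β.path (w' α)) (fun α β hαβ => by
      rw [← map_mul, mul_of_ne (by exact hαβ), map_zero, map_zero, zero_mul]) (by
      have h2 := hΓ _ ((TwoSidedIdeal.mem_ker Ψ).2 (h.apply_quadraticDual L φ)) t
      rw [TwoSidedIdeal.mem_ker] at h2
      rw [← h2]
      simp only [quadraticDual, map_sum, map_smul, hc, map_mul, h.arrow, mul_smul]) (by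
      rw [← hw0]
      conv_rhs => rw [hw2]
      simp only [map_sum, map_smul, map_mul])
  rw [← h1, hw2]
  simp only [map_sum, map_smul, hc, map_mul, smul_eq_mul]
  refine Finset.sum_congr rfl fun α _ => Finset.sum_congr rfl fun β _ => ?_
  ring

end IsYonedaDual

end IsGradedPresentation

/-! ### Presentations of the Yoneda algebra are dual to presentations of the algebra -/

section Predual

open IsGradedPresentation

variable {k : Type u} [Field k] {A : Type v} [Ring A] [Algebra k A]
  {𝒜 : ℕ → Submodule k A} [GradedAlgebra 𝒜]

namespace IsVertexFrame

variable {V : Type} [Fintype V] {e : V → A} {c : V → A →ₗ[k] k} (h : IsVertexFrame 𝒜 e c)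

theorem dual_apply (ψ : A →ₗ[k] k) (j : AugmentationIdeal 𝒜) :
    h.dual ψ j = ∑ a, ψ (e a * GradedAlgebra.proj 𝒜 1 (j : A)) • classZero 𝒜 (e a) := rfl

include h

theorem e_mul_self (a : V) : e a * e a = e a := by
  rw [h.e_mul a (h.e_mem a), h.coeff_self, one_smul]

theorem e_mul_of_ne {a b : V} (hab : a ≠ b) : e a * e b = 0 := by
  rw [h.e_mul a (h.e_mem b), h.coeff_ne a b hab, zero_smul]

theorem dual_congr {ψ ψ' : A →ₗ[k] k} (hψ : ∀ y ∈ 𝒜 1, ψ y = ψ' y) : h.dual ψ = h.dual ψ' := by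
  apply LinearMap.ext
  intro j
  rw [h.dual_apply, h.dual_apply]
  refine Finset.sum_congr rfl fun a _ => ?_
  rw [hψ _ (by simpa using SetLike.mul_mem_graded (h.e_mem a) (gradedProj_mem 𝒜 1 (j : A)))]

/-- The linear form of a homomorphism from the augmentation ideal. -/
theorem exists_form (g : AugmentationIdeal 𝒜 →ₗ[A] DegreeZeroModule 𝒜) :
    ∃ ψ : A →ₗ[k] k, ∀ (y : A) (hy : y ∈ 𝒜 1),
      ψ y = h.trace (g ⟨y, mem_irrelevant_of_mem (n := 0) hy⟩) := by
  let p : A →ₗ[k] AugmentationIdeal 𝒜 :=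
    { toFun y := ⟨GradedAlgebra.proj 𝒜 1 y, mem_irrelevant_of_mem (n := 0) (gradedProj_mem 𝒜 1 y)⟩
      map_add' y z := Subtype.ext (map_add _ y z)
      map_smul' b y := Subtype.ext (map_smul _ b y) }
  refine ⟨h.trace ∘ₗ g.restrictScalars k ∘ₗ p, fun y hy => ?_⟩
  have : p y = ⟨y, mem_irrelevant_of_mem (n := 0) hy⟩ := Subtype.ext (gradedProj_of_mem 𝒜 hy)
  rw [LinearMap.comp_apply, LinearMap.comp_apply, this]
  rfl

/-- Homomorphisms from the augmentation ideal are determined on arrows, and the coordinate at `a` is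
recovered as the trace after multiplying by `e a`. -/
theorem eq_dual {V₀ : Type} [Fintype V₀] [Quiver.{0} V₀] [∀ a b : V₀, Finite (a ⟶ b)]
    {ρ₀ : PathAlgebra k V₀ →ₐ[k] A} (hρ₀ : IsGradedPresentation 𝒜 ρ₀)
    {g : AugmentationIdeal 𝒜 →ₗ[A] DegreeZeroModule 𝒜} {ψ : A →ₗ[k] k}
    (hψ : ∀ (y : A) (hy : y ∈ 𝒜 1), ψ y = h.trace (g ⟨y, mem_irrelevant_of_mem (n := 0) hy⟩)) :
    g = h.dual ψ := by
  refine hρ₀.augmentationHom_ext fun γ => h.ext_coord fun a => ?_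
  have hmem : e a * x ρ₀ γ ∈ 𝒜 1 := by
    simpa using SetLike.mul_mem_graded (h.e_mem a) (hρ₀.x_mem γ)
  rw [h.coord_dual, gradedProj_of_mem 𝒜 (hρ₀.x_mem γ), hψ _ hmem, ← h.trace_e_smul, ← map_smul]
  rfl

/-- The assignment of a homomorphism to a linear form, as a linear map. -/
def dualLin : (A →ₗ[k] k) →ₗ[k] AugmentationIdeal 𝒜 →ₗ[A] DegreeZeroModule 𝒜 where
  toFun := h.dual
  map_add' ψ ψ' := by
    apply LinearMap.ext
    intro j
    simp only [LinearMap.add_apply, h.dual_apply, add_smul, Finset.sum_add_distrib]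
  map_smul' b ψ := by
    apply LinearMap.ext
    intro j
    simp only [LinearMap.smul_apply, h.dual_apply, smul_assoc, Finset.smul_sum, RingHom.id_apply]

theorem dual_comp_mulLeft (ψ : A →ₗ[k] k) (a : V) :
    h.dual (ψ ∘ₗ LinearMap.mulLeft k (e a)) = rightMul 𝒜 (e a) ∘ₗ h.dual ψ := by
  apply LinearMap.ext
  intro j
  refine h.ext_coord fun b => ?_
  rw [LinearMap.comp_apply, h.coord_rightMul, h.coord_dual, h.coord_dual, LinearMap.comp_apply,
    LinearMap.mulLeft_apply, ← mul_assoc]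
  by_cases hb : b = a
  · subst hb
    rw [h.e_mul_self, h.coeff_self, mul_one]
  · rw [h.e_mul_of_ne (Ne.symm hb), h.coeff_ne b a hb, zero_mul, map_zero, mul_zero]

theorem dual_comp_mulRight (ψ : A →ₗ[k] k) (a : V) :
    h.dual (ψ ∘ₗ LinearMap.mulRight k (e a)) = h.dual ψ ∘ₗ augRightMul 𝒜 (e a) := by
  apply LinearMap.ext
  intro j
  refine h.ext_coord fun b => ?_
  have h1 : GradedAlgebra.proj 𝒜 1 ((j : A) * e a) = GradedAlgebra.proj 𝒜 1 (j : A) * e a := by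
    have hj : (j : A) ∈ gradedTail 𝒜 1 := by
      rw [mem_gradedTail]
      intro i hi
      obtain rfl : i = 0 := by omega
      exact mem_irrelevant_toIdeal_iff.1 j.2
    have h2 := gradedProj_mul_of_mem_gradedTail 𝒜 (m := 0) (y := e a) hj
      (by rw [mem_gradedTail]; intro i hi; omega)
    rwa [add_zero, gradedProj_of_mem 𝒜 (h.e_mem a)] at h2
  rw [LinearMap.comp_apply, h.coord_dual, h.coord_dual, LinearMap.comp_apply,
    LinearMap.mulRight_apply, coe_augRightMul, h1, mul_assoc]

end IsVertexFrame

variable {V : Type} [Fintype V] [Quiver.{0} V] [∀ a b : V, Finite (a ⟶ b)]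
  {Ψ : PathAlgebra k V →ₐ[k] YonedaAlgebra 𝒜}
  (hΨ : IsGradedPresentation (ExtAlgebra.grading _ k) Ψ)
include hΨ

omit [∀ a b : V, Finite (a ⟶ b)] in
/-- The vertices of a presentation of the Yoneda algebra give idempotents of the algebra. -/
theorem exists_isVertexFrame_of_yoneda : ∃ (e : V → A) (c : V → A →ₗ[k] k),
    IsVertexFrame 𝒜 e c ∧
      ∀ a, Ψ (ofPath k (vertex a)) = endToYoneda 𝒜 (rightMul 𝒜 (e a)) := by
  have he : ∀ a, ∃ y ∈ 𝒜 0, Ψ (ofPath k (vertex a)) = endToYoneda 𝒜 (rightMul 𝒜 y) := by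
    intro a
    have h1 := hΨ.e_mem a
    rw [← range_endToYoneda] at h1
    obtain ⟨f, hf⟩ := h1
    obtain ⟨y, hy, rfl⟩ := exists_eq_rightMul f
    exact ⟨y, hy, hf.symm⟩
  choose e hemem he using he
  -- `R` restricts to a bijection from `𝒜 0` onto the degree-zero part of the Yoneda algebra, and
  -- carries the coordinate forms back. It reverses products, which is harmless since the forms are
  -- multiplicative with values in `k`.
  let R : A →ₗ[k] YonedaAlgebra 𝒜 := endToYoneda 𝒜 ∘ₗ rightMulLin 𝒜
  have hR : ∀ y, R y = endToYoneda 𝒜 (rightMul 𝒜 y) := fun y => rfl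
  have hRinj : ∀ y ∈ 𝒜 0, R y = 0 → y = 0 := fun y hy h =>
    rightMul_injective hy (endToYoneda_injective (h.trans (map_zero _).symm))
  have hRproj : ∀ y, R (GradedAlgebra.proj 𝒜 0 y) = R y := by
    intro y
    rw [hR, hR]
    congr 1
    apply semisimpleHom_ext
    rw [rightMul_classZero, rightMul_classZero, one_mul, one_mul, classZero_gradedProj]
  refine ⟨e, fun a => hΨ.vertexCoeff a ∘ₗ R, ⟨fun y => ?_, fun a => ?_, fun a b hab => ?_,
    fun a y z => ?_⟩, he⟩
  · refine sub_eq_zero.1 (hRinj _ (Submodule.sub_mem _ (gradedProj_mem 𝒜 0 y)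
      (Submodule.sum_mem _ fun a _ => Submodule.smul_mem _ _ (hemem a))) ?_)
    have h1 : R y ∈ ExtAlgebra.grading _ k 0 := by
      rw [← range_endToYoneda]
      exact ⟨_, rfl⟩
    rw [map_sub, hRproj, map_sum, sub_eq_zero]
    refine (hΨ.isVertexFrame.eq_sum h1).trans (Finset.sum_congr rfl fun a _ => ?_)
    rw [map_smul, hR (e a), ← he]
    rfl
  · rw [LinearMap.comp_apply, hR, ← he]
    exact hΨ.isVertexFrame.coeff_self a
  · rw [LinearMap.comp_apply, hR, ← he]
    exact hΨ.isVertexFrame.coeff_ne a b hab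
  · simp only [LinearMap.comp_apply]
    rw [hR (y * z), ← endToYoneda_rightMul_mul, hΨ.vertexCoeff_mul, mul_comm]
    rfl

/-- Every graded presentation of the Yoneda algebra is dual to one of the algebra. -/
theorem exists_isYonedaDual_of_yoneda [Module.Finite k A] {V₀ : Type} [Fintype V₀]
    [Quiver.{0} V₀] [∀ a b : V₀, Finite (a ⟶ b)] {ρ₀ : PathAlgebra k V₀ →ₐ[k] A}
    (hρ₀ : IsGradedPresentation 𝒜 ρ₀) :
    ∃ (ρ : PathAlgebra k V →ₐ[k] A) (hρ : IsGradedPresentation 𝒜 ρ), hρ.IsYonedaDual Ψ := by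
  classical
  obtain ⟨e', c, hf, he⟩ := exists_isVertexFrame_of_yoneda hΨ
  have hsep : ∀ y z : A, (∀ ψ : A →ₗ[k] k, ψ y = ψ z) → y = z := fun y z hyz => by
    rw [← sub_eq_zero, ← Module.forall_dual_apply_eq_zero_iff k]
    intro ψ
    rw [map_sub, hyz, sub_self]
  -- The arrows of `Ψ` form a basis of Ext¹, the dual of `𝒜 1`. The arrows of `A` are to be the dual
  -- basis; they exist because `A` is finite dimensional, hence reflexive.
  have hx : ∀ β : QuiverArrow V, ∃ y : A, ∀ ψ : A →ₗ[k] k,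
      ψ y = hΨ.arrowCoeff β (augToYoneda 𝒜 (hf.dual ψ)) := by
    intro β
    obtain ⟨y, hy⟩ := (Module.evalEquiv k A).surjective
      (hΨ.arrowCoeff β ∘ₗ augToYoneda 𝒜 ∘ₗ hf.dualLin)
    exact ⟨y, fun ψ => LinearMap.congr_fun hy ψ⟩
  choose x' hx' using hx
  have hxmem : ∀ β, x' β ∈ 𝒜 1 := by
    intro β
    have : GradedAlgebra.proj 𝒜 1 (x' β) = x' β := by
      refine hsep _ _ fun ψ => ?_
      have h1 := hx' β (ψ ∘ₗ GradedAlgebra.proj 𝒜 1)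
      rw [LinearMap.comp_apply] at h1
      rw [h1, hx', hf.dual_congr (ψ' := ψ) fun y hy => ?_]
      rw [LinearMap.comp_apply, gradedProj_of_mem 𝒜 hy]
    rw [← this]
    exact gradedProj_mem 𝒜 1 _
  have hl : ∀ β : QuiverArrow V, e' β.src * x' β = x' β := by
    intro β
    refine hsep _ _ fun ψ => ?_
    have h1 := hx' β (ψ ∘ₗ LinearMap.mulLeft k (e' β.src))
    rw [LinearMap.comp_apply, LinearMap.mulLeft_apply, hf.dual_comp_mulLeft,
      ← endToYoneda_mul_augToYoneda, ← he, hΨ.arrowCoeff_mul, hΨ.vertexCoeff_e, if_pos rfl,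
      hΨ.arrowCoeff_e, one_mul, zero_mul, add_zero] at h1
    rw [h1, hx']
  have hr : ∀ β : QuiverArrow V, x' β * e' β.tgt = x' β := by
    intro β
    refine hsep _ _ fun ψ => ?_
    have h1 := hx' β (ψ ∘ₗ LinearMap.mulRight k (e' β.tgt))
    rw [LinearMap.comp_apply, LinearMap.mulRight_apply, hf.dual_comp_mulRight,
      ← augToYoneda_mul_endToYoneda_rightMul, ← he, hΨ.arrowCoeff_mul, hΨ.vertexCoeff_e,
      if_pos rfl, hΨ.arrowCoeff_e, mul_one, mul_zero, zero_add] at h1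
    rw [h1, hx']
  have hg : ∀ α : QuiverArrow V, ∃ g, augToYoneda 𝒜 g = Ψ (ofPath k α.path) := fun α => by
    have h1 := hΨ.x_mem α
    rw [← range_augToYoneda] at h1
    exact h1
  choose g hg using hg
  choose ψ hψ using fun α => hf.exists_form (g α)
  have hgψ : ∀ α, g α = hf.dual (ψ α) := fun α => hf.eq_dual hρ₀ (hψ α)
  have hψx : ∀ α β, ψ α (x' β) = if α = β then 1 else 0 := by
    intro α β
    rw [hx', ← hgψ, hg, hΨ.arrowCoeff_x]
  -- Expanding an arbitrary form in the basis of Ext¹ given by the arrows of `Ψ` and evaluating at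
  -- `y` gives the dual expansion of `y`.
  have hspan : ∀ y ∈ 𝒜 1, y = ∑ α, ψ α y • x' α := by
    intro y hy
    refine hsep _ _ fun φ => ?_
    have h1 : hf.dual φ = ∑ α, φ (x' α) • g α := by
      apply augToYoneda_injective
      have h2 : augToYoneda 𝒜 (hf.dual φ) ∈ ExtAlgebra.grading _ k 1 := by
        rw [← range_augToYoneda]
        exact ⟨_, rfl⟩
      rw [← gradedProj_of_mem _ h2, hΨ.gradedProj_one, map_sum]
      refine Finset.sum_congr rfl fun α _ => ?_
      rw [map_smul, hg, hx']
    have h3 := congrArg hf.trace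
      (LinearMap.congr_fun h1 ⟨y, mem_irrelevant_of_mem (n := 0) hy⟩)
    rw [hf.trace_dual, gradedProj_of_mem 𝒜 hy, LinearMap.sum_apply, map_sum] at h3
    rw [h3, map_sum]
    refine Finset.sum_congr rfl fun α _ => ?_
    rw [LinearMap.smul_apply, map_smul, map_smul, ← hψ α y hy, smul_eq_mul, smul_eq_mul, mul_comm]
  let X : ∀ a b : V, (a ⟶ b) → A := fun a b α => x' ⟨a, b, α⟩
  have hlX : ∀ (a b : V) (α : a ⟶ b), e' a * X a b α = X a b α := fun a b α => hl ⟨a, b, α⟩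
  have hrX : ∀ (a b : V) (α : a ⟶ b), X a b α * e' b = X a b α := fun a b α => hr ⟨a, b, α⟩
  let ρ : PathAlgebra k V →ₐ[k] A :=
    PathAlgebra.lift hf.e_mul_self (fun a b h => hf.e_mul_of_ne h) hf.sum_e hrX
  have hρe : ∀ a, ρ (ofPath k (vertex a)) = e' a :=
    lift_vertex hf.e_mul_self (fun a b h => hf.e_mul_of_ne h) hf.sum_e hrX
  have hρx : ∀ α : QuiverArrow V, ρ (ofPath k α.path) = x' α := fun α =>
    lift_arrow hf.e_mul_self (fun a b h => hf.e_mul_of_ne h) hf.sum_e hlX hrX α.hom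
  have hρ : IsGradedPresentation 𝒜 ρ := by
    refine isGradedPresentation_of_linearIndependent (fun a => ?_) (fun α => ?_) ?_ ?_ ?_
    · rw [hρe]
      exact hf.e_mem a
    · rw [hρx]
      exact hxmem α
    · rw [Fintype.linearIndependent_iff]
      intro b hb a
      simp only [hρe] at hb
      have h1 := congrArg (c a) hb
      rw [map_sum, map_zero, Finset.sum_eq_single a] at h1
      · rwa [map_smul, hf.coeff_self, smul_eq_mul, mul_one] at h1
      · intro a' _ ha'
        rw [map_smul, hf.coeff_ne a a' ha'.symm, smul_zero]
      · simp
    · rw [Fintype.linearIndependent_iff]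
      intro b hb α
      simp only [hρx] at hb
      have h1 := congrArg (ψ α) hb
      simpa [hψx] using h1
    -- The auxiliary presentation `ρ₀` shows that `A` is generated in degrees zero and one, where
    -- surjectivity is already known.
    · have key : ∀ n, ∀ y ∈ 𝒜 n, y ∈ ρ.range := by
        intro n
        have h0 : ∀ y ∈ 𝒜 0, y ∈ ρ.range := by
          intro y hy
          rw [hf.eq_sum hy]
          have h2 : ∀ a, e' a ∈ ρ.range := fun a => ⟨_, hρe a⟩
          exact sum_mem fun a _ => Subalgebra.smul_mem _ (h2 a) _
        have h1 : ∀ y ∈ 𝒜 1, y ∈ ρ.range := by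
          intro y hy
          rw [hspan y hy]
          have h2 : ∀ α, x' α ∈ ρ.range := fun α => ⟨_, hρx α⟩
          exact sum_mem fun α _ => Subalgebra.smul_mem _ (h2 α) _
        induction n with
        | zero => exact h0
        | succ n ih =>
          intro y hy
          obtain ⟨y', rfl, hy'⟩ := hρ₀.exists_eq_sum_mul_x hy
          exact sum_mem fun α _ => mul_mem (ih _ (hy' α)) (h1 _ (hρ₀.x_mem α))
      intro y
      obtain ⟨N, hN⟩ := eq_sum_gradedProj 𝒜 y
      have : y ∈ ρ.range := by
        rw [hN]
        exact sum_mem fun n _ => key n _ (gradedProj_mem 𝒜 n y)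
      exact this
  refine ⟨ρ, hρ, fun a => ?_, fun α => ?_⟩
  · rw [he]
    exact congrArg (fun y => endToYoneda 𝒜 (rightMul 𝒜 y)) (hρe a).symm
  · rw [← hg, hgψ, hf.dual_congr (ψ' := hρ.arrowCoeff α) fun y hy => ?_]
    · congr 1
      apply LinearMap.ext
      intro j
      rw [IsGradedPresentation.arrowDual, hf.dual_apply, IsVertexFrame.dual_apply]
      refine Finset.sum_congr rfl fun a _ => ?_
      rw [← hρe]
    · have h1 : ∀ β, hρ.arrowCoeff α (x' β) = if α = β then 1 else 0 := by
        intro β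
        rw [← hρx, hρ.arrowCoeff_x]
        simp only [eq_comm]
      rw [hspan y hy, map_sum, map_sum]
      simp only [map_smul, h1, hψx]

end Predual

/-! ### The main theorem -/

section Main

variable {k : Type u} [Field k] {A : Type v} [Ring A] [Algebra k A]
  {𝒜 : ℕ → Submodule k A} [GradedAlgebra 𝒜]

omit [GradedAlgebra 𝒜] in
theorem IsGradedQuiverAlgebra.exists_isGradedPresentation (hA : IsGradedQuiverAlgebra 𝒜) :
    ∃ (V : Type) (_ : Fintype V) (_ : Quiver.{0} V) (_ : ∀ a b : V, Finite (a ⟶ b))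
      (ρ : PathAlgebra k V →ₐ[k] A), IsGradedPresentation 𝒜 ρ := by
  obtain ⟨V, i1, i2, i3, I, -, hI, e, he⟩ := hA
  refine ⟨V, i1, i2, i3, e.toAlgHom.comp (RingCon.mkₐ k I.ringCon), fun p => ?_, ?_, ?_⟩
  · rw [he]
    exact Submodule.subset_span ⟨p, rfl, rfl⟩
  · exact e.surjective.comp (RingCon.mk'_surjective _)
  · intro x hx p hp
    refine hI x ?_ p ((mem_support_iff x p).2 hp)
    have h1 : e (RingCon.mkₐ k I.ringCon x) = 0 := hx
    rw [map_eq_zero_iff e e.injective] at h1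
    exact (TwoSidedIdeal.mem_iff I x).2 ((RingCon.eq I.ringCon).1 h1)

variable [Module.Finite k A] (hA : IsGradedQuiverAlgebra 𝒜) (hKoszul : IsKoszulAlgebra 𝒜)
  (hgl : HasFiniteGlobalDimension A)
  {V : Type} [Fintype V] [Quiver.{0} V] [∀ a b : V, Finite (a ⟶ b)]
include hA hKoszul hgl

/-- Every presentation of the algebra has a companion presentation of the Yoneda algebra. -/
theorem exists_isPresentation_yoneda {I : TwoSidedIdeal (PathAlgebra k V)}
    (hI : IsPresentation I A) : ∃ K : TwoSidedIdeal (PathAlgebra k V),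
      IsPresentation K (YonedaAlgebra 𝒜) ∧ (homotopyDegree I).IsHomogeneous K := by
  obtain ⟨V₀, _, _, _, ρ₀, hρ₀⟩ := hA.exists_isGradedPresentation
  obtain ⟨L⟩ := hKoszul
  obtain ⟨ρ, hρ, hΓ⟩ := exists_isGradedPresentation hρ₀ hI
  obtain ⟨Ψ, hΨ⟩ := hρ.exists_isYonedaDual
  exact ⟨TwoSidedIdeal.ker Ψ,
    (hΨ.isGradedPresentation L).isPresentation _ (exists_grading_eq_bot hgl),
    hΨ.isHomogeneous L _ (hΓ _ (isHomogeneous_homotopyDegree I))⟩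

omit hgl in
/-- Every presentation of the Yoneda algebra has a companion presentation of the algebra. -/
theorem exists_isPresentation_of_yoneda {K : TwoSidedIdeal (PathAlgebra k V)}
    (hK : IsPresentation K (YonedaAlgebra 𝒜)) : ∃ I : TwoSidedIdeal (PathAlgebra k V),
      IsPresentation I A ∧ (homotopyDegree K).IsHomogeneous I := by
  obtain ⟨V₀, _, _, _, ρ₀, hρ₀⟩ := hA.exists_isGradedPresentation
  obtain ⟨L⟩ := hKoszul
  obtain ⟨Ψ₀, hΨ₀⟩ := hρ₀.exists_isYonedaDual
  obtain ⟨Ψ, hΨ, hΓ⟩ := exists_isGradedPresentation (hΨ₀.isGradedPresentation L) hK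
  obtain ⟨ρ, hρ, hdual⟩ := exists_isYonedaDual_of_yoneda hΨ hρ₀
  exact ⟨TwoSidedIdeal.ker ρ, hρ.isPresentation 𝒜 (exists_forall_eq_bot_of_finite 𝒜),
    hdual.isHomogeneous_of_dual L (exists_forall_eq_bot_of_finite 𝒜) _
      (hΓ _ (isHomogeneous_homotopyDegree K))⟩

end Main

theorem mainTheorem4 {k : Type u} [Field k] [IsAlgClosed k] {A : Type v} [Ring A] [Algebra k A]
    [Module.Finite k A] (𝒜 : ℕ → Submodule k A) [GradedAlgebra 𝒜]
    (hA : IsGradedQuiverAlgebra 𝒜) (hKoszul : IsKoszulAlgebra 𝒜)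
    (hgl : HasFiniteGlobalDimension A) :
    IsSimplyConnectedAlgebra k A ↔ IsSimplyConnectedAlgebra k (YonedaAlgebra 𝒜) := by
  constructor
  · rintro ⟨⟨V, i1, i2, i3, I, hI⟩, h⟩
    obtain ⟨K, hK, -⟩ := exists_isPresentation_yoneda hA hKoszul hgl hI
    refine ⟨⟨V, i1, i2, i3, K, hK⟩, fun V _ _ _ K hK => ?_⟩
    -- The companion lives on the same quiver, and its ideal is homogeneous for the homotopy classes
    -- of `K`; its trivial fundamental group therefore maps onto that of `K`.
    obtain ⟨I, hI, hΓ⟩ := exists_isPresentation_of_yoneda hA hKoszul hK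
    obtain ⟨h1, h2, h3⟩ := h V I hI
    exact ⟨h1, h2, fun x => subsingleton_fundamentalGroup_of_isHomogeneous hΓ x (h3 x)⟩
  · rintro ⟨⟨V, i1, i2, i3, K, hK⟩, h⟩
    obtain ⟨I, hI, -⟩ := exists_isPresentation_of_yoneda hA hKoszul hK
    refine ⟨⟨V, i1, i2, i3, I, hI⟩, fun V _ _ _ I hI => ?_⟩
    obtain ⟨K, hK, hΓ⟩ := exists_isPresentation_yoneda hA hKoszul hgl hI
    obtain ⟨h1, h2, h3⟩ := h V K hK
    exact ⟨h1, h2, fun x => subsingleton_fundamentalGroup_of_isHomogeneous hΓ x (h3 x)⟩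

end
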